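/- **Model.** Programs are finite while-programs over finitely many integer arrays (indices may be computed) with the operations $+,-,\times$ and integer division, an instruction that tosses one fair coin, and bit-cost time: accessing a number costs its binary length plus that of its index, and an arithmetic operation costs the product of the (incremented) lengths of its operands. A database is a finite list $x=(x_1,\dots,x_n)$ of vectors in $\{0,1\}^d$; $\mathrm{sum}(x)=\sum_i x_i\in\mathbb R^d$. The insert–delete distance $d_{\mathrm{ID}}(x,x')$ is the least number of insertions and deletions of entries that turn $x$ into $x'$. A randomized map $M$ from databases to $\mathbb R^d$ is $\varepsilon$-DP if $\Pr[M(x)\in S]\le e^{\varepsilon}\Pr[M(x')\in S]$ whenever $d_{\mathrm{ID}}(x,x')\le 1$ and $S$ is measurable; it is $(\alpha,\beta)$-accurate if $\Pr[\|M(x)-\mathrm{sum}(x)\|_\infty>\alpha]\le\beta$ for every $x$. $R(M)$ is the supremum over all $x$ of the expected number of coins tossed on input $x$. **Theorem.** There are a single program, a constant $C$ and exponents $a,b\in\mathbb N$ such that the following holds for all integers $d,s\ge 1$ and all real $\varepsilon>0$ with $d/\varepsilon>10$. On input $d$, $s$, $\lceil d/\varepsilon\rceil$ and a database $x$ of $n$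 vectors in $\{0,1\}^d$, the program halts with probability $1$ and outputs a vector $M(x)\in\mathbb Z^d\subset\mathbb R^d$, where 1. the expected running time is at most $C\,(n+d+\ln s+\max\{\ln\frac1\varepsilon,0\})^{a}$, that is, $\mathrm{poly}(n,d,\log s,\log\frac1\varepsilon)$; 2. $M$ is $\varepsilon$-DP; 3. $R(M)\le C\left(\frac ds\,\ln^{b}\frac d\varepsilon+\ln s\right)$; 4. for every $\beta\in(0,1]$, $M$ is $(\alpha,\beta)$-accurate with $$\alpha=C\left(\frac{d\ln(d/\beta)}{\varepsilon}+\frac{s\ln s\cdot d\ln(d/\varepsilon)}{\varepsilon}\right).$$ In particular, for $s=\lceil d\,\ln^{b}(d/\varepsilon)\rceil$ the same program has expected running time at most $C\,(n+d+\max\{\ln\frac1\varepsilon,0\})^{a}$, satisfies $R(M)\le C\left(\ln d+\ln\ln\frac d\varepsilon\right)$, and for every $\beta\in(0,1]$ is $(\alpha,\beta)$-accurate with $$\alpha=C\left(\frac{d\ln(d/\beta)}{\varepsilon}+\frac{d^2\,\ln^{a}\!\big(d/\min\{1,\varepsilon\}\big)}{\varepsilon}\right).$$ -/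

import Mathlib

open MeasureTheory
open scoped ENNReal

/-! ## Randomized programs with bit-cost accounting

A program is a finite piece of syntax over a random access memory that holds integers. Every
elementary operation is charged according to the bit lengths of the integers it touches, and the
only source of randomness is an instruction that tosses one fair coin. -/

namespace RandProg

/-- The number of binary digits of `|z|`. -/
def bitLen (z : ℤ) : ℕ := z.natAbs.size

/-- The memory consists of arrays `0, 1, 2, …`, each with integer cells `0, 1, 2, …`. A program
names arrays by constants, so it uses only finitely many of them; indices are computed. -/
abbrev Memory := ℕ → ℕ → ℤ

/-- The arithmetic operations. -/
inductive Op
  | plus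
  | minus
  | times
  | quot

/-- Integer division rounds down for a positive divisor; division by `0` gives `0`. -/
def Op.apply : Op → ℤ → ℤ → ℤ
  | .plus, x, y => x + y
  | .minus, x, y => x - y
  | .times, x, y => x * y
  | .quot, x, y => x / y

/-- Arithmetic terms: constants, the content of cell `i` of array `a`, and operations. -/
inductive Arith
  | const (k : ℤ)
  | cell (a : ℕ) (i : Arith)
  | bin (o : Op) (e f : Arith)

/-- The value of a term (a negative index is read as `0`). -/
def Arith.val (m : Memory) : Arith → ℤ
  | .const k => k
  | .cell a i => m a (i.val m).toNat
  | .bin o e f => o.apply (e.val m) (f.val m)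

/-- The number of bit operations charged for evaluating a term: reading a number costs its length,
an access to memory also costs the length of the index, and an arithmetic operation costs the
product of the lengths of its operands (each length increased by one), as for the schoolbook
algorithms. -/
def Arith.cost (m : Memory) : Arith → ℕ
  | .const k => 1 + bitLen k
  | .cell a i => i.cost m + 1 + bitLen (i.val m) + bitLen (m a (i.val m).toNat)
  | .bin _ e f =>
      e.cost m + f.cost m + (bitLen (e.val m) + 1) * (bitLen (f.val m) + 1)

/-- Commands: do nothing, write the value of `e` into cell `i` of array `a`, write a fair random
bit into cell `i` of array `a`, sequential composition, `if 0 < e then p else q`, and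
`while 0 < e do p`. -/
inductive Cmd
  | skip
  | assign (a : ℕ) (i e : Arith)
  | toss (a : ℕ) (i : Arith)
  | seq (p q : Cmd)
  | branch (e : Arith) (p q : Cmd)
  | loop (e : Arith) (p : Cmd)

/-- The memory, together with the time spent and the number of random bits used so far. -/
structure State where
  mem : Memory
  time : ℕ
  bits : ℕ

/-- Every set of states is measurable (all measures below are countable sums of point masses). -/
instance : MeasurableSpace State := ⊤

/-- Let `t` units of time pass. -/
def State.tick (σ : State) (t : ℕ) : State := { σ with time := σ.time + t }

/-- Write `z` into cell `i` of array `a`. -/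
def State.write (σ : State) (a i : ℕ) (z : ℤ) : State :=
  { σ with mem := Function.update σ.mem a (Function.update (σ.mem a) i z) }

/-- The state after writing the random bit `z` into the cell of array `a` given by `i`. -/
def State.tossed (σ : State) (a : ℕ) (i : Arith) (z : ℤ) : State :=
  { mem := (σ.write a (i.val σ.mem).toNat z).mem
    time := σ.time + (i.cost σ.mem + 1 + bitLen (i.val σ.mem))
    bits := σ.bits + 1 }

/-- The distribution of the final state of the runs of `while 0 < e do body` that execute the body
exactly `k` times. -/
noncomputable def unroll (e : Arith) (body : State → Measure State) :
    ℕ → State → Measure State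
  | 0, σ =>
      if 0 < e.val σ.mem then 0 else Measure.dirac (σ.tick (e.cost σ.mem + 1))
  | k + 1, σ =>
      if 0 < e.val σ.mem then
        (body (σ.tick (e.cost σ.mem + 1))).bind (unroll e body k)
      else 0

/-- The distribution of the final state when a command is started in a given state. It is a
measure of total mass at most one; the missing mass is the probability that the command runs
forever. -/
noncomputable def Cmd.denote : Cmd → State → Measure State
  | .skip => fun σ => Measure.dirac (σ.tick 1)
  | .assign a i e => fun σ =>
      Measure.dirac
        ((σ.write a (i.val σ.mem).toNat (e.val σ.mem)).tick
          (i.cost σ.mem + e.cost σ.mem + 1 + bitLen (i.val σ.mem) + bitLen (e.val σ.mem)))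
  | .toss a i => fun σ =>
      (2⁻¹ : ℝ≥0∞) • Measure.dirac (σ.tossed a i 0) +
        (2⁻¹ : ℝ≥0∞) • Measure.dirac (σ.tossed a i 1)
  | .seq p q => fun σ => (p.denote σ).bind q.denote
  | .branch e p q => fun σ =>
      if 0 < e.val σ.mem then p.denote (σ.tick (e.cost σ.mem + 1))
      else q.denote (σ.tick (e.cost σ.mem + 1))
  | .loop e p => fun σ => Measure.sum fun k => unroll e p.denote k σ

end RandProg

/-! ## Private summation -/

namespace PrivateSum

open RandProg

/-- A record is an element of `{0,1}^d`; a database is a finite list of records. -/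
abbrev Record (d : ℕ) := Fin d → Bool

/-- `sum(x) = x_1 + … + x_n`, a vector in `ℝ^d`. -/
def total {d : ℕ} (x : List (Record d)) : Fin d → ℝ :=
  fun j => (x.map fun r => if r j then (1 : ℝ) else 0).sum

/-- One insertion or one deletion. -/
inductive Edit {X : Type*} : List X → List X → Prop
  | insertion (l : List X) (a : X) (r : List X) : Edit (l ++ r) (l ++ a :: r)
  | deletion (l : List X) (a : X) (r : List X) : Edit (l ++ a :: r) (l ++ r)

/-- `x` can be transformed into `y` by exactly `k` insertions and deletions. -/
def EditChain {X : Type*} : ℕ → List X → List X → Prop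
  | 0, x, y => x = y
  | k + 1, x, y => ∃ z, Edit x z ∧ EditChain k z y

/-- The insert-delete distance: the least number of insertions and deletions that transform
`x` into `y`. -/
noncomputable def insertDeleteDist {X : Type*} (x y : List X) : ℕ∞ :=
  ⨅ (k : ℕ) (_ : EditChain k x y), (k : ℕ∞)

/-- `(ε, δ)`-differential privacy with respect to the insert-delete distance; `M x` is the
distribution of the output on the database `x`. -/
def IsDP {X Y : Type*} [MeasurableSpace Y] (ε δ : ℝ) (M : List X → Measure Y) : Prop :=
  ∀ x x' : List X, insertDeleteDist x x' ≤ 1 → ∀ S : Set Y, MeasurableSet S →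
    M x S ≤ ENNReal.ofReal (Real.exp ε) * M x' S + ENNReal.ofReal δ

/-- `(α, β)`-accuracy for summation (the norm on `Fin d → ℝ` is the maximum norm). -/
def IsAccurate {d : ℕ} (α β : ℝ) (M : List (Record d) → Measure (Fin d → ℝ)) : Prop :=
  ∀ x : List (Record d), M x {y | α < ‖y - total x‖} ≤ ENNReal.ofReal β

/-- The input of a program: array `0` holds the parameters `d`, `s`, `⌈d/ε⌉` and the number `n` of
records, and cell `i * d + j` of array `1` holds coordinate `j` of record `i`. (The real number `ε`
is thus handed to the program through the integer `⌈d/ε⌉`.) All other cells are `0`. -/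
noncomputable def inputMemory (d s : ℕ) (ε : ℝ) (x : List (Record d)) : Memory
  | 0, 0 => d
  | 0, 1 => s
  | 0, 2 => ⌈(d : ℝ) / ε⌉
  | 0, 3 => x.length
  | 1, k =>
      if h : 0 < d then
        if (x.getD (k / d) fun _ => false) ⟨k % d, Nat.mod_lt k h⟩ then 1 else 0
      else 0
  | _, _ => 0

/-- The distribution of the final state of the program on the given parameters and database. -/
noncomputable def finalState (P : Cmd) (d s : ℕ) (ε : ℝ) (x : List (Record d)) :
    Measure State :=
  P.denote { mem := inputMemory d s ε x, time := 0, bits := 0 }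

/-- The program halts with probability one. -/
def HaltsAlmostSurely (P : Cmd) (d s : ℕ) (ε : ℝ) (x : List (Record d)) : Prop :=
  IsProbabilityMeasure (finalState P d s ε x)

/-- The mechanism computed by the program: the output vector is found in array `2`. -/
noncomputable def mechanism (P : Cmd) (d s : ℕ) (ε : ℝ) (x : List (Record d)) :
    Measure (Fin d → ℝ) :=
  (finalState P d s ε x).map fun σ j => (σ.mem 2 (j : ℕ) : ℝ)

/-- The expected running time on the database `x`, for a program that halts almost surely. -/
noncomputable def expectedTime (P : Cmd) (d s : ℕ) (ε : ℝ) (x : List (Record d)) : ℝ≥0∞ :=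
  ∫⁻ σ, (σ.time : ℝ≥0∞) ∂(finalState P d s ε x)

/-- The expected randomness complexity: the supremum over all databases of the expected number of
random bits used, for a program that halts almost surely. -/
noncomputable def randomness (P : Cmd) (d s : ℕ) (ε : ℝ) : ℝ≥0∞ :=
  ⨆ x : List (Record d), ∫⁻ σ, (σ.bits : ℝ≥0∞) ∂(finalState P d s ε x)

end PrivateSum

/-! ### Expectations over program runs -/

namespace RandProg

/-! Put K = ⌈d/ε⌉ and L = 4K. The mechanism adds noise to the vector of column sums and then rounds.
The noise is uniform on an integer cube of random radius R = L(J+1) + I, where J is geometric and I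
is uniform below L. For s > 1 every noisy coordinate is shifted by uL, with u uniform below s, and
rounded down to a multiple of W = sL. For s = 1 the width is 1 and the shift is 0, so nothing is
rounded.

Privacy. The radius L + q has weight 2^-(q/L+1)/L, and the cube has (2(L+q)+1)^d points. The noise
density at a vector of maximum norm ρ is therefore a tail sum of the quotients of these two
quantities. Over a stretch of at most L radii such a quotient loses at most a factor 2 from the
weight and e^(d/L) per step from the volume. Hence a single term is at most (e^ε - 1) times the
terms after it, and increasing ρ by one costs a factor of at most e^ε (`noiseDensity_le`). One edit
moves every column sum by at most 1; u does not depend on the data, and rounding is postprocessing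
(`isDP_program`).

Randomness. After u and J are drawn, every possible radius is below L(J+2). A column whose shifted
sum has no multiple of W within this reach is rounded to the same value whatever its noise
(`rnd_eq_of_near_eq_zero`), so no coins are tossed for it; the fine part I is drawn only if some
column needs it. Over all u, the numbers of multiples of W within reach add up to exactly 2(J+2), by
Hermite's identity (`sum_near`), so a column needs coins with probability at most 2(J+2)/s.
Averaging over J gives O((d/s) log K) bits for the noise (`tsum_geo_noiseBits_le`), besides O(log s)
for u and O(1) for J.

Accuracy. The noise is at most L(J+2), the rounding error is at most W, and J exceeds q with
probability 2^-(q+1) (`mechanism_lt_norm_le`). This fails to suffice only for s = d = 1 and β > 1/2,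
where the permitted error may be below any fixed multiple of L; there the density of the noise near
0 is used (`mechanism_lt_norm_le_of_one`).

Program. The bulk of the file derives the output law, the expected time and the expected number of
coins of the concrete program. `Runs` records the three facts and is composed along the syntax; the
random loops are covered by `Runs.retry` (rejection) and `Runs.geometric`. Times follow from a bound
on the length of all numbers in memory, which may grow by one digit per noise level. The law is
always stated as if all noise had been drawn, so that `lintegral_output` is free of the coin saving.
-/

theorem measurable_of_state {β : Type*} [MeasurableSpace β] (f : State → β) : Measurable f :=
  fun _ _ => trivial

theorem lintegral_denote_seq (p q : Cmd) (σ : State) (f : State → ℝ≥0∞) :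
    ∫⁻ τ, f τ ∂((Cmd.seq p q).denote σ) = ∫⁻ ρ, ∫⁻ τ, f τ ∂(q.denote ρ) ∂(p.denote σ) :=
  Measure.lintegral_bind (measurable_of_state _).aemeasurable (measurable_of_state _).aemeasurable

theorem lintegral_dirac_state (σ : State) (f : State → ℝ≥0∞) :
    ∫⁻ τ, f τ ∂(Measure.dirac σ) = f σ :=
  lintegral_dirac' _ (measurable_of_state f)

theorem denote_loop_of_not {e : Arith} {p : Cmd} {σ : State} (h : ¬ 0 < e.val σ.mem) :
    (Cmd.loop e p).denote σ = Measure.dirac (σ.tick (e.cost σ.mem + 1)) := by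
  ext S hS
  simp only [Cmd.denote]
  rw [Measure.sum_apply _ hS, tsum_eq_single 0]
  · simp [unroll, h]
  · rintro (_ | k) hk
    · exact absurd rfl hk
    · simp [unroll, h]

theorem denote_loop_of_pos {e : Arith} {p : Cmd} {σ : State} (h : 0 < e.val σ.mem) :
    (Cmd.loop e p).denote σ
      = (Cmd.seq p (Cmd.loop e p)).denote (σ.tick (e.cost σ.mem + 1)) := by
  ext S hS
  simp only [Cmd.denote]
  rw [Measure.sum_apply _ hS, Measure.bind_apply hS (measurable_of_state _).aemeasurable,
    tsum_eq_zero_add' ENNReal.summable]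
  simp only [unroll, h, if_true]
  simp only [Measure.coe_zero, Pi.zero_apply, zero_add]
  rw [← lintegral_congr (fun τ => (Measure.sum_apply (fun k => unroll e p.denote k τ) hS).symm),
    lintegral_tsum (fun _ => (measurable_of_state _).aemeasurable)]
  refine tsum_congr fun k => ?_
  rw [Measure.bind_apply hS (measurable_of_state _).aemeasurable]

/-- Upper bounds for loops: a function that decreases in expectation along every iteration
dominates the expectation at the exit. -/
theorem lintegral_loop_le {e : Arith} {p : Cmd} {f I : State → ℝ≥0∞}
    (hexit : ∀ σ, ¬ 0 < e.val σ.mem → f (σ.tick (e.cost σ.mem + 1)) ≤ I σ)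
    (hstep : ∀ σ, 0 < e.val σ.mem → ∫⁻ τ, I τ ∂(p.denote (σ.tick (e.cost σ.mem + 1))) ≤ I σ)
    (σ : State) : ∫⁻ τ, f τ ∂((Cmd.loop e p).denote σ) ≤ I σ := by
  simp only [Cmd.denote]
  rw [lintegral_sum_measure, ENNReal.tsum_eq_iSup_nat]
  refine iSup_le fun n => ?_
  -- Only runs with fewer than n iterations are counted; the bound holds for each n and from every
  -- state, so no termination argument is needed.
  induction n generalizing σ with
  | zero => simp
  | succ n ih =>
    by_cases h : 0 < e.val σ.mem
    · rw [Finset.sum_range_succ']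
      simp only [unroll, h, if_true, lintegral_zero_measure, add_zero]
      refine le_trans (le_of_eq ?_) ((lintegral_mono fun τ => ih τ).trans (hstep σ h))
      rw [lintegral_finsetSum _ (fun _ _ => measurable_of_state _)]
      refine Finset.sum_congr rfl fun k _ => ?_
      exact Measure.lintegral_bind (measurable_of_state _).aemeasurable
        (measurable_of_state _).aemeasurable
    · rw [Finset.sum_range_succ']
      simp only [unroll, h, if_false, lintegral_zero_measure, Finset.sum_const_zero, zero_add]
      rw [lintegral_dirac_state]
      exact hexit σ h

/-! ### A calculus of deterministic and random runs -/

/-- Started with memory `m`, the command `c` deterministically reaches memory `m'` within `T` time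
units. -/
def Det (c : Cmd) (m m' : Memory) (T : ℕ) : Prop :=
  ∀ t b, ∃ t', c.denote ⟨m, t, b⟩ = Measure.dirac ⟨m', t', b⟩ ∧ t' ≤ t + T

/-- Started with memory `m`, the command `c` halts almost surely and reaches memory `μ a` with
probability `w a`; the expected time is at most `T`, the expected number of random bits is at
most `B`. -/
structure Runs {α : Type} (c : Cmd) (m : Memory) (w : α → ℝ≥0∞) (μ : α → Memory)
    (T B : ℝ≥0∞) : Prop where
  law : ∀ t b (G : Memory → ℝ≥0∞),
    ∫⁻ σ, G σ.mem ∂(c.denote ⟨m, t, b⟩) = ∑' a, w a * G (μ a)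
  time : ∀ t b, ∫⁻ σ, (σ.time : ℝ≥0∞) ∂(c.denote ⟨m, t, b⟩) ≤ t + T
  bits : ∀ t b, ∫⁻ σ, (σ.bits : ℝ≥0∞) ∂(c.denote ⟨m, t, b⟩) ≤ b + B

theorem Det.mono {c : Cmd} {m m' : Memory} {T T' : ℕ} (h : Det c m m' T) (hT : T ≤ T') :
    Det c m m' T' := fun t b => by
  obtain ⟨t', h1, h2⟩ := h t b
  exact ⟨t', h1, by omega⟩

theorem Det.seq {p q : Cmd} {m m' m'' : Memory} {T T' : ℕ} (hp : Det p m m' T)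
    (hq : Det q m' m'' T') : Det (.seq p q) m m'' (T + T') := fun t b => by
  obtain ⟨t₁, h1, h2⟩ := hp t b
  obtain ⟨t₂, h3, h4⟩ := hq t₁ b
  refine ⟨t₂, ?_, by omega⟩
  simp only [Cmd.denote]
  rw [h1, Measure.dirac_bind (measurable_of_state _), h3]

theorem Det.branch_pos {e : Arith} {p q : Cmd} {m m' : Memory} {T : ℕ} (h : 0 < e.val m)
    (hp : Det p m m' T) : Det (.branch e p q) m m' (e.cost m + 1 + T) := fun t b => by
  obtain ⟨t', h1, h2⟩ := hp (t + (e.cost m + 1)) b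
  refine ⟨t', ?_, by omega⟩
  rw [← h1]
  simp only [Cmd.denote, h, if_true, State.tick]

theorem Det.branch_not {e : Arith} {p q : Cmd} {m m' : Memory} {T : ℕ} (h : ¬ 0 < e.val m)
    (hq : Det q m m' T) : Det (.branch e p q) m m' (e.cost m + 1 + T) := fun t b => by
  obtain ⟨t', h1, h2⟩ := hq (t + (e.cost m + 1)) b
  refine ⟨t', ?_, by omega⟩
  rw [← h1]
  simp only [Cmd.denote, h, if_false, State.tick]

theorem Det.loop_not {e : Arith} {p : Cmd} {m : Memory} (h : ¬ 0 < e.val m) :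
    Det (.loop e p) m m (e.cost m + 1) := fun t _ =>
  ⟨t + (e.cost m + 1), denote_loop_of_not h, le_rfl⟩

theorem Det.loop_pos {e : Arith} {p : Cmd} {m m' m'' : Memory} {T T' : ℕ} (h : 0 < e.val m)
    (hp : Det p m m' T) (hl : Det (.loop e p) m' m'' T') :
    Det (.loop e p) m m'' (e.cost m + 1 + (T + T')) := fun t b => by
  obtain ⟨t', h1, h2⟩ := hp.seq hl (t + (e.cost m + 1)) b
  exact ⟨t', (denote_loop_of_pos (σ := ⟨m, t, b⟩) h).trans h1, by omega⟩

section Runs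

variable {α β : Type} {c p q : Cmd} {m m' : Memory} {w : α → ℝ≥0∞} {μ : α → Memory}
  {T B T' B' : ℝ≥0∞}

theorem Runs.mono (h : Runs c m w μ T B) (hT : T ≤ T') (hB : B ≤ B') : Runs c m w μ T' B' :=
  ⟨h.law, fun t b => (h.time t b).trans (by gcongr), fun t b => (h.bits t b).trans (by gcongr)⟩

theorem Runs.congr_law {w' : β → ℝ≥0∞} {μ' : β → Memory} (h : Runs c m w μ T B)
    (hw : ∀ G : Memory → ℝ≥0∞, ∑' a, w a * G (μ a) = ∑' b, w' b * G (μ' b)) :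
    Runs c m w' μ' T B :=
  ⟨fun t b G => (h.law t b G).trans (hw G), h.time, h.bits⟩

theorem Det.runs {n : ℕ} (h : Det c m m' n) : Runs c m (fun _ : Unit => 1) (fun _ => m') n 0 := by
  refine ⟨fun t b G => ?_, fun t b => ?_, fun t b => ?_⟩ <;>
    obtain ⟨t', h1, h2⟩ := h t b <;> rw [h1, lintegral_dirac_state]
  · simp
  · exact_mod_cast h2
  · simp

theorem Runs.delay {n : ℕ} (hc : ∀ t b, c.denote ⟨m, t, b⟩ = p.denote ⟨m, t + n, b⟩)
    (h : Runs p m w μ T B) : Runs c m w μ (n + T) B := by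
  refine ⟨fun t b G => ?_, fun t b => ?_, fun t b => ?_⟩ <;> rw [hc]
  · exact h.law _ _ G
  · refine (h.time _ _).trans (le_of_eq ?_)
    push_cast
    ring
  · exact h.bits _ _

theorem Runs.loop_pos {e : Arith} (hpos : 0 < e.val m) (h : Runs (.seq p (.loop e p)) m w μ T B) :
    Runs (.loop e p) m w μ ((e.cost m + 1 : ℕ) + T) B :=
  h.delay fun t b => denote_loop_of_pos (σ := ⟨m, t, b⟩) hpos

/-- The law is applied to the indicator of the memories that are not listed with nonzero weight; its
expectation is 0. -/
theorem Runs.ae_mem (h : Runs p m w μ T B) (t b : ℕ) :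
    ∀ᵐ σ ∂(p.denote ⟨m, t, b⟩), ∃ a, w a ≠ 0 ∧ μ a = σ.mem := by
  classical
  have h0 := h.law t b (fun m' => if ∃ a, w a ≠ 0 ∧ μ a = m' then 0 else 1)
  have hz : ∑' a, w a * (if ∃ a', w a' ≠ 0 ∧ μ a' = μ a then (0 : ℝ≥0∞) else 1) = 0 := by
    refine ENNReal.tsum_eq_zero.2 fun a => ?_
    by_cases ha : w a = 0
    · simp [ha]
    · rw [if_pos ⟨a, ha, rfl⟩, mul_zero]
  rw [hz, lintegral_eq_zero_iff (measurable_of_state _)] at h0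
  filter_upwards [h0] with σ hσ
  by_contra hn
  simp [hn] at hσ

/-- The law controls functions of the memory only, while F may also involve the clock and the bit
counter. The excess of F over g is therefore bounded by an infimum of H over the labels of the
current memory, which is a function of the memory even if μ is not injective. -/
theorem Runs.lintegral_le_of {F : State → ℝ≥0∞} {H : α → ℝ≥0∞} {g : State → ℝ≥0∞}
    (h : Runs p m w μ T B) (t b : ℕ)
    (hF : ∀ a, w a ≠ 0 → ∀ σ : State, σ.mem = μ a → F σ ≤ g σ + H a) :
    ∫⁻ σ, F σ ∂(p.denote ⟨m, t, b⟩) ≤ ∫⁻ σ, g σ ∂(p.denote ⟨m, t, b⟩) + ∑' a, w a * H a := by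
  have key : ∀ σ, F σ ≤ g σ + ⨅ a : {a : α // w a ≠ 0 ∧ μ a = σ.mem}, H a.1 := by
    intro σ
    rw [ENNReal.add_iInf]
    exact le_iInf fun a => hF a.1 a.2.1 σ a.2.2.symm
  refine (lintegral_mono key).trans ?_
  rw [lintegral_add_left (measurable_of_state _)]
  gcongr
  rw [h.law t b (fun m' => ⨅ a : {a : α // w a ≠ 0 ∧ μ a = m'}, H a.1)]
  refine ENNReal.tsum_le_tsum fun a => ?_
  by_cases ha : w a = 0
  · simp [ha]
  · gcongr
    exact iInf_le_of_le ⟨a, ha, rfl⟩ le_rfl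

theorem Runs.seq {w₂ : α → β → ℝ≥0∞} {μ₂ : α → β → Memory} {T₂ B₂ : α → ℝ≥0∞}
    (hp : Runs p m w μ T B)
    (hq : ∀ a, w a ≠ 0 → Runs q (μ a) (w₂ a) (μ₂ a) (T₂ a) (B₂ a)) :
    Runs (.seq p q) m (fun ab : α × β => w ab.1 * w₂ ab.1 ab.2) (fun ab => μ₂ ab.1 ab.2)
      (T + ∑' a, w a * T₂ a) (B + ∑' a, w a * B₂ a) := by
  refine ⟨fun t b G => ?_, fun t b => ?_, fun t b => ?_⟩ <;> rw [lintegral_denote_seq]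
  · have hae : ∀ᵐ σ ∂(p.denote ⟨m, t, b⟩), ∫⁻ τ, G τ.mem ∂(q.denote σ)
        = (fun m' => ∫⁻ τ, G τ.mem ∂(q.denote ⟨m', 0, 0⟩)) σ.mem := by
      filter_upwards [hp.ae_mem t b] with σ hσ
      obtain ⟨a, ha, haσ⟩ := hσ
      obtain ⟨mm, tt, bb⟩ := σ
      simp only at haσ ⊢
      rw [← haσ, (hq a ha).law, (hq a ha).law]
    rw [lintegral_congr_ae hae,
      hp.law t b (fun m' => ∫⁻ τ, G τ.mem ∂(q.denote ⟨m', 0, 0⟩)), ENNReal.tsum_prod']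
    refine tsum_congr fun a => ?_
    by_cases ha : w a = 0
    · simp [ha]
    · simp_rw [(hq a ha).law, mul_assoc]
      rw [ENNReal.tsum_mul_left]
  · refine (hp.lintegral_le_of t b (g := fun σ => (σ.time : ℝ≥0∞)) (H := T₂) ?_).trans ?_
    · rintro a ha ⟨mm, tt, bb⟩ rfl
      exact (hq a ha).time _ _
    · rw [← add_assoc]
      gcongr
      exact hp.time t b
  · refine (hp.lintegral_le_of t b (g := fun σ => (σ.bits : ℝ≥0∞)) (H := B₂) ?_).trans ?_
    · rintro a ha ⟨mm, tt, bb⟩ rfl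
      exact (hq a ha).bits _ _
    · rw [← add_assoc]
      gcongr
      exact hp.bits t b

theorem Det.seq_runs {n : ℕ} (hp : Det p m m' n) (hq : Runs q m' w μ T B) :
    Runs (.seq p q) m w μ (n + T) B := by
  have h := hp.runs.seq (q := q) (fun _ _ => hq)
  refine (h.congr_law (w' := w) (μ' := μ) fun G => ?_).mono (by simp) (by simp)
  rw [ENNReal.tsum_prod']
  simp

theorem Runs.seq_det {n : ℕ} {μ' : α → Memory} (hp : Runs p m w μ T B) (hw : ∑' a, w a = 1)
    (hq : ∀ a, w a ≠ 0 → Det q (μ a) (μ' a) n) : Runs (.seq p q) m w μ' (T + n) B := by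
  have h := hp.seq (q := q) (fun a ha => (hq a ha).runs)
  refine (h.congr_law (w' := w) (μ' := μ') fun G => ?_).mono ?_ (by simp)
  · rw [ENNReal.tsum_prod']
    simp
  · rw [ENNReal.tsum_mul_right, hw, one_mul]

/-- Φ is a potential for the remaining time: the sum of clock and Φ must not increase in
expectation. -/
theorem Runs.loop_time_le {e : Arith} (Φ : Memory → ℝ≥0∞)
    (hexit : ∀ m, ¬ 0 < e.val m → (e.cost m + 1 : ℕ) ≤ Φ m)
    (hstep : ∀ m, 0 < e.val m → ∀ t b,
      ∫⁻ σ, (σ.time + Φ σ.mem) ∂(p.denote ⟨m, t, b⟩) + (e.cost m + 1 : ℕ) ≤ t + Φ m) (t b : ℕ) :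
    ∫⁻ σ, (σ.time : ℝ≥0∞) ∂((Cmd.loop e p).denote ⟨m, t, b⟩) ≤ t + Φ m := by
  refine lintegral_loop_le (I := fun σ => σ.time + Φ σ.mem) (fun σ h => ?_) (fun σ h => ?_) ⟨m, t, b⟩
  · have := hexit σ.mem h
    simp only [State.tick]
    push_cast at this ⊢
    gcongr
  · obtain ⟨mm, tt, bb⟩ := σ
    simp only [State.tick] at h ⊢
    have h1 := hstep mm h (tt + (e.cost mm + 1)) bb
    have hfin : ((e.cost mm + 1 : ℕ) : ℝ≥0∞) ≠ ∞ := ENNReal.natCast_ne_top _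
    refine (ENNReal.add_le_add_iff_right hfin).1 (h1.trans (le_of_eq ?_))
    push_cast
    ring

theorem Runs.loop_bits_le {e : Arith} (Φ : Memory → ℝ≥0∞)
    (hstep : ∀ m, 0 < e.val m → ∀ t b,
      ∫⁻ σ, (σ.bits + Φ σ.mem) ∂(p.denote ⟨m, t, b⟩) ≤ b + Φ m) (t b : ℕ) :
    ∫⁻ σ, (σ.bits : ℝ≥0∞) ∂((Cmd.loop e p).denote ⟨m, t, b⟩) ≤ b + Φ m :=
  lintegral_loop_le (I := fun σ => σ.bits + Φ σ.mem) (fun _ _ => le_self_add)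
    (fun σ h => hstep σ.mem h _ _) ⟨m, t, b⟩

/-- Repeating an experiment until its outcome is acceptable. -/
theorem Runs.retry {e : Arith} {x₀ : α} {q : ℝ≥0∞} {g : ℕ} (hw : ∑' a, w a = 1)
    (hg : ∀ a, w a ≠ 0 ∨ a = x₀ → e.cost (μ a) + 1 ≤ g)
    (hbody : ∀ a, w a ≠ 0 ∨ a = x₀ → 0 < e.val (μ a) → Runs p (μ a) w μ T B)
    (h₀ : 0 < e.val (μ x₀))
    (hq : q = ∑' a, if 0 < e.val (μ a) then 0 else w a) (hq0 : q ≠ 0) :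
    Runs (.loop e p) (μ x₀) (fun a => if 0 < e.val (μ a) then 0 else w a / q) μ
      ((T + g) / q + g) (B / q) := by
  classical
  -- The probability of rejection in one round.
  set r : ℝ≥0∞ := ∑' a, if 0 < e.val (μ a) then w a else 0 with hr
  have hqr : q + r = 1 := by
    rw [hq, hr, ← ENNReal.tsum_add, ← hw]
    refine tsum_congr fun a => ?_
    split_ifs <;> simp
  have hq1 : q ≠ ∞ := fun h => by simp [h] at hqr
  have hr1 : 1 - r = q := by
    rw [← hqr]
    refine ENNReal.add_sub_cancel_right fun h => by simp [h] at hqr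
  have hsum : ∀ (X Y : ℝ≥0∞), ∑' a, w a * (if 0 < e.val (μ a) then X else Y) = r * X + q * Y := by
    intro X Y
    rw [hr, hq, ← ENNReal.tsum_mul_right, ← ENNReal.tsum_mul_right, ← ENNReal.tsum_add]
    refine tsum_congr fun a => ?_
    split_ifs <;> simp
  -- X / q solves the renewal equation Y = rY + X, which governs mass, time and bits alike.
  have hmix : ∀ X : ℝ≥0∞, r * (X / q) + X = X / q := by
    intro X
    have : X = q * (X / q) := (ENNReal.mul_div_cancel hq0 hq1).symm
    nth_rw 2 [this]
    rw [← add_mul, add_comm r q, hqr, one_mul]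
  refine ⟨fun t b G => ?_, fun t b => ?_, fun t b => ?_⟩
  · set A : ℝ≥0∞ := ∑' a, (if 0 < e.val (μ a) then 0 else w a) * G (μ a) with hA
    have hgoal : ∑' a, (if 0 < e.val (μ a) then 0 else w a / q) * G (μ a) = A / q := by
      rw [hA, div_eq_mul_inv, ← ENNReal.tsum_mul_right]
      refine tsum_congr fun a => ?_
      split_ifs
      · simp
      · rw [div_eq_mul_inv]; ring
    have hsumG : ∀ X : ℝ≥0∞,
        ∑' a, w a * (if 0 < e.val (μ a) then X else G (μ a)) = r * X + A := by
      intro X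
      rw [hr, hA, ← ENNReal.tsum_mul_right, ← ENNReal.tsum_add]
      refine tsum_congr fun a => ?_
      split_ifs <;> simp
    rw [hgoal]
    apply le_antisymm
    -- The potential is infinite at unreachable memories, where the step inequality is then trivial.
    -- The start x₀ is admitted separately, since it need not have positive weight.
    · let Φ : Memory → ℝ≥0∞ := fun m' => if ∃ a, (w a ≠ 0 ∨ a = x₀) ∧ μ a = m' then
        (if 0 < e.val m' then A / q else G m') else ∞
      have hΦ : ∑' a, w a * Φ (μ a) = A / q := by
        rw [← hmix A, ← hsumG]
        refine tsum_congr fun a => ?_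
        by_cases ha : w a = 0
        · simp [ha]
        · simp only [Φ]
          rw [if_pos ⟨a, Or.inl ha, rfl⟩]
      have h1 := lintegral_loop_le (e := e) (p := p) (f := fun σ => G σ.mem)
        (I := fun σ => Φ σ.mem) (fun σ h => ?_) (fun σ h => ?_) ⟨μ x₀, t, b⟩
      · refine h1.trans (le_of_eq ?_)
        simp only [Φ]
        rw [if_pos ⟨x₀, Or.inr rfl, rfl⟩, if_pos h₀]
      · simp only [Φ, State.tick]
        split_ifs <;> simp
      · by_cases hex : ∃ a, (w a ≠ 0 ∨ a = x₀) ∧ μ a = σ.mem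
        · obtain ⟨a, ha, haσ⟩ := hex
          have hb := (hbody a ha (haσ ▸ h)).law (σ.time + (e.cost σ.mem + 1)) σ.bits Φ
          rw [haσ, hΦ] at hb
          refine hb.le.trans ?_
          simp only [Φ]
          rw [if_pos ⟨a, ha, haσ⟩, if_pos h]
        · simp only [Φ]
          rw [if_neg hex]
          exact le_top
    -- For the lower bound, n rounds already collect A times a partial geometric sum, and its limit
    -- is A / (1 - r) = A / q.
    · have hfix : ∀ n : ℕ, ∀ a, w a ≠ 0 ∨ a = x₀ → 0 < e.val (μ a) → ∀ t b,
          A * ∑ k ∈ Finset.range n, r ^ k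
            ≤ ∫⁻ σ, G σ.mem ∂((Cmd.loop e p).denote ⟨μ a, t, b⟩) := by
        intro n
        induction n with
        | zero => intro a _ _ t b; simp
        | succ n ih =>
          intro a ha hpos t b
          rw [denote_loop_of_pos (σ := ⟨μ a, t, b⟩) hpos, lintegral_denote_seq]
          let Ψ : Memory → ℝ≥0∞ := fun m' => if 0 < e.val m' then
            A * ∑ k ∈ Finset.range n, r ^ k else G m'
          have hb := (hbody a ha hpos).law (t + (e.cost (μ a) + 1)) b Ψ
          have hΨ : ∑' a, w a * Ψ (μ a) = A * ∑ k ∈ Finset.range (n + 1), r ^ k := by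
            have : A * ∑ k ∈ Finset.range (n + 1), r ^ k
                = r * (A * ∑ k ∈ Finset.range n, r ^ k) + A := by
              rw [Finset.sum_range_succ', mul_add, pow_zero, mul_one]
              simp_rw [pow_succ]
              rw [← Finset.sum_mul]
              ring
            rw [this, ← hsumG]
          rw [hΨ] at hb
          rw [← hb]
          have hae := (hbody a ha hpos).ae_mem (t + (e.cost (μ a) + 1)) b
          refine lintegral_mono_ae ?_
          filter_upwards [hae] with σ hσ
          obtain ⟨a', ha', haσ⟩ := hσ
          obtain ⟨mm, tt, bb⟩ := σ
          simp only at haσ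
          subst haσ
          simp only [Ψ]
          split_ifs with hg'
          · exact ih a' (Or.inl ha') hg' tt bb
          · rw [denote_loop_of_not (σ := ⟨μ a', tt, bb⟩) hg', lintegral_dirac_state]
            exact le_rfl
      have hlim : A / q = ⨆ n : ℕ, A * ∑ k ∈ Finset.range n, r ^ k := by
        rw [← ENNReal.mul_iSup, ← ENNReal.tsum_eq_iSup_nat, ENNReal.tsum_geometric, hr1,
          div_eq_mul_inv]
      rw [hlim]
      exact iSup_le fun n => hfix n x₀ (Or.inr rfl) h₀ t b
  -- There are 1/q rounds on average, each costing a guard and a body, and one final guard.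
  · let X : ℝ≥0∞ := (T + g) / q + g
    let Φ : Memory → ℝ≥0∞ := fun m' => if ∃ a, (w a ≠ 0 ∨ a = x₀) ∧ μ a = m' then
        (if 0 < e.val m' then X else g) else ∞
    have hΦ : ∑' a, w a * Φ (μ a) = r * X + q * g := by
      rw [← hsum]
      refine tsum_congr fun a => ?_
      by_cases ha : w a = 0
      · simp [ha]
      · simp only [Φ]
        rw [if_pos ⟨a, Or.inl ha, rfl⟩]
    have hX : T + g + (r * X + q * g) = X := by
      simp only [X]
      calc T + g + (r * ((T + g) / q + g) + q * g)
          = (r * ((T + g) / q) + (T + g)) + (q + r) * g := by ring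
        _ = _ := by rw [hmix, hqr, one_mul]
    have h1 := Runs.loop_time_le (p := p) (m := μ x₀) (e := e) Φ (fun m' h => ?_)
      (fun m' h t b => ?_) t b
    · refine h1.trans (le_of_eq ?_)
      simp only [Φ]
      rw [if_pos ⟨x₀, Or.inr rfl, rfl⟩, if_pos h₀]
    · simp only [Φ]
      split_ifs with hex
      · obtain ⟨a, ha, rfl⟩ := hex
        exact_mod_cast hg a ha
      · exact le_top
    · by_cases hex : ∃ a, (w a ≠ 0 ∨ a = x₀) ∧ μ a = m'
      · have hval : Φ m' = X := by
          simp only [Φ]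
          rw [if_pos hex, if_pos h]
        obtain ⟨a, ha, rfl⟩ := hex
        have hb := hbody a ha h
        rw [lintegral_add_left (measurable_of_state _), hb.law, hΦ, hval]
        calc _ ≤ (t : ℝ≥0∞) + T + (r * X + q * g) + g := by
              gcongr
              · exact hb.time t b
              · exact hg a ha
          _ = t + (T + g + (r * X + q * g)) := by ring
          _ ≤ _ := by rw [hX]
      · simp only [Φ]
        rw [if_neg hex]
        simp
  · let X : ℝ≥0∞ := B / q
    let Φ : Memory → ℝ≥0∞ := fun m' => if ∃ a, (w a ≠ 0 ∨ a = x₀) ∧ μ a = m' then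
        (if 0 < e.val m' then X else 0) else ∞
    have hΦ : ∑' a, w a * Φ (μ a) = r * X := by
      rw [← add_zero (r * X), ← mul_zero q, ← hsum]
      refine tsum_congr fun a => ?_
      by_cases ha : w a = 0
      · simp [ha]
      · simp only [Φ]
        rw [if_pos ⟨a, Or.inl ha, rfl⟩]
    have h1 := Runs.loop_bits_le (p := p) (m := μ x₀) (e := e) Φ (fun m' h t b => ?_) t b
    · refine h1.trans (le_of_eq ?_)
      simp only [Φ]
      rw [if_pos ⟨x₀, Or.inr rfl, rfl⟩, if_pos h₀]
    · by_cases hex : ∃ a, (w a ≠ 0 ∨ a = x₀) ∧ μ a = m'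
      · have hval : Φ m' = X := by
          simp only [Φ]
          rw [if_pos hex, if_pos h]
        obtain ⟨a, ha, rfl⟩ := hex
        have hb := hbody a ha h
        rw [lintegral_add_left (measurable_of_state _), hb.law, hΦ, hval]
        calc _ ≤ (b : ℝ≥0∞) + B + r * X := by
              gcongr
              exact hb.bits t b
          _ = b + (r * X + B) := by ring
          _ ≤ _ := by simp only [X]; rw [hmix]
      · simp only [Φ]
        rw [if_neg hex]
        simp

end Runs

/-! ### Costs in terms of the word length -/

/-- A weight that bounds the length of the value of a term, relative to the lengths in memory. -/
def Arith.lenWeight : Arith → ℕ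
  | .const k => bitLen k
  | .cell _ _ => 1
  | .bin _ e f => e.lenWeight + f.lenWeight + 1

/-- A weight that bounds the cost of a term, relative to the squared lengths in memory. -/
def Arith.costWeight : Arith → ℕ
  | .const k => 1 + bitLen k
  | .cell _ i => i.costWeight + i.lenWeight + 2
  | .bin _ e f => e.costWeight + f.costWeight + (e.lenWeight + 1) * (f.lenWeight + 1)

/-- All numbers in memory have at most `l` binary digits. -/
def Short (l : ℕ) (m : Memory) : Prop := ∀ a k, bitLen (m a k) ≤ l

theorem bitLen_le_iff {z : ℤ} {l : ℕ} : bitLen z ≤ l ↔ |z| < 2 ^ l := by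
  rw [bitLen, Nat.size_le, Int.abs_eq_natAbs]
  exact_mod_cast Iff.rfl

theorem bitLen_apply_le (o : Op) (x y : ℤ) : bitLen (o.apply x y) ≤ bitLen x + bitLen y + 1 := by
  have hx : |x| < 2 ^ bitLen x := bitLen_le_iff.1 le_rfl
  have hy : |y| < 2 ^ bitLen y := bitLen_le_iff.1 le_rfl
  have h2 : (2 : ℤ) ^ bitLen x + 2 ^ bitLen y ≤ 2 ^ (bitLen x + bitLen y + 1) := by
    have h3 : (1 : ℤ) ≤ 2 ^ bitLen x := one_le_pow₀ (by norm_num)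
    have h4 : (1 : ℤ) ≤ 2 ^ bitLen y := one_le_pow₀ (by norm_num)
    rw [pow_succ, pow_add]
    nlinarith
  rw [bitLen_le_iff]
  cases o with
  | plus => exact ((abs_add_le x y).trans_lt (add_lt_add hx hy)).trans_le h2
  | minus => exact ((abs_sub x y).trans_lt (add_lt_add hx hy)).trans_le h2
  | times =>
    simp only [Op.apply]
    rw [abs_mul]
    calc |x| * |y| ≤ 2 ^ bitLen x * 2 ^ bitLen y := by gcongr
      _ = 2 ^ (bitLen x + bitLen y) := (pow_add _ _ _).symm
      _ < _ := pow_lt_pow_right₀ (by norm_num) (Nat.lt_succ_self _)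
  | quot =>
    simp only [Op.apply]
    have h : |x / y| ≤ |x| := Int.abs_ediv_le_abs x y
    have h4 : (0 : ℤ) ≤ 2 ^ bitLen y := by positivity
    linarith

theorem Arith.bitLen_val_le {l : ℕ} {m : Memory} (hm : Short l m) (e : Arith) :
    bitLen (e.val m) ≤ e.lenWeight * (l + 1) := by
  induction e with
  | const k =>
    simp only [Arith.val, Arith.lenWeight]
    exact Nat.le_mul_of_pos_right _ (Nat.succ_pos l)
  | cell a i _ =>
    simp only [Arith.val, Arith.lenWeight]
    have := hm a (i.val m).toNat
    omega
  | bin o e f he hf =>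
    simp only [Arith.val, Arith.lenWeight]
    refine (bitLen_apply_le o _ _).trans ?_
    nlinarith

theorem Arith.cost_le {l : ℕ} {m : Memory} (hm : Short l m) (e : Arith) :
    e.cost m ≤ e.costWeight * (l + 1) ^ 2 := by
  have h1 : 1 ≤ (l + 1) ^ 2 := Nat.one_le_pow _ _ (Nat.succ_pos l)
  have h2 : l + 1 ≤ (l + 1) ^ 2 := Nat.le_self_pow (by norm_num) _
  induction e with
  | const k =>
    simp only [Arith.cost, Arith.costWeight]
    exact Nat.le_mul_of_pos_right _ h1
  | cell a i hi =>
    simp only [Arith.cost, Arith.costWeight]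
    have h3 := hm a (i.val m).toNat
    have h4 := (i.bitLen_val_le hm).trans (Nat.mul_le_mul_left i.lenWeight h2)
    rw [add_mul, add_mul]
    omega
  | bin o e f he hf =>
    simp only [Arith.cost, Arith.costWeight]
    have h3 : bitLen (e.val m) + 1 ≤ (e.lenWeight + 1) * (l + 1) := by
      have := e.bitLen_val_le hm
      rw [add_mul]
      omega
    have h4 : bitLen (f.val m) + 1 ≤ (f.lenWeight + 1) * (l + 1) := by
      have := f.bitLen_val_le hm
      rw [add_mul]
      omega
    have h5 := Nat.mul_le_mul h3 h4
    have h6 : (e.lenWeight + 1) * (l + 1) * ((f.lenWeight + 1) * (l + 1))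
      = (e.lenWeight + 1) * (f.lenWeight + 1) * (l + 1) ^ 2 := by ring
    have h7 : (e.costWeight + f.costWeight + (e.lenWeight + 1) * (f.lenWeight + 1)) * (l + 1) ^ 2
      = e.costWeight * (l + 1) ^ 2 + f.costWeight * (l + 1) ^ 2
        + (e.lenWeight + 1) * (f.lenWeight + 1) * (l + 1) ^ 2 := by ring
    rw [h7]
    omega

theorem Arith.guard_cost_le {l : ℕ} {m : Memory} (hm : Short l m) (e : Arith) :
    e.cost m + 1 ≤ (e.costWeight + 1) * (l + 1) ^ 2 := by
  have h1 : 1 ≤ (l + 1) ^ 2 := Nat.one_le_pow _ _ (Nat.succ_pos l)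
  have := e.cost_le hm
  rw [add_mul]
  omega

/-- Write `z` into cell `k` of array `a`. -/
def Memory.set (m : Memory) (a k : ℕ) (z : ℤ) : Memory :=
  Function.update m a (Function.update (m a) k z)

theorem Short.set {l : ℕ} {m : Memory} (hm : Short l m) (a k : ℕ) {z : ℤ} (hz : |z| < 2 ^ l) :
    Short l (Memory.set m a k z) := by
  intro a' k'
  simp only [Memory.set, Function.update_apply]
  split_ifs
  · simp only [Function.update_apply]
    split_ifs
    · exact bitLen_le_iff.2 hz
    · exact hm _ _
  · exact hm _ _

theorem Short.mono {l l' : ℕ} {m : Memory} (hm : Short l m) (h : l ≤ l') : Short l' m :=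
  fun a k => (hm a k).trans h

/-- A weight that bounds the time of one pass through a command, relative to the squared lengths
in memory. -/
def Cmd.weight : Cmd → ℕ
  | .skip => 1
  | .assign _ i e => i.costWeight + e.costWeight + i.lenWeight + e.lenWeight + 1
  | .toss _ i => i.costWeight + i.lenWeight + 1
  | .seq p q => p.weight + q.weight
  | .branch e p q => e.costWeight + 1 + p.weight + q.weight
  | .loop e p => e.costWeight + 1 + p.weight

theorem Det.assign {l : ℕ} {m m' : Memory} {a : ℕ} {i e : Arith} (k : ℕ) (z : ℤ)
    (hm : Short l m) (hi : i.val m = k) (hz : e.val m = z) (hm' : Memory.set m a k z = m') :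
    Det (.assign a i e) m m' ((Cmd.assign a i e).weight * (l + 1) ^ 2) := by
  intro t b
  refine ⟨t + (i.cost m + e.cost m + 1 + bitLen (k : ℤ) + bitLen z), ?_, ?_⟩
  · simp only [Cmd.denote, State.write, State.tick, hi, hz, Int.toNat_natCast]
    rw [← hm']
    rfl
  · have h1 : 1 ≤ (l + 1) ^ 2 := Nat.one_le_pow _ _ (Nat.succ_pos l)
    have h2 : l + 1 ≤ (l + 1) ^ 2 := Nat.le_self_pow (by norm_num) _
    have h3 := i.cost_le hm
    have h4 := e.cost_le hm
    have h5 := (i.bitLen_val_le hm).trans (Nat.mul_le_mul_left i.lenWeight h2)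
    have h6 := (e.bitLen_val_le hm).trans (Nat.mul_le_mul_left e.lenWeight h2)
    rw [hi] at h5
    rw [hz] at h6
    rw [Cmd.weight, add_mul, add_mul, add_mul, add_mul]
    omega

theorem Runs.toss {l : ℕ} {m : Memory} {a : ℕ} {i : Arith} (k : ℕ)
    (hm : Short l m) (hi : i.val m = k) :
    Runs (.toss a i) m (fun _ : Bool => 2⁻¹) (fun b => Memory.set m a k b.toNat)
      ((Cmd.toss a i).weight * (l + 1) ^ 2 : ℕ) 1 := by
  have h1 : 1 ≤ (l + 1) ^ 2 := Nat.one_le_pow _ _ (Nat.succ_pos l)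
  have h2 : l + 1 ≤ (l + 1) ^ 2 := Nat.le_self_pow (by norm_num) _
  have h3 := i.cost_le hm
  have h5 := (i.bitLen_val_le hm).trans (Nat.mul_le_mul_left i.lenWeight h2)
  have hhalf : ∀ x : ℝ≥0∞, 2⁻¹ * x + 2⁻¹ * x = x := fun x => by
    rw [← add_mul, ENNReal.inv_two_add_inv_two, one_mul]
  have key : ∀ t b (f : State → ℝ≥0∞), ∫⁻ σ, f σ ∂((Cmd.toss a i).denote ⟨m, t, b⟩)
      = 2⁻¹ * f (State.tossed ⟨m, t, b⟩ a i 0) + 2⁻¹ * f (State.tossed ⟨m, t, b⟩ a i 1) := by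
    intro t b f
    simp only [Cmd.denote]
    rw [lintegral_add_measure, lintegral_smul_measure, lintegral_smul_measure,
      lintegral_dirac_state, lintegral_dirac_state]
    rfl
  refine ⟨fun t b G => ?_, fun t b => ?_, fun t b => ?_⟩ <;> rw [key]
  · rw [tsum_fintype, Fintype.sum_bool, add_comm]
    simp [State.tossed, State.write, hi, Memory.set]
  · simp only [State.tossed]
    rw [hhalf, ← Nat.cast_add]
    refine Nat.cast_le.2 ?_
    rw [Cmd.weight, add_mul, add_mul]
    omega
  · simp only [State.tossed]
    rw [hhalf]
    push_cast
    rfl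

theorem Det.seq_weight {p q : Cmd} {m m' m'' : Memory} {θ : ℕ} (hp : Det p m m' (p.weight * θ))
    (hq : Det q m' m'' (q.weight * θ)) : Det (.seq p q) m m'' ((Cmd.seq p q).weight * θ) :=
  (hp.seq hq).mono (add_mul _ _ _).symm.le

theorem Runs.seq_det_weight {α : Type} {w : α → ℝ≥0∞} {μ μ' : α → Memory} {B : ℝ≥0∞} {p q : Cmd}
    {m : Memory} {θ : ℕ} (hp : Runs p m w μ (p.weight * θ : ℕ) B) (hw : ∑' a, w a = 1)
    (hq : ∀ a, w a ≠ 0 → Det q (μ a) (μ' a) (q.weight * θ)) :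
    Runs (.seq p q) m w μ' ((Cmd.seq p q).weight * θ : ℕ) B :=
  (hp.seq_det hw hq).mono (by rw [← Nat.cast_add, ← add_mul]; rfl) le_rfl

theorem Det.branch_pos_weight {l : ℕ} {e : Arith} {p q : Cmd} {m m' : Memory} (hm : Short l m)
    (h : 0 < e.val m) (hp : Det p m m' (p.weight * (l + 1) ^ 2)) :
    Det (.branch e p q) m m' ((Cmd.branch e p q).weight * (l + 1) ^ 2) := by
  refine (Det.branch_pos h hp).mono ?_
  have := Arith.guard_cost_le hm e
  simp only [Cmd.weight]
  nlinarith [Nat.zero_le (q.weight * (l + 1) ^ 2)]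

theorem Det.branch_not_weight {l : ℕ} {e : Arith} {p q : Cmd} {m m' : Memory} (hm : Short l m)
    (h : ¬ 0 < e.val m) (hq : Det q m m' (q.weight * (l + 1) ^ 2)) :
    Det (.branch e p q) m m' ((Cmd.branch e p q).weight * (l + 1) ^ 2) := by
  refine (Det.branch_not h hq).mono ?_
  have := Arith.guard_cost_le hm e
  simp only [Cmd.weight]
  nlinarith [Nat.zero_le (p.weight * (l + 1) ^ 2)]

end RandProg

/-! ### The memory as a record of variables -/

namespace PrivateSum

open RandProg

/-- The contents of the memory: the three input and output arrays and the scalar variables. -/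
@[ext]
structure Vars where
  par : ℕ → ℤ
  dat : ℕ → ℤ
  out : ℕ → ℤ
  len : ℤ
  wid : ℤ
  shift : ℤ
  level : ℤ
  coin : ℤ
  reach : ℤ
  flag : ℤ
  bound : ℤ
  draw : ℤ
  pow : ℤ
  rad : ℤ
  col : ℤ
  row : ℤ

/-- The array whose cell `0` contains `z`, all other cells being `0`. -/
def scalar (z : ℤ) : ℕ → ℤ := Function.update 0 0 z

/-- The list of all arrays. -/
def Vars.arrays (x : Vars) : List (ℕ → ℤ) :=
  [x.par, x.dat, x.out, scalar x.len, scalar x.wid, scalar x.shift, scalar x.level, scalar x.coin,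
    scalar x.reach, scalar x.flag, scalar x.bound, scalar x.draw, scalar x.pow, scalar x.rad,
    scalar x.col, scalar x.row]

/-- The memory with the given contents. -/
def Vars.mem (x : Vars) : Memory := fun a => x.arrays.getD a 0

theorem set_getD (l : List (ℕ → ℤ)) (a k : ℕ) (z : ℤ) (ha : a < l.length) :
    Memory.set (fun b => l.getD b 0) a k z
      = fun b => (l.set a (Function.update (l.getD a 0) k z)).getD b 0 := by
  funext b
  simp only [Memory.set, Function.update_apply, List.getD_eq_getElem?_getD, List.getElem?_set]
  by_cases h : b = a
  · subst h
    simp [ha]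
  · simp [h, Ne.symm h]

/-- This turns an assignment into a record update. For concrete records both list hypotheses hold by
`rfl`; it is essential that scalar arrays vanish outside cell 0. -/
theorem Vars.set_scalar {x y : Vars} (a : ℕ) (z : ℤ) {z₀ : ℤ} (ha : a < 16)
    (hx : x.arrays.getD a 0 = scalar z₀) (hy : x.arrays.set a (scalar z) = y.arrays) :
    Memory.set x.mem a 0 z = y.mem := by
  unfold Vars.mem
  rw [set_getD _ _ _ _ ha, hx, ← hy]
  have : Function.update (scalar z₀) 0 z = scalar z := Function.update_idem _ _ _
  rw [this]

theorem Vars.set_out {x : Vars} (k : ℕ) (z : ℤ) :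
    Memory.set x.mem 2 k z = ({x with out := Function.update x.out k z} : Vars).mem := by
  unfold Vars.mem
  rw [set_getD _ _ _ _ (by simp [Vars.arrays])]
  rfl

theorem Vars.set_coin (x : Vars) (z : ℤ) :
    Memory.set x.mem 7 0 z = ({x with coin := z} : Vars).mem :=
  Vars.set_scalar 7 z (by norm_num) rfl rfl

/-- The scalar variable in array `a`. -/
abbrev var (a : ℕ) : Arith := .cell a (.const 0)

/-- Assignment to the scalar variable in array `a`. -/
abbrev setVar (a : ℕ) (e : Arith) : Cmd := .assign a (.const 0) e

theorem Det.setVar {l a : ℕ} {x y : Vars} {e : Arith} (z : ℤ) {z₀ : ℤ} (hx : Short l x.mem)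
    (hz : e.val x.mem = z) (ha : a < 16) (ha₀ : x.arrays.getD a 0 = scalar z₀)
    (hy : x.arrays.set a (scalar z) = y.arrays) :
    Det (setVar a e) x.mem y.mem ((setVar a e).weight * (l + 1) ^ 2) :=
  Det.assign 0 z hx rfl hz (Vars.set_scalar a z ha ha₀ hy)

theorem Vars.short_set {l a : ℕ} {x y : Vars} {z z₀ : ℤ} (hx : Short l x.mem) (hz : |z| < 2 ^ l)
    (ha : a < 16) (ha₀ : x.arrays.getD a 0 = scalar z₀)
    (hy : x.arrays.set a (scalar z) = y.arrays) : Short l y.mem := by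
  rw [← Vars.set_scalar a z ha ha₀ hy]
  exact hx.set a 0 hz

/-! ### Uniform sampling by rejection -/

/-- The uniform distribution on `{0, …, N - 1}`. -/
noncomputable def unif (N v : ℕ) : ℝ≥0∞ := if v < N then (N : ℝ≥0∞)⁻¹ else 0

theorem tsum_unif_mul (N : ℕ) (g : ℕ → ℝ≥0∞) :
    ∑' v, unif N v * g v = (N : ℝ≥0∞)⁻¹ * ∑ v ∈ Finset.range N, g v := by
  rw [tsum_eq_sum (s := Finset.range N), Finset.mul_sum]
  · refine Finset.sum_congr rfl fun v hv => ?_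
    rw [unif, if_pos (Finset.mem_range.1 hv)]
  · intro v hv
    rw [unif, if_neg (by simpa using hv), zero_mul]

theorem tsum_unif {N : ℕ} (hN : N ≠ 0) : ∑' v, unif N v = 1 := by
  have := tsum_unif_mul N fun _ => 1
  simp only [mul_one, Finset.sum_const, Finset.card_range, nsmul_eq_mul] at this
  rw [this, ENNReal.inv_mul_cancel (by exact_mod_cast hN) (ENNReal.natCast_ne_top N)]

theorem lt_of_unif_ne_zero {N v : ℕ} (h : unif N v ≠ 0) : v < N := by
  by_contra hn
  exact h (if_neg hn)

/-- Append one random bit to the number `draw` and double `pow`. -/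
def drawBit : Cmd :=
  .seq (.toss 7 (.const 0)) (.seq (setVar 11 (.bin .plus (.bin .times (.const 2) (var 11)) (var 7)))
    (.seq (setVar 7 (.const 0)) (setVar 12 (.bin .times (.const 2) (var 12)))))

/-- Append random bits to `draw` until `pow` is at least `bound`. -/
def drawBits : Cmd := .loop (.bin .minus (var 10) (var 12)) drawBit

/-- Draw a uniform number below the least power of two that is at least `bound`. -/
def attempt : Cmd :=
  .seq (setVar 12 (.const 1)) (.seq (setVar 11 (.const 0)) (.seq drawBits (setVar 12 (.const 0))))

/-- Draw a uniform number below `bound`, by rejection. -/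
def sampler : Cmd :=
  .seq (setVar 11 (var 10))
    (.loop (.bin .plus (.bin .minus (var 11) (var 10)) (.const 1)) attempt)

theorem Vars.short_draw_pow {l : ℕ} {x : Vars} (hx : Short l x.mem) {v p : ℤ} (hv : |v| < 2 ^ l)
    (hp : |p| < 2 ^ l) : Short l ({x with draw := v, pow := p} : Vars).mem :=
  Vars.short_set (a := 12) (x := {x with draw := v})
    (Vars.short_set (a := 11) hx hv (by norm_num) rfl rfl) hp (by norm_num) rfl rfl

theorem Vars.short_coin {l : ℕ} {x : Vars} (hx : Short l x.mem) {v : ℤ} (hv : |v| < 2 ^ l) :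
    Short l ({x with coin := v} : Vars).mem :=
  Vars.short_set (a := 7) hx hv (by norm_num) rfl rfl

theorem tsum_bool_half : ∑' _ : Bool, (2⁻¹ : ℝ≥0∞) = 1 := by
  rw [tsum_fintype, Fintype.sum_bool, ENNReal.inv_two_add_inv_two]

/-- The coin is cleared after use, so that the resulting memory is determined by `draw` and `pow`
alone. -/
theorem runs_drawBit {l : ℕ} {x : Vars} {v p : ℕ} (hx : Short l x.mem) (hc : x.coin = 0)
    (hv : 2 * v + 1 < 2 ^ l) (hp : 2 * p < 2 ^ l) :
    Runs drawBit ({x with draw := v, pow := p} : Vars).mem (fun _ : Bool => 2⁻¹)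
      (fun b => ({x with draw := ((2 * v + b.toNat : ℕ) : ℤ), pow := ((2 * p : ℕ) : ℤ)} : Vars).mem)
      (drawBit.weight * (l + 1) ^ 2 : ℕ) 1 := by
  have hnat : ∀ n : ℕ, n < 2 ^ l → |(n : ℤ)| < 2 ^ l := fun n hn => by
    rw [abs_of_nonneg (by positivity)]
    exact_mod_cast hn
  have hb : ∀ b : Bool, b.toNat ≤ 1 := Bool.toNat_le
  have hv1 : ∀ b : Bool, |((2 * v + b.toNat : ℕ) : ℤ)| < 2 ^ l := fun b =>
    hnat _ (by have := hb b; omega)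
  have hb1 : ∀ b : Bool, |(b.toNat : ℤ)| < 2 ^ l := fun b => hnat _ (by have := hb b; omega)
  have hp0 := hnat p (by omega)
  have h0 := Vars.short_draw_pow hx (hnat v (by omega)) hp0
  have ht := Runs.toss (a := 7) 0 h0 (i := .const 0) rfl
  simp only [Vars.set_coin] at ht
  refine ht.seq_det_weight
    tsum_bool_half fun b _ => ?_
  refine (Det.setVar
    (y := {x with draw := ((2 * v + b.toNat : ℕ) : ℤ), pow := p, coin := b.toNat})
    ((2 * v + b.toNat : ℕ) : ℤ) (Vars.short_coin h0 (hb1 b)) ?_ (by norm_num) rfl rfl).seq_weight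
    ((Det.setVar (y := {x with draw := ((2 * v + b.toNat : ℕ) : ℤ), pow := p}) 0
      (Vars.short_coin (Vars.short_draw_pow hx (hv1 b) hp0) (hb1 b)) rfl (by norm_num) rfl
      (by rw [← hc]; rfl)).seq_weight
    (Det.setVar ((2 * p : ℕ) : ℤ) (Vars.short_draw_pow hx (hv1 b) hp0) ?_ (by norm_num) rfl rfl))
  · push_cast
    rfl
  · push_cast
    rfl

/-- The bits are appended below the prefix v, so n of them lead to v·2^n + w with w uniform. The
hypotheses on N say that the guard fails after exactly n rounds. -/
theorem runs_drawBits {l N n a v : ℕ} {x : Vars} (hx : Short l x.mem) (hc : x.coin = 0)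
    (hN : x.bound = N) (hv : v < 2 ^ a) (hlt : ∀ i < n, 2 ^ (a + i) < N) (hle : N ≤ 2 ^ (a + n))
    (hl : a + n < l) :
    Runs drawBits ({x with draw := v, pow := ((2 ^ a : ℕ) : ℤ)} : Vars).mem (unif (2 ^ n))
      (fun w => ({x with draw := ((v * 2 ^ n + w : ℕ) : ℤ), pow := ((2 ^ (a + n) : ℕ) : ℤ)} :
        Vars).mem) ((n + 1) * (drawBits.weight * (l + 1) ^ 2) : ℕ) n := by
  have hwt : drawBits.weight = (Arith.bin .minus (var 10) (var 12)).costWeight + 1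
    + drawBit.weight := rfl
  induction n generalizing a v with
  | zero =>
    have hs : Short l ({x with draw := v, pow := ((2 ^ a : ℕ) : ℤ)} : Vars).mem := by
      have h2 : (2 : ℤ) ^ a < 2 ^ l := pow_lt_pow_right₀ (by norm_num) (by omega)
      have h3 : (v : ℤ) < 2 ^ a := by exact_mod_cast hv
      refine Vars.short_draw_pow hx ?_ ?_ <;> rw [abs_of_nonneg (by positivity)]
      · linarith
      · push_cast; exact h2
    have hd : Det drawBits ({x with draw := v, pow := ((2 ^ a : ℕ) : ℤ)} : Vars).mem _ _ :=
      Det.loop_not (e := .bin .minus (var 10) (var 12)) (p := drawBit) (by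
        have : ¬ (0 : ℤ) < x.bound - ((2 ^ a : ℕ) : ℤ) := by
          rw [hN]
          have : (N : ℤ) ≤ ((2 ^ a : ℕ) : ℤ) := by exact_mod_cast hle
          omega
        exact this)
    refine (hd.runs.congr_law fun G => ?_).mono ?_ (by simp)
    · rw [tsum_unif_mul]
      simp
    · refine Nat.cast_le.2 ((Arith.guard_cost_le hs _).trans ?_)
      rw [hwt]
      simp only [zero_add, one_mul]
      exact Nat.mul_le_mul_right _ (Nat.le_add_right _ _)
  | succ n ih =>
    have h2l : 2 ^ (a + 1) < 2 ^ l := Nat.pow_lt_pow_right (by norm_num) (by omega)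
    rw [pow_succ] at h2l
    have hs : Short l ({x with draw := v, pow := ((2 ^ a : ℕ) : ℤ)} : Vars).mem := by
      refine Vars.short_draw_pow hx ?_ ?_ <;> rw [abs_of_nonneg (by positivity)]
      · exact_mod_cast (by omega : v < 2 ^ l)
      · exact_mod_cast (by omega : 2 ^ a < 2 ^ l)
    have hb := runs_drawBit hx hc (v := v) (p := 2 ^ a) (by omega) (by omega)
    have e1 : 2 * 2 ^ a = 2 ^ (a + 1) := by ring
    have hbound : ∀ b : Bool, 2 * v + b.toNat < 2 ^ (a + 1) := fun b => by
      have : b.toNat ≤ 1 := Bool.toNat_le b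
      rw [pow_succ]
      omega
    rw [e1] at hb
    have hseq := hb.seq (q := drawBits) fun b _ => ih (a := a + 1) (v := 2 * v + b.toNat) (hbound b)
      (fun i hi => by
        have := hlt (i + 1) (by omega)
        rwa [show a + (i + 1) = a + 1 + i by ring] at this)
      (by rwa [show a + 1 + n = a + (n + 1) by ring]) (by omega)
    have hpos : 0 < (Arith.bin .minus (var 10) (var 12)).val
        ({x with draw := v, pow := ((2 ^ a : ℕ) : ℤ)} : Vars).mem := by
      have : (0 : ℤ) < x.bound - ((2 ^ a : ℕ) : ℤ) := by
        rw [hN]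
        have : ((2 ^ a : ℕ) : ℤ) < N := by exact_mod_cast hlt 0 (by omega)
        omega
      exact this
    have hgc := Arith.guard_cost_le hs (.bin .minus (var 10) (var 12))
    refine ((Runs.loop_pos hpos hseq).congr_law fun G => ?_).mono ?_ ?_
    · rw [ENNReal.tsum_prod', tsum_fintype, Fintype.sum_bool]
      simp_rw [mul_assoc, ENNReal.tsum_mul_left, tsum_unif_mul]
      -- The first new bit is the most significant one: it decides between the lower and the upper
      -- half of the range.
      rw [pow_succ, mul_two, Finset.sum_range_add]
      have e3 : (((2 ^ n + 2 ^ n : ℕ) : ℝ≥0∞))⁻¹ = 2⁻¹ * ((2 ^ n : ℕ) : ℝ≥0∞)⁻¹ := by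
        rw [← ENNReal.mul_inv (Or.inl (by norm_num)) (Or.inl (by norm_num))]
        push_cast
        rw [two_mul]
      rw [e3, mul_add, mul_assoc, mul_assoc, add_comm]
      have hf : ((2 * v + false.toNat) * 2 ^ n) = v * (2 ^ n + 2 ^ n) := by simp; ring
      have ht : ((2 * v + true.toNat) * 2 ^ n) = v * (2 ^ n + 2 ^ n) + 2 ^ n := by simp; ring
      simp only [hf, ht, add_assoc, add_comm 1 n]
    · rw [ENNReal.tsum_mul_right]
      simp only [tsum_fintype, Fintype.sum_bool, ENNReal.inv_two_add_inv_two, one_mul]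
      rw [← Nat.cast_add, ← Nat.cast_add]
      refine Nat.cast_le.2 ?_
      nlinarith
    · rw [ENNReal.tsum_mul_right]
      simp only [tsum_fintype, Fintype.sum_bool, ENNReal.inv_two_add_inv_two, one_mul]
      push_cast
      rw [add_comm]

theorem abs_natCast_lt {n l : ℕ} (h : n < 2 ^ l) : |(n : ℤ)| < 2 ^ l := by
  rw [abs_of_nonneg (by positivity)]
  exact_mod_cast h

/-- The final reset of `pow` makes the memory after an attempt equal to the one before it except for
`draw`, as needed for repeating the attempt. -/
theorem runs_attempt {l N v : ℕ} {x : Vars} (hx : Short l x.mem) (hc : x.coin = 0)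
    (hN : x.bound = N) (h1 : 1 ≤ N) (hl : 2 * N ≤ 2 ^ l) (hv : v < 2 ^ l) :
    Runs attempt ({x with draw := v} : Vars).mem (unif (2 ^ Nat.clog 2 N))
      (fun w => ({x with draw := w, pow := 0} : Vars).mem)
      ((Nat.clog 2 N + 1) * (attempt.weight * (l + 1) ^ 2) : ℕ) (Nat.clog 2 N) := by
  set t := Nat.clog 2 N with ht
  have hl0 : 1 < 2 ^ l := by omega
  have hle : N ≤ 2 ^ t := Nat.le_pow_clog (by norm_num) _
  have hlt : ∀ i < t, 2 ^ i < N := fun i hi => Nat.pow_lt_of_lt_clog hi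
  -- The power of two overshoots N by less than a factor 2, so the doubled numbers still fit the
  -- word length.
  have htl : t < l ∧ 2 ^ t < 2 ^ l := by
    have h3 : 2 ^ t < 2 ^ l := by
      rcases Nat.eq_zero_or_pos t with h0 | h0
      · rw [h0]; simpa using hl0
      · have := hlt (t - 1) (by omega)
        have h4 : 2 ^ t = 2 ^ (t - 1) * 2 := by rw [← pow_succ]; congr 1; omega
        omega
    exact ⟨(Nat.pow_lt_pow_iff_right (by norm_num)).1 h3, h3⟩
  have hs0 : Short l ({x with draw := v} : Vars).mem :=
    Vars.short_set (a := 11) hx (abs_natCast_lt hv) (by norm_num) rfl rfl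
  have hd1 := Det.setVar (a := 12) (y := {x with draw := v, pow := 1}) (e := .const 1) 1 hs0 rfl
    (by norm_num) rfl rfl
  have hd2 := Det.setVar (a := 11) (y := {x with draw := 0, pow := 1}) (e := .const 0) 0
    (Vars.short_draw_pow hx (abs_natCast_lt hv) (abs_natCast_lt (n := 1) hl0)) rfl
    (by norm_num) rfl rfl
  have hr := runs_drawBits (v := 0) (a := 0) (n := t) hx hc hN (by norm_num)
    (by simpa using hlt) (by simpa using hle) (by simpa using htl.1)
  simp only [zero_mul, zero_add, pow_zero, Nat.cast_zero, Nat.cast_one] at hr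
  have hr2 := hr.seq_det (q := Cmd.assign 12 (.const 0) (.const 0))
    (n := (setVar 12 (.const 0)).weight * (l + 1) ^ 2) (tsum_unif (by positivity))
    (fun w hw => Det.setVar (a := 12) (y := {x with draw := (w : ℤ), pow := 0}) (e := .const 0) 0
      (Vars.short_draw_pow hx (abs_natCast_lt ((lt_of_unif_ne_zero hw).trans htl.2))
        (abs_natCast_lt htl.2)) rfl (by norm_num) rfl rfl)
  refine (hd1.seq_runs (hd2.seq_runs hr2)).mono ?_ le_rfl
  have hwt : attempt.weight = (setVar 12 (.const 1)).weight + ((setVar 11 (.const 0)).weight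
    + (drawBits.weight + (setVar 12 (.const 0)).weight)) := rfl
  rw [hwt]
  generalize (setVar 12 (.const 1)).weight = w1
  generalize (setVar 11 (.const 0)).weight = w2
  generalize (setVar 12 (.const 0)).weight = w3
  generalize drawBits.weight = w4
  norm_cast
  generalize (l + 1) ^ 2 = θ
  nlinarith [Nat.zero_le (t * (w1 * θ)), Nat.zero_le (t * (w2 * θ)), Nat.zero_le (t * (w3 * θ))]

/-- Conditioning the uniform distribution below 2^t on being less than N makes it uniform below N.
Acceptance has probability at least 1/2, whence the factor 2 in the bits. For N = 1 no coin is
tossed, which is what makes skipping noise free of charge. -/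
theorem runs_sampler {l N : ℕ} {x : Vars} (hx : Short l x.mem) (hc : x.coin = 0)
    (hp : x.pow = 0) (hN : x.bound = N) (h1 : 1 ≤ N) (hl : 2 * N ≤ 2 ^ l) :
    Runs sampler x.mem (unif N) (fun w => ({x with draw := w} : Vars).mem)
      (3 * (Nat.clog 2 N + 1) * (sampler.weight * (l + 1) ^ 2) : ℕ) (2 * Nat.clog 2 N : ℕ) := by
  have ha := fun (v : ℕ) (hv : v < 2 ^ l) => runs_attempt hx hc hN h1 hl hv
  simp only [← hp] at ha
  set t := Nat.clog 2 N with ht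
  have hle : N ≤ 2 ^ t := Nat.le_pow_clog (by norm_num) _
  have htN : 2 ^ t ≤ 2 * N := by
    rcases Nat.eq_zero_or_pos t with h0 | h0
    · rw [h0]; omega
    · have : 2 ^ (t - 1) < N := Nat.pow_lt_of_lt_clog (by omega)
      have h4 : 2 ^ t = 2 ^ (t - 1) * 2 := by rw [← pow_succ]; congr 1; omega
      omega
  set e : Arith := .bin .plus (.bin .minus (var 11) (var 10)) (.const 1) with he
  have hval : ∀ w : ℕ, 0 < e.val ({x with draw := w} : Vars).mem ↔ N ≤ w := fun w => by
    change (0 : ℤ) < (w : ℤ) - x.bound + 1 ↔ _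
    rw [hN]
    omega
  have hsupp : ∀ w, unif (2 ^ t) w ≠ 0 ∨ w = N → w < 2 ^ l := by
    rintro w (hw | rfl)
    · exact (lt_of_unif_ne_zero hw).trans_le (htN.trans hl)
    · omega
  have hshort : ∀ w : ℕ, w < 2 ^ l → Short l ({x with draw := w} : Vars).mem := fun w hw =>
    Vars.short_set (a := 11) hx (abs_natCast_lt hw) (by norm_num) rfl rfl
  set q : ℝ≥0∞ := N * ((2 ^ t : ℕ) : ℝ≥0∞)⁻¹ with hq
  have hN0 : (N : ℝ≥0∞) ≠ 0 := by exact_mod_cast (by omega : N ≠ 0)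
  have h2t : ((2 ^ t : ℕ) : ℝ≥0∞) ≠ 0 := by exact_mod_cast (by positivity : (2 ^ t : ℕ) ≠ 0)
  have hq0 : q ≠ 0 := mul_ne_zero hN0 (ENNReal.inv_ne_zero.2 (ENNReal.natCast_ne_top _))
  have hqi : q⁻¹ = ((2 ^ t : ℕ) : ℝ≥0∞) / N := by
    rw [hq, ENNReal.mul_inv (Or.inl hN0) (Or.inl (ENNReal.natCast_ne_top _)), inv_inv, mul_comm,
      div_eq_mul_inv]
  have hq2 : q⁻¹ ≤ 2 := by
    rw [hqi]
    refine ENNReal.div_le_of_le_mul ?_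
    exact_mod_cast htN
  have hqsum : q = ∑' w : ℕ, if 0 < e.val ({x with draw := (w : ℤ)} : Vars).mem then 0
      else unif (2 ^ t) w := by
    have h3 : ∀ w : ℕ, (if 0 < e.val ({x with draw := (w : ℤ)} : Vars).mem then 0
        else unif (2 ^ t) w) = unif (2 ^ t) w * (if w ∈ Finset.range N then 1 else 0) := fun w => by
      by_cases h : N ≤ w <;> simp [hval, h]
    simp_rw [h3]
    rw [tsum_unif_mul, hq, mul_comm, Finset.sum_ite_mem, Finset.inter_eq_right.2
      (Finset.range_subset_range.2 hle)]
    simp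
  -- The value N is itself a rejected outcome; storing it in `draw` forces the first attempt. It
  -- lies outside the support when N is a power of two.
  have hr := Runs.retry (e := e) (p := attempt) (w := unif (2 ^ t))
    (μ := fun w : ℕ => ({x with draw := w} : Vars).mem) (x₀ := N) (q := q)
    (g := (e.costWeight + 1) * (l + 1) ^ 2) (tsum_unif (by positivity))
    (fun w hw => Arith.guard_cost_le (hshort w (hsupp w hw)) e)
    (fun w hw _ => ha w (hsupp w hw)) ((hval N).2 le_rfl) hqsum hq0
  have hd := Det.setVar (a := 11) (y := {x with draw := (N : ℤ)}) (e := var 10) N hx hN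
    (by norm_num) rfl rfl
  refine ((hd.seq_runs hr).congr_law fun G => ?_).mono ?_ ?_
  · refine tsum_congr fun w => ?_
    congr 1
    by_cases h : N ≤ w
    · simp [hval, h, unif, Nat.not_lt.2 h]
    · rw [if_neg (by rwa [hval]), unif, unif, if_pos (by omega), if_pos (by omega),
        div_eq_mul_inv, hqi, div_eq_mul_inv, ← mul_assoc,
        ENNReal.inv_mul_cancel h2t (ENNReal.natCast_ne_top _), one_mul]
  · have hwt : sampler.weight = (setVar 11 (var 10)).weight + (e.costWeight + 1 + attempt.weight) :=
      rfl
    rw [hwt]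
    generalize (setVar 11 (var 10)).weight = w1
    generalize e.costWeight = w2
    generalize attempt.weight = w3
    rw [div_eq_mul_inv]
    refine (add_le_add_right (add_le_add_left (mul_le_mul_right hq2 _) _) _).trans ?_
    norm_cast
    generalize (l + 1) ^ 2 = θ
    nlinarith [Nat.zero_le (t * (w1 * θ)), Nat.zero_le (t * (w2 * θ)), Nat.zero_le (t * (w3 * θ)),
      Nat.zero_le (w1 * θ), Nat.zero_le (w3 * θ), Nat.zero_le (t * θ)]
  · rw [div_eq_mul_inv]
    refine (mul_le_mul_right hq2 _).trans (le_of_eq ?_)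
    push_cast
    ring

end PrivateSum

/-! ### Counting loops and geometric loops -/

namespace RandProg

theorem Det.for {e : Arith} {p : Cmd} (S : ℕ → Memory) (n : ℕ) {T g : ℕ}
    (hpos : ∀ i < n, 0 < e.val (S i)) (hend : ¬ 0 < e.val (S n))
    (hg : ∀ i ≤ n, e.cost (S i) + 1 ≤ g) (hstep : ∀ i < n, Det p (S i) (S (i + 1)) T) :
    Det (.loop e p) (S 0) (S n) ((n + 1) * (g + T)) := by
  suffices h : ∀ k ≤ n, Det (.loop e p) (S (n - k)) (S n) ((k + 1) * (g + T)) by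
    simpa using h n le_rfl
  intro k hk
  induction k with
  | zero => exact (Det.loop_not hend).mono (by have := hg n le_rfl; simp; omega)
  | succ k ih =>
    have h1 : n - (k + 1) + 1 = n - k := by omega
    have hs := hstep (n - (k + 1)) (by omega)
    rw [h1] at hs
    refine (Det.loop_pos (hpos _ (by omega)) hs (ih (by omega))).mono ?_
    have := hg (n - (k + 1)) (by omega)
    nlinarith

/-- The geometric distribution: `i` successes before the first failure. -/
noncomputable def geo (i : ℕ) : ℝ≥0∞ := 2⁻¹ ^ (i + 1)

theorem geo_succ (i : ℕ) : geo (i + 1) = 2⁻¹ * geo i := by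
  rw [geo, geo, pow_succ, mul_comm]

theorem tsum_geo : ∑' i, geo i = 1 := by
  simp_rw [geo, pow_succ]
  rw [ENNReal.tsum_mul_right, ENNReal.tsum_geometric, ENNReal.one_sub_inv_two, inv_inv,
    ENNReal.mul_inv_cancel (by norm_num) (by norm_num)]

/-- A loop whose guard is decided by a fair coin in every iteration. -/
theorem Runs.geometric {e : Arith} {p : Cmd} {A D : ℕ → Memory} {T : ℕ → ℝ≥0∞} {g : ℕ → ℕ}
    (hA : ∀ j, 0 < e.val (A j)) (hD : ∀ j, ¬ 0 < e.val (D j))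
    (hgA : ∀ j, e.cost (A j) + 1 ≤ g j) (hgD : ∀ j, e.cost (D j) + 1 ≤ g j)
    (hbody : ∀ j, Runs p (A j) (fun _ : Bool => 2⁻¹) (fun b => cond b (A (j + 1)) (D j)) (T j) 1) :
    Runs (.loop e p) (A 0) geo D (∑' i, 2⁻¹ ^ i * (T i + 2 * g i)) 2 := by
  classical
  have hmix : ∀ f : ℕ → ℝ≥0∞, ∑' i, geo i * f i = 2⁻¹ * f 0 + 2⁻¹ * ∑' i, geo i * f (i + 1) := by
    intro f
    rw [tsum_eq_zero_add' ENNReal.summable, ← ENNReal.tsum_mul_left]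
    congr 1
    · simp [geo]
    · exact tsum_congr fun i => by rw [geo_succ, mul_assoc]
  refine ⟨fun t b G => ?_, fun t b => ?_, fun t b => ?_⟩
  · let Ψ : ℕ → ℝ≥0∞ := fun j => ∑' i, geo i * G (D (j + i))
    have hΨ : ∀ j, 2⁻¹ * Ψ (j + 1) + 2⁻¹ * G (D j) = Ψ j := by
      intro j
      simp only [Ψ]
      rw [hmix fun i => G (D (j + i)), add_comm]
      simp [add_assoc, add_comm 1]
    apply le_antisymm
    -- The infimum over labels is needed because A is not assumed injective.
    · let Φ : Memory → ℝ≥0∞ := fun m => if 0 < e.val m then ⨅ j : {j // A j = m}, Ψ j else G m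
      have hΦA : ∀ j, Φ (A j) ≤ Ψ j := fun j => by
        simp only [Φ]
        rw [if_pos (hA j)]
        exact iInf_le_of_le ⟨j, rfl⟩ le_rfl
      refine (lintegral_loop_le (I := fun σ => Φ σ.mem) (f := fun σ => G σ.mem) (fun σ h => ?_)
        (fun σ h => ?_) ⟨A 0, t, b⟩).trans ((hΦA 0).trans (by simp [Ψ]))
      · simp only [Φ, State.tick]
        rw [if_neg h]
      · simp only [Φ]
        rw [if_pos h]
        refine le_iInf fun j => ?_
        obtain ⟨j, hj⟩ := j
        have hb := (hbody j).law (σ.time + (e.cost σ.mem + 1)) σ.bits Φ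
        rw [hj] at hb
        refine hb.le.trans ?_
        rw [tsum_fintype, Fintype.sum_bool]
        simp only [cond_true, cond_false]
        rw [← hΨ]
        gcongr
        · exact hΦA _
        · simp only [Φ]
          rw [if_neg (hD j)]
    -- As for rejection, the reverse inequality comes from the runs with a bounded number of rounds.
    · have hlow : ∀ n j t b, ∑ i ∈ Finset.range n, geo i * G (D (j + i))
          ≤ ∫⁻ σ, G σ.mem ∂((Cmd.loop e p).denote ⟨A j, t, b⟩) := by
        intro n
        induction n with
        | zero => intro j t b; simp
        | succ n ih =>
          intro j t b
          rw [denote_loop_of_pos (σ := ⟨A j, t, b⟩) (hA j), lintegral_denote_seq]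
          let Θ : Memory → ℝ≥0∞ := fun m => if 0 < e.val m then
            ∑ i ∈ Finset.range n, geo i * G (D (j + 1 + i)) else G m
          have hb := (hbody j).law (t + (e.cost (A j) + 1)) b Θ
          have hΘ : ∑' b : Bool, 2⁻¹ * Θ (cond b (A (j + 1)) (D j))
              = ∑ i ∈ Finset.range (n + 1), geo i * G (D (j + i)) := by
            rw [tsum_fintype, Fintype.sum_bool, Finset.sum_range_succ']
            simp only [Θ, cond_true, cond_false]
            rw [if_pos (hA _), if_neg (hD _), Finset.mul_sum]
            congr 1
            · refine Finset.sum_congr rfl fun i _ => ?_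
              rw [geo_succ, mul_assoc, show j + 1 + i = j + (i + 1) by ring]
            · simp [geo]
          rw [hΘ] at hb
          rw [← hb]
          refine lintegral_mono_ae ?_
          filter_upwards [(hbody j).ae_mem (t + (e.cost (A j) + 1)) b] with σ hσ
          obtain ⟨b', -, hσ⟩ := hσ
          obtain ⟨mm, tt, bb⟩ := σ
          simp only at hσ
          subst hσ
          simp only [Θ]
          cases b'
          · simp only [cond_false]
            rw [if_neg (hD j), denote_loop_of_not (σ := ⟨D j, tt, bb⟩) (hD j),
              lintegral_dirac_state]
            exact le_rfl
          · simp only [cond_true]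
            rw [if_pos (hA _)]
            exact ih _ _ _
      rw [ENNReal.tsum_eq_iSup_nat]
      exact iSup_le fun n => by simpa using hlow n 0 t b
  -- The expected remaining time from round j; two guards are charged per round so that the guard at
  -- the exit is covered.
  · let Ψ : ℕ → ℝ≥0∞ := fun j => ∑' i, 2⁻¹ ^ i * (T (j + i) + 2 * g (j + i))
    have hΨ : ∀ j, Ψ j = T j + 2 * g j + 2⁻¹ * Ψ (j + 1) := by
      intro j
      simp only [Ψ]
      rw [tsum_eq_zero_add' ENNReal.summable, ← ENNReal.tsum_mul_left]
      simp only [pow_zero, one_mul, add_zero]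
      congr 1
      exact tsum_congr fun i => by rw [pow_succ, ← mul_assoc, mul_comm (2⁻¹ ^ i),
        show j + (i + 1) = j + 1 + i by ring]
    let Φ : Memory → ℝ≥0∞ := fun m => if 0 < e.val m then ⨅ j : {j // A j = m}, Ψ j
      else (e.cost m + 1 : ℕ)
    have hΦA : ∀ j, Φ (A j) ≤ Ψ j := fun j => by
      simp only [Φ]
      rw [if_pos (hA j)]
      exact iInf_le_of_le ⟨j, rfl⟩ le_rfl
    refine (Runs.loop_time_le Φ (fun m h => ?_) (fun m h t b => ?_) t b).trans
      ((add_le_add_right (hΦA 0) _).trans (by simp [Ψ]))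
    · simp only [Φ]
      rw [if_neg h]
    · have hm : Φ m = ⨅ j : {j // A j = m}, Ψ j := if_pos h
      rw [hm, ENNReal.add_iInf]
      refine le_iInf fun j => ?_
      obtain ⟨j, rfl⟩ := j
      have hb := hbody j
      rw [lintegral_add_left (measurable_of_state _), hb.law, tsum_fintype, Fintype.sum_bool, hΨ]
      simp only [cond_true, cond_false]
      have h1 : Φ (D j) ≤ g j := by
        simp only [Φ]
        rw [if_neg (hD j)]
        exact_mod_cast hgD j
      calc _ ≤ (t + T j : ℝ≥0∞) + (2⁻¹ * Ψ (j + 1) + 1 * g j) + g j := by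
            gcongr
            · exact hb.time t b
            · exact hΦA _
            · norm_num
            · exact hgA j
        _ = _ := by ring
  · let Φ : Memory → ℝ≥0∞ := fun m => if 0 < e.val m then ⨅ j : {j // A j = m}, 2 else 0
    have hΦA : ∀ j, Φ (A j) ≤ 2 := fun j => by
      simp only [Φ]
      rw [if_pos (hA j)]
      exact iInf_le_of_le ⟨j, rfl⟩ le_rfl
    refine (Runs.loop_bits_le Φ (fun m h t b => ?_) t b).trans (add_le_add_right (hΦA 0) _)
    have hm : Φ m = ⨅ j : {j // A j = m}, 2 := if_pos h
    rw [hm, ENNReal.add_iInf]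
    refine le_iInf fun j => ?_
    obtain ⟨j, rfl⟩ := j
    have hb := hbody j
    rw [lintegral_add_left (measurable_of_state _), hb.law, tsum_fintype, Fintype.sum_bool]
    simp only [cond_true, cond_false]
    have h1 : Φ (D j) = 0 := if_neg (hD j)
    rw [h1]
    calc _ ≤ (b + 1 : ℝ≥0∞) + (2⁻¹ * 2 + 2⁻¹ * 0) := by
          gcongr
          · exact hb.bits t b
          · exact hΦA _
      _ = _ := by
        rw [ENNReal.inv_mul_cancel (by norm_num) (by norm_num), mul_zero, add_zero, add_assoc,
          one_add_one_eq_two]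

end RandProg

/-! ### Resampling of coordinates, and the program -/

namespace PrivateSum

open RandProg

theorem tsum_pi_unif {d N : ℕ} (hN : N ≠ 0) :
    ∑' z : Fin d → ℕ, ∏ i, unif N (z i) = 1 := by
  rw [tsum_eq_sum (s := Fintype.piFinset fun _ => Finset.range N)]
  · rw [Finset.sum_prod_piFinset (Finset.range N) fun _ : Fin d => unif N]
    have : ∑ v ∈ Finset.range N, unif N v = 1 := by
      have h := tsum_unif hN
      rwa [tsum_eq_sum (s := Finset.range N)] at h
      intro v hv
      exact if_neg (by simpa using hv)
    simp [this]
  · intro z hz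
    simp only [Fintype.mem_piFinset, Finset.mem_range, not_forall] at hz
    obtain ⟨i, hi⟩ := hz
    exact Finset.prod_eq_zero (Finset.mem_univ i) (if_neg hi)

/-- Resampling one coordinate of a vector of independent samples. -/
theorem tsum_resample {d : ℕ} {w : ℕ → ℝ≥0∞} (hw : ∑' v, w v = 1) (k : Fin d)
    (h : (Fin d → ℕ) → ℝ≥0∞) :
    ∑' v, w v * ∑' z : Fin d → ℕ, (∏ i, w (z i)) * h (Function.update z k v)
      = ∑' z : Fin d → ℕ, (∏ i, w (z i)) * h z := by
  classical
  -- Splitting off coordinate k separates the overwritten value, whose weights sum to 1, from the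
  -- other coordinates.
  let e := (Equiv.funSplitAt k ℕ).symm
  have hprod : ∀ v y, ∏ i, w (e (v, y) i) = w v * ∏ j : {j // j ≠ k}, w (y j) := by
    intro v y
    rw [Fintype.prod_eq_mul_prod_subtype_ne (fun i => w (e (v, y) i)) k]
    congr 1
    · simp [e]
    · refine Finset.prod_congr rfl fun j _ => ?_
      simp [e, j.2]
  have hupd : ∀ v v' y, Function.update (e (v', y)) k v = e (v, y) := by
    intro v v' y
    funext i
    by_cases hi : i = k
    · subst hi; simp [e]
    · simp [e, hi]
  simp_rw [← e.tsum_eq (fun z => (∏ i, w (z i)) * h z),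
    fun v => (e.tsum_eq (fun z => (∏ i, w (z i)) * h (Function.update z k v))).symm,
    ENNReal.tsum_prod', hprod, hupd]
  refine tsum_congr fun v => ?_
  simp_rw [mul_assoc, ENNReal.tsum_mul_left]
  rw [ENNReal.tsum_mul_right, hw, one_mul]

/-- Sum of two terms. -/
abbrev plus (e f : Arith) : Arith := .bin .plus e f
/-- Difference of two terms. -/
abbrev minus (e f : Arith) : Arith := .bin .minus e f
/-- Product of two terms. -/
abbrev times (e f : Arith) : Arith := .bin .times e f
/-- Integer quotient of two terms. -/
abbrev quot (e f : Arith) : Arith := .bin .quot e f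
/-- The `k`-th parameter of the program. -/
abbrev param (k : ℕ) : Arith := .cell 0 (.const k)
/-- The output cell of the current column. -/
abbrev current : Arith := .cell 2 (var 14)

/-- Compute the cell length, the width of the grid, and the bound for the random shift. -/
def prologue : Cmd :=
  .seq (setVar 3 (times (.const 4) (param 2)))
    (.seq (.branch (minus (param 1) (.const 1)) (setVar 4 (times (param 1) (var 3)))
      (setVar 4 (.const 1))) (setVar 10 (param 1)))

/-- Store the random shift and get ready for drawing the noise level. -/
def storeShift : Cmd := .seq (setVar 5 (times (var 11) (var 3))) (setVar 7 (.const 1))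

/-- Draw the noise level, a geometric random variable. -/
def drawLevel : Cmd := .loop (var 7) (.seq (.toss 7 (.const 0)) (setVar 6 (plus (var 6) (var 7))))

/-- Compute an upper bound for the radius of the noise. -/
def storeReach : Cmd := setVar 8 (times (var 3) (plus (var 6) (.const 2)))

/-- Add one entry of the current column. -/
def addEntry : Cmd :=
  .seq (.assign 2 (var 14) (plus current (.cell 1 (plus (times (var 15) (param 0)) (var 14)))))
    (setVar 15 (plus (var 15) (.const 1)))

/-- Sum up the current column. -/
def addColumn : Cmd := .loop (minus (param 3) (var 15)) addEntry

/-- The number of grid points within reach of the current column sum. -/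
def nearTerm : Arith :=
  minus (quot (plus (plus current (var 5)) (var 8)) (var 4))
    (quot (minus (plus current (var 5)) (var 8)) (var 4))

/-- Sum up all columns and count the grid points within reach. -/
def scan : Cmd :=
  .loop (minus (param 0) (var 14))
    (.seq addColumn (.seq (setVar 9 (plus (var 9) nearTerm))
      (.seq (setVar 14 (plus (var 14) (.const 1))) (setVar 15 (.const 0)))))

/-- Set the bound for drawing the fine part of the radius, which is needed only if some grid point
is within reach. -/
def radiusBound : Cmd := .branch (var 9) (setVar 10 (var 3)) (setVar 10 (.const 1))

/-- Store the radius. -/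
def storeRadius : Cmd :=
  .seq (setVar 13 (plus (times (var 3) (plus (var 6) (.const 1))) (var 11)))
    (.seq (setVar 11 (.const 0)) (.seq (setVar 10 (.const 0)) (setVar 14 (.const 0))))

/-- Set the bound for drawing the noise of the current column, which is needed only if some grid
point is within reach. -/
def columnBound : Cmd :=
  .branch nearTerm (setVar 10 (plus (times (.const 2) (var 13)) (.const 1))) (setVar 10 (.const 1))

/-- Add the noise to the current column and round. -/
def storeColumn : Cmd :=
  .seq (.assign 2 (var 14) (times (var 4)
      (quot (plus (plus current (var 5)) (minus (var 11) (quot (var 10) (.const 2)))) (var 4))))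
    (.seq (setVar 11 (.const 0)) (.seq (setVar 10 (.const 0))
      (setVar 14 (plus (var 14) (.const 1)))))

/-- Draw the noise of the current column, if it is needed, and round. -/
def releaseColumn : Cmd := .seq columnBound (.seq sampler storeColumn)

/-- Process all columns. -/
def release : Cmd := .loop (minus (param 0) (var 14)) releaseColumn

/-- The part of the program after the choice of the shift and the noise level. -/
def finish : Cmd :=
  .seq storeReach (.seq scan (.seq radiusBound (.seq sampler (.seq storeRadius release))))

/-- The program for private summation. -/
def program : Cmd :=
  .seq prologue (.seq sampler (.seq storeShift (.seq drawLevel finish)))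

/-! ### Execution of the program -/

/-- The number of multiples of `W` (shifted by `sh`) within reach `T` of `y`. -/
def near (W sh T y : ℤ) : ℤ := (y + sh + T) / W - (y + sh - T) / W

/-- Round `y`, shifted by `sh`, to a multiple of `W`. -/
def rnd (W sh y : ℤ) : ℤ := W * ((y + sh) / W)

theorem near_nonneg {W sh T y : ℤ} (hW : 0 < W) (hT : 0 ≤ T) : 0 ≤ near W sh T y :=
  sub_nonneg.2 (Int.ediv_le_ediv hW (by linarith))

/-- Floors are monotone; if they agree at both ends of the window of half-width T, they are constant
on it. This is what justifies drawing no noise for the column. -/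
theorem rnd_eq_of_near_eq_zero {W sh T y z : ℤ} (hW : 0 < W) (hz : |z| ≤ T)
    (h : near W sh T y = 0) : rnd W sh (y + z) = rnd W sh y := by
  have hz' := abs_le.1 hz
  have h0 : 0 ≤ T := (abs_nonneg z).trans hz
  have h1 : (y + sh - T) / W ≤ (y + z + sh) / W := Int.ediv_le_ediv hW (by linarith)
  have h2 : (y + z + sh) / W ≤ (y + sh + T) / W := Int.ediv_le_ediv hW (by linarith)
  have h3 : (y + sh - T) / W ≤ (y + sh) / W := Int.ediv_le_ediv hW (by linarith)
  have h4 : (y + sh) / W ≤ (y + sh + T) / W := Int.ediv_le_ediv hW (by linarith)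
  unfold near at h
  unfold rnd
  rw [show (y + z + sh) / W = (y + sh) / W by omega]

theorem Vars.short_out {l k : ℕ} {x : Vars} {z : ℤ} (hx : Short l x.mem) (hz : |z| < 2 ^ l) :
    Short l ({x with out := Function.update x.out k z} : Vars).mem := by
  rw [← Vars.set_out]
  exact hx.set 2 k hz

/-- The sum of the first `m` entries of column `j`. -/
def partialSum (dat : ℕ → ℤ) (d m j : ℕ) : ℤ := ∑ i ∈ Finset.range m, dat (i * d + j)

theorem det_addColumn {l d n j : ℕ} {x : Vars} (hx : Short l x.mem) (hd : x.par 0 = d)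
    (hn : x.par 3 = n) (hcol : x.col = j) (hrow : x.row = 0) (hout : x.out j = 0)
    (hS : ∀ m ≤ n, |partialSum x.dat d m j| < 2 ^ l) (hnl : n < 2 ^ l) :
    Det addColumn x.mem ({x with
      out := Function.update x.out j (partialSum x.dat d n j), row := n} : Vars).mem
      ((n + 1) * (addColumn.weight * (l + 1) ^ 2)) := by
  let A : ℕ → Vars := fun i =>
    {x with out := Function.update x.out j (partialSum x.dat d i j), row := i}
  have hA0 : A 0 = x := by
    have : Function.update x.out j (partialSum x.dat d 0 j) = x.out := by
      rw [partialSum, Finset.sum_range_zero, ← hout, Function.update_eq_self]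
    apply Vars.ext <;> simp [A, this, hrow]
  have hsh : ∀ i ≤ n, Short l (A i).mem := fun i hi =>
    Vars.short_set (a := 15) (z := i) (Vars.short_out (k := j) hx (hS i hi))
      (abs_natCast_lt (hi.trans_lt hnl)) (by norm_num) rfl rfl
  have hval : ∀ i, (minus (param 3) (var 15)).val (A i).mem = n - i := fun i => by
    rw [← hn]; rfl
  have h := Det.for (e := minus (param 3) (var 15)) (p := addEntry) (fun i => (A i).mem) n
    (T := addEntry.weight * (l + 1) ^ 2)
    (g := ((minus (param 3) (var 15)).costWeight + 1) * (l + 1) ^ 2)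
    (fun i hi => by rw [hval]; omega) (by rw [hval]; omega)
    (fun i hi => Arith.guard_cost_le (hsh i hi) _) (fun i hi => ?_)
  · rw [hA0, ← add_mul] at h
    exact h
  · refine (Det.assign (l := l) j (partialSum x.dat d (i + 1) j) (i := var 14)
      (e := plus current (.cell 1 (plus (times (var 15) (param 0)) (var 14)))) (hsh i hi.le) hcol ?_
      (Vars.set_out _ _)).seq_weight
      (Det.setVar ((i + 1 : ℕ) : ℤ) (Vars.short_out (hsh i hi.le) (hS (i + 1) hi)) ?_ (by norm_num)
        rfl ?_)
    · have e1 : ((i : ℤ) * x.par 0 + x.col).toNat = i * d + j := by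
        rw [hd, hcol]
        exact_mod_cast Int.toNat_natCast (i * d + j)
      have e2 : Function.update x.out j (partialSum x.dat d i j) x.col.toNat
          = partialSum x.dat d i j := by
        rw [hcol, Int.toNat_natCast, Function.update_self]
      change Function.update x.out j (partialSum x.dat d i j) x.col.toNat
        + x.dat ((i : ℤ) * x.par 0 + x.col).toNat = _
      rw [e1, e2, partialSum, partialSum, Finset.sum_range_succ]
    · push_cast
      rfl
    · simp only [A, Function.update_idem]
      rfl

theorem det_scan {l d n : ℕ} {x : Vars} (hx : Short l x.mem) (hd : x.par 0 = d)
    (hn : x.par 3 = n) (hcol : x.col = 0) (hrow : x.row = 0) (hflag : x.flag = 0) (hout : x.out = 0)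
    (hS : ∀ m ≤ n, ∀ j < d, |partialSum x.dat d m j| < 2 ^ l) (hnl : n < 2 ^ l) (hdl : d < 2 ^ l)
    (hW : 0 < x.wid) (hT : 0 ≤ x.reach)
    (hF : ∑ j ∈ Finset.range d, near x.wid x.shift x.reach (partialSum x.dat d n j) < 2 ^ l) :
    Det scan x.mem ({x with
      out := fun k => if k < d then partialSum x.dat d n k else 0
      flag := ∑ j ∈ Finset.range d, near x.wid x.shift x.reach (partialSum x.dat d n j)
      col := d} : Vars).mem
      ((d + 1) * ((n + 1) * (scan.weight * (l + 1) ^ 2))) := by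
  let fl : ℕ → ℤ := fun j =>
    ∑ j ∈ Finset.range j, near x.wid x.shift x.reach (partialSum x.dat d n j)
  let A : ℕ → Vars := fun j => {x with
    out := fun k => if k < j then partialSum x.dat d n k else 0
    flag := fl j
    col := j}
  have hfl : ∀ j ≤ d, |fl j| < 2 ^ l := fun j hj => by
    rw [abs_of_nonneg (Finset.sum_nonneg fun i _ => near_nonneg hW hT)]
    refine lt_of_le_of_lt ?_ hF
    exact Finset.sum_le_sum_of_subset_of_nonneg (Finset.range_subset_range.2 hj)
      fun i _ _ => near_nonneg hW hT
  have hA0 : A 0 = x := by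
    apply Vars.ext <;> simp [A, fl, hcol, hflag, hout]
    rfl
  have hshO : ∀ j ≤ d, Short l
      ({x with out := fun k => if k < j then partialSum x.dat d n k else 0} : Vars).mem := by
    intro j hj
    induction j with
    | zero =>
      simp only [Nat.not_lt_zero, if_false]
      rw [show (fun _ : ℕ => (0 : ℤ)) = x.out from hout.symm]
      exact hx
    | succ j ih =>
      have := Vars.short_out (k := j) (ih (by omega)) (hS n le_rfl j (by omega))
      convert this using 3
      funext k
      simp only [Function.update_apply]
      rcases lt_trichotomy k j with h | h | h
      · simp [h.ne, h, h.trans (Nat.lt_succ_self j)]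
      · subst h; simp
      · simp [h.ne', not_lt.2 h.le, not_lt.2 (Nat.succ_le_of_lt h)]
  have hshF : ∀ j ≤ d, ∀ j' ≤ d, Short l ({x with
      out := fun k => if k < j then partialSum x.dat d n k else 0, flag := fl j'} : Vars).mem :=
    fun j hj j' hj' => Vars.short_set (a := 9) (hshO j hj) (hfl j' hj') (by norm_num) rfl rfl
  have hshC : ∀ j ≤ d, ∀ j' ≤ d, ∀ i ≤ d, Short l ({x with
      out := fun k => if k < j then partialSum x.dat d n k else 0, flag := fl j', col := i} :
      Vars).mem :=
    fun j hj j' hj' i hi => Vars.short_set (a := 14) (z := (i : ℤ)) (hshF j hj j' hj')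
      (abs_natCast_lt (hi.trans_lt hdl)) (by norm_num) rfl rfl
  have hshR : ∀ j ≤ d, ∀ j' ≤ d, ∀ i ≤ d, Short l ({x with
      out := fun k => if k < j then partialSum x.dat d n k else 0, flag := fl j', col := i
      row := n} : Vars).mem :=
    fun j hj j' hj' i hi => Vars.short_set (a := 15) (z := (n : ℤ)) (hshC j hj j' hj' i hi)
      (abs_natCast_lt hnl) (by norm_num) rfl rfl
  have hval : ∀ i, (minus (param 0) (var 14)).val (A i).mem = d - i := fun i => by
    rw [← hd]; rfl
  have hs : ∀ i ≤ d, Short l (A i).mem := fun i hi => hshC i hi i hi i hi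
  have h := Det.for (e := minus (param 0) (var 14)) (fun i => (A i).mem) d
    (p := .seq addColumn (.seq (setVar 9 (plus (var 9) nearTerm))
      (.seq (setVar 14 (plus (var 14) (.const 1))) (setVar 15 (.const 0)))))
    (T := (n + 1) * (addColumn.weight * (l + 1) ^ 2) + (Cmd.seq (setVar 9 (plus (var 9) nearTerm))
      (.seq (setVar 14 (plus (var 14) (.const 1))) (setVar 15 (.const 0)))).weight * (l + 1) ^ 2)
    (g := ((minus (param 0) (var 14)).costWeight + 1) * (l + 1) ^ 2)
    (fun i hi => by rw [hval]; omega) (by rw [hval]; omega)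
    (fun i hi => Arith.guard_cost_le (hs i hi) _) (fun j hj => ?_)
  · rw [hA0] at h
    refine h.mono (Nat.mul_le_mul_left _ ?_)
    have hwt : scan.weight = (minus (param 0) (var 14)).costWeight + 1 + (addColumn.weight +
      (Cmd.seq (setVar 9 (plus (var 9) nearTerm))
      (.seq (setVar 14 (plus (var 14) (.const 1))) (setVar 15 (.const 0)))).weight) := rfl
    rw [hwt]
    generalize (Cmd.seq _ _).weight = w1
    generalize addColumn.weight = w2
    generalize (minus _ _).costWeight = w3
    generalize (l + 1) ^ 2 = θ
    nlinarith [Nat.zero_le (n * (w1 * θ)), Nat.zero_le (n * ((w3 + 1) * θ))]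
  · have h1 := det_addColumn (j := j) (x := A j) (hs j hj.le) hd hn rfl hrow (by simp [A])
      (fun m hm => hS m hm j hj) hnl
    have hupd : Function.update (A j).out j (partialSum x.dat d n j)
        = fun k => if k < j + 1 then partialSum x.dat d n k else 0 := by
      funext k
      simp only [Function.update_apply, A]
      rcases lt_trichotomy k j with h | h | h
      · simp [h.ne, h, h.trans (Nat.lt_succ_self j)]
      · subst h; simp
      · simp [h.ne', not_lt.2 h.le, not_lt.2 (Nat.succ_le_of_lt h)]
    rw [show partialSum (A j).dat d n j = partialSum x.dat d n j from rfl, hupd] at h1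
    refine h1.seq ((Det.setVar (fl (j + 1)) (hshR _ hj _ hj.le _ hj.le) ?_ (by norm_num) rfl
      rfl).seq_weight
      ((Det.setVar ((j + 1 : ℕ) : ℤ) (hshR _ hj _ hj _ hj.le) (by push_cast; rfl) (by norm_num) rfl
      rfl).seq_weight
      (Det.setVar 0 (hshR _ hj _ hj _ hj) rfl (by norm_num) rfl ?_)))
    · simp only [fl]
      rw [Finset.sum_range_succ]
      change _ + near x.wid x.shift x.reach (if j < j + 1 then partialSum x.dat d n j else 0) = _
      rw [if_pos (Nat.lt_succ_self j)]
      rfl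
    · simp only [A]
      rw [hrow]
      rfl

theorem clog_le_of_two_mul_le {N l : ℕ} (h : 2 * N ≤ 2 ^ l) : Nat.clog 2 N ≤ l :=
  Nat.clog_le_of_le_pow (by omega)

/-- The law is that of full noise in both cases. If no grid point is within reach, the sampler is
called with bound 1 and tosses nothing; all terms of the full sum then coincide, so the average is
unchanged. -/
theorem runs_releaseColumn {l j R : ℕ} {x : Vars} {y : ℤ} (hx : Short l x.mem)
    (hcoin : x.coin = 0) (hpow : x.pow = 0) (hdraw : x.draw = 0) (hbound : x.bound = 0)
    (hrad : x.rad = R) (hcol : x.col = j) (hout : x.out j = y) (hW : 0 < x.wid)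
    (hT : (R : ℤ) ≤ x.reach) (hRl : 2 * (2 * R + 1) ≤ 2 ^ l) (hjl : j + 1 < 2 ^ l)
    (hr : ∀ z : ℤ, |z| ≤ R → |rnd x.wid x.shift (y + z)| < 2 ^ l) :
    Runs releaseColumn x.mem (unif (2 * R + 1))
      (fun v => ({x with out := Function.update x.out j (rnd x.wid x.shift (y + ((v : ℤ) - R)))
                         col := ((j + 1 : ℕ) : ℤ)} : Vars).mem)
      (3 * (l + 1) * (releaseColumn.weight * (l + 1) ^ 2) : ℕ)
      (if near x.wid x.shift x.reach y = 0 then 0 else (2 * Nat.clog 2 (2 * R + 1) : ℕ)) := by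
  set c := near x.wid x.shift x.reach y with hc
  have hc0 : 0 ≤ c := near_nonneg hW (le_trans (by positivity) hT)
  set N : ℕ := if c = 0 then 1 else 2 * R + 1 with hN
  have hN1 : 1 ≤ N := by rw [hN]; split_ifs <;> omega
  have hNR : N ≤ 2 * R + 1 := by rw [hN]; split_ifs <;> omega
  -- Subtracting N / 2 centres the draw in both cases: it is 0 for N = 1 and R for N = 2R + 1.
  have hN2 : N / 2 ≤ R := by omega
  have hcell : ∀ y : Vars, y.col = j → y.col.toNat = j := fun y h => by rw [h]; rfl
  have hnear : nearTerm.val x.mem = c := by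
    change near x.wid x.shift x.reach (x.out x.col.toNat) = c
    rw [hcell x hcol, hout]
  have hb : Det columnBound x.mem ({x with bound := N} : Vars).mem
      (columnBound.weight * (l + 1) ^ 2) := by
    by_cases h : c = 0
    · refine Det.branch_not_weight hx (by rw [hnear]; omega)
        (Det.setVar (N : ℤ) hx ?_ (by norm_num) rfl rfl)
      rw [hN, if_pos h]
      rfl
    · refine Det.branch_pos_weight hx (by rw [hnear]; omega)
        (Det.setVar (N : ℤ) hx ?_ (by norm_num) rfl rfl)
      rw [hN, if_neg h]
      change 2 * x.rad + 1 = _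
      rw [hrad]
      push_cast
      rfl
  have hsN : Short l ({x with bound := (N : ℤ)} : Vars).mem :=
    Vars.short_set (a := 10) hx (abs_natCast_lt (by omega)) (by norm_num) rfl rfl
  have hs := runs_sampler (x := {x with bound := N}) hsN hcoin hpow rfl hN1 (by omega)
  have hlog : Nat.clog 2 N ≤ l := clog_le_of_two_mul_le (by omega)
  have hshV : ∀ v < N, Short l ({x with bound := (N : ℤ), draw := (v : ℤ)} : Vars).mem :=
    fun v hv => Vars.short_set (a := 11) (z := (v : ℤ)) hsN (abs_natCast_lt (by omega))
      (by norm_num) rfl rfl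
  have hrv : ∀ v < N, |rnd x.wid x.shift (y + ((v : ℤ) - (N / 2 : ℕ)))| < 2 ^ l := fun v hv =>
    hr _ (abs_le.2 (by omega))
  have htail : ∀ v : ℕ, unif N v ≠ 0 → Det storeColumn
      ({x with bound := (N : ℤ), draw := (v : ℤ)} : Vars).mem
      ({x with out := Function.update x.out j (rnd x.wid x.shift (y + ((v : ℤ) - (N / 2 : ℕ))))
               col := ((j + 1 : ℕ) : ℤ)} : Vars).mem (storeColumn.weight * (l + 1) ^ 2) := by
    intro v hv
    have hvN := lt_of_unif_ne_zero hv
    set z := rnd x.wid x.shift (y + ((v : ℤ) - (N / 2 : ℕ))) with hz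
    have s1 : Short l
        ({x with bound := (N : ℤ), draw := (v : ℤ), out := Function.update x.out j z} : Vars).mem :=
      Vars.short_out (k := j) (hshV v hvN) (hrv v hvN)
    have s2 : Short l
        ({x with bound := (N : ℤ), draw := 0, out := Function.update x.out j z} : Vars).mem :=
      Vars.short_set (a := 11) s1 (z := 0) (by simp) (by norm_num) rfl rfl
    have s3 : Short l
        ({x with bound := 0, draw := 0, out := Function.update x.out j z} : Vars).mem :=
      Vars.short_set (a := 10) s2 (z := 0) (by simp) (by norm_num) rfl rfl
    refine (Det.assign j z (i := var 14) (e := times (var 4)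
          (quot (plus (plus current (var 5)) (minus (var 11) (quot (var 10) (.const 2)))) (var 4)))
      (hshV v hvN) hcol ?_ (Vars.set_out _ _)).seq_weight
      ((Det.setVar 0 s1 rfl (by norm_num) rfl rfl).seq_weight
      ((Det.setVar 0 s2 rfl (by norm_num) rfl rfl).seq_weight
      (Det.setVar ((j + 1 : ℕ) : ℤ) s3 ?_ (by norm_num) rfl ?_)))
    · change x.wid * ((x.out x.col.toNat + x.shift + ((v : ℤ) - (N : ℤ) / 2)) / x.wid) = z
      rw [hcell x hcol, hout, hz, rnd]
      push_cast
      congr 2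
      ring
    · change x.col + 1 = _
      rw [hcol]
      push_cast
      rfl
    · simp only [hdraw, hbound]
      rfl
  refine ((hb.seq_runs (hs.seq_det (tsum_unif (by omega)) htail)).congr_law fun G => ?_).mono ?_ ?_
  · by_cases h : c = 0
    · have hN' : N = 1 := if_pos h
      have h2 : ∀ v ∈ Finset.range (2 * R + 1),
          rnd x.wid x.shift (y + ((v : ℤ) - R)) = rnd x.wid x.shift y := fun v hv => by
        have := Finset.mem_range.1 hv
        exact rnd_eq_of_near_eq_zero hW (le_trans (abs_le.2 (by omega)) hT) h
      have h3 : ∀ v ∈ Finset.range (2 * R + 1),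
          G ({x with out := Function.update x.out j (rnd x.wid x.shift (y + ((v : ℤ) - R)))
                     col := ((j + 1 : ℕ) : ℤ)} : Vars).mem
          = G ({x with out := Function.update x.out j (rnd x.wid x.shift y)
                       col := ((j + 1 : ℕ) : ℤ)} : Vars).mem := fun v hv => by rw [h2 v hv]
      rw [hN', tsum_unif_mul, tsum_unif_mul, Finset.sum_congr rfl h3]
      simp only [Finset.range_one, Finset.sum_singleton, Finset.sum_const, Finset.card_range,
        nsmul_eq_mul, ← mul_assoc]
      rw [ENNReal.inv_mul_cancel (by exact_mod_cast (by omega : 2 * R + 1 ≠ 0))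
        (ENNReal.natCast_ne_top _)]
      simp
    · have hN' : N = 2 * R + 1 := if_neg h
      have hN3 : (2 * R + 1) / 2 = R := by omega
      rw [hN', hN3]
  · have hwt : releaseColumn.weight
      = columnBound.weight + (sampler.weight + storeColumn.weight) := rfl
    rw [hwt]
    generalize columnBound.weight = w1
    generalize storeColumn.weight = w2
    generalize sampler.weight = w3
    norm_cast
    generalize (l + 1) ^ 2 = θ
    have h5 : 3 * (Nat.clog 2 N + 1) * (w3 * θ) ≤ 3 * (l + 1) * (w3 * θ) := by gcongr
    nlinarith [Nat.zero_le (l * (w1 * θ)), Nat.zero_le (l * (w2 * θ)), Nat.zero_le (w1 * θ),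
      Nat.zero_le (w2 * θ)]
  · by_cases h : c = 0
    · rw [if_pos h, hN, if_pos h]
      simp
    · rw [if_neg h, hN, if_neg h]

/-- The output vector after the columns from `j` on have been processed. -/
def released (x : Vars) (d R j : ℕ) (S : ℕ → ℤ) (z : Fin d → ℕ) (k : ℕ) : ℤ :=
  if h : j ≤ k ∧ k < d then rnd x.wid x.shift (S k + ((z ⟨k, h.2⟩ : ℤ) - R)) else x.out k

/-- Induction on the number of columns still to be processed. At every stage the outcomes are
indexed by complete vectors z, of which only the remaining coordinates matter; this keeps the index
type fixed. -/
theorem runs_release {l d R : ℕ} {x : Vars} {S : ℕ → ℤ} (hx : Short l x.mem)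
    (hd : x.par 0 = d) (hcoin : x.coin = 0) (hpow : x.pow = 0) (hdraw : x.draw = 0)
    (hbound : x.bound = 0) (hrad : x.rad = R) (hcol : x.col = 0) (hW : 0 < x.wid)
    (hT : (R : ℤ) ≤ x.reach) (hout : ∀ k < d, x.out k = S k)
    (hRl : 2 * (2 * R + 1) ≤ 2 ^ l) (hdl : d < 2 ^ l)
    (hr : ∀ k < d, ∀ z : ℤ, |z| ≤ R → |rnd x.wid x.shift (S k + z)| < 2 ^ l) :
    Runs release x.mem (fun z : Fin d → ℕ => ∏ i, unif (2 * R + 1) (z i))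
      (fun z => ({x with out := released x d R 0 S z, col := d} : Vars).mem)
      ((d + 1) * (3 * (l + 1) * (release.weight * (l + 1) ^ 2)) : ℕ)
      (∑ k ∈ Finset.range d, if near x.wid x.shift x.reach (S k) = 0 then 0
        else (2 * Nat.clog 2 (2 * R + 1) : ℕ)) := by
  set bit : ℕ → ℝ≥0∞ := fun k => if near x.wid x.shift x.reach (S k) = 0 then 0
        else (2 * Nat.clog 2 (2 * R + 1) : ℕ) with hbit
  have hwt : release.weight = (minus (param 0) (var 14)).costWeight + 1 + releaseColumn.weight := rfl
  suffices h : ∀ m ≤ d, ∀ o : ℕ → ℤ, (∀ k < d, d - m ≤ k → o k = S k) →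
      Short l ({x with out := o, col := (d - m : ℕ)} : Vars).mem →
      Runs release ({x with out := o, col := (d - m : ℕ)} : Vars).mem
      (fun z : Fin d → ℕ => ∏ i, unif (2 * R + 1) (z i))
      (fun z => ({x with out := released {x with out := o} d R (d - m) S z, col := d} : Vars).mem)
      ((m + 1) * (3 * (l + 1) * (release.weight * (l + 1) ^ 2)) : ℕ)
      (∑ k ∈ Finset.Ico (d - m) d, bit k) by
    have h1 := h d le_rfl x.out (fun k hk _ => hout k hk)
    have h2 : ({x with out := x.out, col := ((d - d : ℕ) : ℤ)} : Vars) = x := by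
      apply Vars.ext <;> simp [hcol]
    rw [h2] at h1
    have h3 := h1 hx
    rw [Nat.sub_self, ← Finset.range_eq_Ico] at h3
    exact h3
  intro m hm
  induction m with
  | zero =>
    intro o ho hs
    have hg : ¬ 0 < (minus (param 0) (var 14)).val
        ({x with out := o, col := (d - 0 : ℕ)} : Vars).mem := by
      change ¬ (0 : ℤ) < x.par 0 - (d : ℤ)
      rw [hd]
      simp
    have hd0 := (Det.loop_not (p := releaseColumn) hg).runs
    refine (hd0.congr_law fun G => ?_).mono ?_ (by simp)
    · have : ∀ z : Fin d → ℕ, released {x with out := o} d R (d - 0) S z = o := by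
        intro z
        funext k
        rw [released, dif_neg (by omega)]
      simp_rw [this, ENNReal.tsum_mul_right]
      rw [tsum_pi_unif (by omega)]
      simp
    · refine Nat.cast_le.2 ((Arith.guard_cost_le hs _).trans ?_)
      rw [hwt]
      generalize (l + 1) ^ 2 = θ
      generalize releaseColumn.weight = w1
      generalize Arith.costWeight _ = w2
      nlinarith [Nat.zero_le (l * (w1 * θ)), Nat.zero_le (l * ((w2 + 1) * θ)), Nat.zero_le (w1 * θ),
        Nat.zero_le ((w2 + 1) * θ)]
  | succ m ih =>
    intro o ho hs
    set j := d - (m + 1) with hj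
    have hjd : j < d := by omega
    have hj1 : d - m = j + 1 := by omega
    rw [hj1] at ih
    have hg : 0 < (minus (param 0) (var 14)).val
        ({x with out := o, col := (j : ℤ)} : Vars).mem := by
      change (0 : ℤ) < x.par 0 - (j : ℤ)
      rw [hd]
      omega
    have hb := runs_releaseColumn (x := {x with out := o, col := (j : ℤ)}) (j := j) (y := S j) hs
      hcoin hpow hdraw hbound hrad rfl (ho j hjd le_rfl) hW hT hRl (by omega) (hr j hjd)
    have hsq := hb.seq (q := release) fun v hv => ih (by omega) _ (fun k hk hk' => by
        rw [Function.update_of_ne (by omega)]; exact ho k hk (by omega))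
      (Vars.short_set (a := 14) (z := ((j + 1 : ℕ) : ℤ))
        (Vars.short_out (k := j) hs (hr j hjd _ (abs_le.2 (by
          have := lt_of_unif_ne_zero hv
          omega)))) (abs_natCast_lt (by omega)) (by norm_num) rfl rfl)
    refine ((Runs.loop_pos hg hsq).congr_law fun G => ?_).mono ?_ ?_
    · rw [ENNReal.tsum_prod']
      -- The draw for column j followed by an irrelevant coordinate j of z becomes a single
      -- coordinate of z.
      rw [← tsum_resample (tsum_unif (by omega)) ⟨j, hjd⟩]
      refine tsum_congr fun v => ?_
      simp_rw [mul_assoc, ENNReal.tsum_mul_left]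
      congr 1
      refine tsum_congr fun z => ?_
      congr 4
      funext k
      simp only [released]
      rcases lt_trichotomy k j with h | h | h
      · rw [dif_neg (by omega), dif_neg (by omega), Function.update_of_ne h.ne]
      · subst h
        rw [dif_neg (by omega), dif_pos ⟨le_rfl, hjd⟩, Function.update_self, Function.update_self]
      · by_cases hkd : k < d
        · rw [dif_pos ⟨h, hkd⟩, dif_pos ⟨h.le, hkd⟩,
            Function.update_of_ne (by simpa [Fin.ext_iff] using h.ne')]
        · rw [dif_neg (by omega), dif_neg (by omega), Function.update_of_ne h.ne']
    · rw [ENNReal.tsum_mul_right, tsum_unif (by omega), one_mul]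
      norm_cast
      have hgc := Arith.guard_cost_le hs (minus (param 0) (var 14))
      rw [hwt] at *
      revert hgc
      generalize Arith.cost _ _ = gc
      generalize (l + 1) ^ 2 = θ
      generalize releaseColumn.weight = w1
      generalize Arith.costWeight _ = w2
      intro hgc
      nlinarith [Nat.zero_le (l * ((w2 + 1) * θ)), Nat.zero_le ((w2 + 1) * θ)]
    · rw [ENNReal.tsum_mul_right, tsum_unif (by omega), one_mul,
        Finset.sum_eq_sum_Ico_succ_bot hjd]

/-- A crude bound from W ≥ 1, used only to ensure that the counter of grid points fits into a word.
-/
theorem near_le {W sh T y : ℤ} (hW : 0 < W) (hT : 0 ≤ T) : near W sh T y ≤ 2 * T := by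
  have h1 : (y + sh + T) / W ≤ (y + sh - T + 2 * T * W) / W :=
    Int.ediv_le_ediv hW (by nlinarith)
  rw [Int.add_mul_ediv_right _ _ hW.ne'] at h1
  unfold near
  linarith

theorem abs_rnd_le {W sh y : ℤ} (hW : 0 < W) : |rnd W sh y| ≤ |y + sh| + W := by
  unfold rnd
  have h1 := Int.mul_ediv_add_emod (y + sh) W
  have h2 := Int.emod_nonneg (y + sh) hW.ne'
  have h3 := Int.emod_lt_of_pos (y + sh) hW
  have h4 := abs_le.1 (le_refl |y + sh|)
  rw [abs_le]
  constructor <;> linarith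

/-- The word length `l` suffices for all numbers that occur at noise level `J`. -/
def Fits (d s K n J l : ℕ) : Prop := 64 * ((n + 1) * (d + 1) * (s * K) * (J + 2)) ≤ 2 ^ l

theorem Fits.bounds {d s K n J l : ℕ} (h : Fits d s K n J l) (hs : 1 ≤ s) (hK : 1 ≤ K) :
    64 * (n + 1) ≤ 2 ^ l ∧ 64 * (d + 1) ≤ 2 ^ l ∧ 64 * (s * K) ≤ 2 ^ l ∧
      64 * (d * (K * (J + 2))) ≤ 2 ^ l ∧ 64 * (K * (J + 2)) ≤ 2 ^ l := by
  unfold Fits at h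
  have hsK : 1 ≤ s * K := Nat.mul_pos hs hK
  have hKs : K ≤ s * K := Nat.le_mul_of_pos_left _ hs
  have key : ∀ a, a ≤ (n + 1) * (d + 1) * (s * K) * (J + 2) → 64 * a ≤ 2 ^ l := fun a ha =>
    (Nat.mul_le_mul_left 64 ha).trans h
  refine ⟨key _ ?_, key _ ?_, key _ ?_, key _ ?_, key _ ?_⟩
  · calc n + 1 = (n + 1) * 1 * 1 * 1 := by ring
      _ ≤ _ := by gcongr <;> omega
  · calc d + 1 = 1 * (d + 1) * 1 * 1 := by ring
      _ ≤ _ := by gcongr <;> omega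
  · calc s * K = 1 * 1 * (s * K) * 1 := by ring
      _ ≤ _ := by gcongr <;> omega
  · calc d * (K * (J + 2)) = 1 * d * K * (J + 2) := by ring
      _ ≤ _ := by gcongr <;> omega
  · calc K * (J + 2) = 1 * 1 * K * (J + 2) := by ring
      _ ≤ _ := by gcongr <;> omega

theorem partialSum_bounds {dat : ℕ → ℤ} {d m j : ℕ} (h : ∀ k, 0 ≤ dat k ∧ dat k ≤ 1) :
    0 ≤ partialSum dat d m j ∧ partialSum dat d m j ≤ m := by
  refine ⟨Finset.sum_nonneg fun i _ => (h _).1, ?_⟩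
  refine (Finset.sum_le_sum fun i _ => (h (i * d + j)).2).trans (le_of_eq ?_)
  simp

/-- The bound for the fine part of the radius. -/
def fineBound (W sh T : ℤ) (d K : ℕ) (S : ℕ → ℤ) : ℕ :=
  if ∑ j ∈ Finset.range d, near W sh T (S j) = 0 then 1 else 4 * K

/-- The reach 4K(J+2) exceeds every possible radius and depends on J only, so it can be tested
before the fine part is drawn. The bits for the fine part are charged to one column within reach, so
each such column pays four logarithms instead of two. -/
theorem runs_finish {l d s K n J : ℕ} {x : Vars} (hx : Short l x.mem) (hs : 1 ≤ s) (hK : 1 ≤ K)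
    (hfit : Fits d s K n J l) (hd : x.par 0 = d) (hn : x.par 3 = n)
    (hdat : ∀ k, 0 ≤ x.dat k ∧ x.dat k ≤ 1) (hlen : x.len = (4 * K : ℕ)) (hW : 0 < x.wid)
    (hW' : x.wid ≤ (4 * (s * K) : ℕ)) (hsh : 0 ≤ x.shift) (hsh' : x.shift ≤ (4 * (s * K) : ℕ))
    (hlev : x.level = J) (hcoin : x.coin = 0) (hpow : x.pow = 0) (hflag : x.flag = 0)
    (hcol : x.col = 0) (hrow : x.row = 0) (hout : x.out = 0) :
    ∃ μ : ℕ × (Fin d → ℕ) → Memory,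
      Runs finish x.mem (fun a => unif (fineBound x.wid x.shift (4 * K * (J + 2) : ℕ) d K
          (partialSum x.dat d n)) a.1 * ∏ i, unif (2 * (4 * K * (J + 1) + a.1) + 1) (a.2 i)) μ
        ((d + 1) * ((n + 1) * (3 * (l + 1) * (finish.weight * (l + 1) ^ 2))) : ℕ)
        (∑ k ∈ Finset.range d, if near x.wid x.shift (4 * K * (J + 2) : ℕ) (partialSum x.dat d n k)
          = 0 then 0 else (4 * Nat.clog 2 (8 * K * (J + 2)) : ℕ)) ∧
      ∀ a (k : Fin d), μ a 2 k = rnd x.wid x.shift (partialSum x.dat d n k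
        + ((a.2 k : ℤ) - (4 * K * (J + 1) + a.1 : ℕ))) := by
  obtain ⟨b1, b2, b3, b4, b5⟩ := hfit.bounds hs hK
  have hpl : (0 : ℕ) < 2 ^ l := by positivity
  set T : ℕ := 4 * K * (J + 2) with hTdef
  set S := partialSum x.dat d n with hS
  have hT4 : T = 4 * (K * (J + 2)) := by rw [hTdef]; ring
  have hKJ : K ≤ K * (J + 2) := Nat.le_mul_of_pos_right _ (by omega)
  have hTl : T < 2 ^ l := by omega
  have hT0 : (0 : ℤ) ≤ (T : ℤ) := by positivity
  set N := fineBound x.wid x.shift T d K S with hN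
  have hN1 : 1 ≤ N := by rw [hN, fineBound]; split_ifs <;> omega
  have hN4 : N ≤ 4 * K := by rw [hN, fineBound]; split_ifs <;> omega
  have hF0 : 0 ≤ ∑ j ∈ Finset.range d, near x.wid x.shift T (S j) :=
    Finset.sum_nonneg fun _ _ => near_nonneg hW hT0
  have hF : ∑ j ∈ Finset.range d, near x.wid x.shift T (S j) < 2 ^ l := by
    have h1 : ∑ j ∈ Finset.range d, near x.wid x.shift T (S j) ≤ ∑ j ∈ Finset.range d, (2 * T : ℤ) :=
      Finset.sum_le_sum fun _ _ => near_le hW hT0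
    rw [Finset.sum_const, Finset.card_range, nsmul_eq_mul] at h1
    have h2 : d * (2 * T) < 2 ^ l := by
      have : d * (2 * T) = 8 * (d * (K * (J + 2))) := by rw [hT4]; ring
      omega
    exact h1.trans_lt (by exact_mod_cast h2)
  have s1 : Short l ({x with reach := T} : Vars).mem :=
    Vars.short_set (a := 8) hx (abs_natCast_lt hTl) (by norm_num) rfl rfl
  have e1 : Det storeReach x.mem ({x with reach := T} : Vars).mem
      (storeReach.weight * (l + 1) ^ 2) := by
    refine Det.setVar (T : ℤ) hx ?_ (by norm_num) rfl rfl
    change x.len * (x.level + 2) = T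
    rw [hlen, hlev, hTdef]
    push_cast
    ring
  have hSb : ∀ m ≤ n, ∀ j < d, |partialSum x.dat d m j| < 2 ^ l := fun m hm j _ => by
    obtain ⟨h1, h2⟩ := partialSum_bounds (d := d) (m := m) (j := j) hdat
    rw [abs_of_nonneg h1]
    exact h2.trans_lt (by exact_mod_cast (by omega : m < 2 ^ l))
  have e2 := det_scan (x := {x with reach := T}) s1 hd hn hcol hrow hflag hout hSb (by omega)
    (by omega) hW hT0 hF
  set F := ∑ j ∈ Finset.range d, near x.wid x.shift T (S j) with hFdef
  set o : ℕ → ℤ := fun k => if k < d then S k else 0 with ho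
  have s2 : ∀ F' : ℤ, |F'| < 2 ^ l → Short l ({x with reach := (T : ℤ), flag := F'} : Vars).mem :=
    fun F' hF' => Vars.short_set (a := 9) (x := {x with reach := (T : ℤ)}) s1 hF' (by norm_num)
      rfl rfl
  have s3 : Short l ({x with reach := (T : ℤ), flag := F, out := o} : Vars).mem := by
    have : ∀ m ≤ d, Short l ({x with reach := (T : ℤ), flag := F
                                     out := fun k => if k < m then S k else 0} : Vars).mem := by
      intro m hm
      induction m with
      | zero =>
        simp only [Nat.not_lt_zero, if_false]
        rw [show (fun _ : ℕ => (0 : ℤ)) = x.out from hout.symm]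
        exact s2 F (by rwa [abs_of_nonneg hF0])
      | succ m ih =>
        have := Vars.short_out (k := m) (ih (by omega)) (hSb n le_rfl m (by omega))
        convert this using 3
        funext k
        simp only [Function.update_apply]
        rcases lt_trichotomy k m with h | h | h
        · simp [h.ne, h, h.trans (Nat.lt_succ_self m)]
        · subst h; simp [hS]
        · simp [h.ne', not_lt.2 h.le, not_lt.2 (Nat.succ_le_of_lt h)]
    exact this d le_rfl
  have s4 : Short l ({x with reach := (T : ℤ), flag := F, out := o, col := (d : ℤ)} : Vars).mem :=
    Vars.short_set (a := 14) (z := (d : ℤ)) s3 (abs_natCast_lt (by omega)) (by norm_num) rfl rfl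
  have e3 : Det radiusBound
      ({x with reach := (T : ℤ), flag := F, out := o, col := (d : ℤ)} : Vars).mem
      ({x with reach := (T : ℤ), flag := F, out := o, col := (d : ℤ), bound := (N : ℤ)} : Vars).mem
      (radiusBound.weight * (l + 1) ^ 2) := by
    by_cases h : F = 0
    · refine Det.branch_not_weight s4 (by change ¬ 0 < F; omega)
        (Det.setVar (N : ℤ) s4 ?_ (by norm_num) rfl rfl)
      rw [hN, fineBound, if_pos h]
      rfl
    · refine Det.branch_pos_weight s4 (by change 0 < F; omega)
        (Det.setVar (N : ℤ) s4 ?_ (by norm_num) rfl rfl)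
      rw [hN, fineBound, if_neg h]
      exact hlen
  have s5 : Short l
      ({x with reach := (T : ℤ), flag := F, out := o, col := (d : ℤ), bound := (N : ℤ)} :
        Vars).mem :=
    Vars.short_set (a := 10) s4 (abs_natCast_lt (by omega)) (by norm_num) rfl rfl
  have e4 := runs_sampler s5 hcoin hpow rfl hN1 (by omega)
  let R : ℕ → ℕ := fun I => 4 * K * (J + 1) + I
  -- The reach is exactly one cell length 4K above the least radius, and the fine part stays below
  -- 4K.
  have hR : ∀ I < N, R I < T := fun I hI => by
    have h1 : 4 * K * (J + 1) + 4 * K = T := by rw [hTdef]; ring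
    simp only [R]
    omega
  have e5 : ∀ I, unif N I ≠ 0 → Runs (.seq storeRadius release)
      ({x with reach := (T : ℤ), flag := F, out := o, col := (d : ℤ), bound := (N : ℤ)
               draw := (I : ℤ)} : Vars).mem
      (fun z : Fin d → ℕ => ∏ i, unif (2 * R I + 1) (z i))
      (fun z => ({x with reach := (T : ℤ), flag := F, bound := 0, draw := 0, rad := (R I : ℤ)
                         out := released {x with out := o} d (R I) 0 S z, col := (d : ℤ)} :
          Vars).mem)
      (storeRadius.weight * (l + 1) ^ 2 + (d + 1) * (3 * (l + 1) * (release.weight * (l + 1) ^ 2)) : ℕ)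
      (∑ k ∈ Finset.range d, if near x.wid x.shift T (S k) = 0 then 0
        else (2 * Nat.clog 2 (8 * K * (J + 2)) : ℕ)) := by
    intro I hI
    have hIN := lt_of_unif_ne_zero hI
    have hRT := hR I hIN
    have t1 : Short l
        ({x with reach := (T : ℤ), flag := F, out := o, col := (d : ℤ), bound := (N : ℤ)
                 draw := (I : ℤ)} : Vars).mem :=
      Vars.short_set (a := 11) (z := (I : ℤ)) s5 (abs_natCast_lt (by omega)) (by norm_num) rfl rfl
    have t2 : Short l
        ({x with reach := (T : ℤ), flag := F, out := o, col := (d : ℤ), bound := (N : ℤ)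
                 draw := (I : ℤ), rad := (R I : ℤ)} : Vars).mem :=
      Vars.short_set (a := 13) (z := (R I : ℤ)) t1 (abs_natCast_lt (by omega)) (by norm_num) rfl rfl
    have t3 : Short l
        ({x with reach := (T : ℤ), flag := F, out := o, col := (d : ℤ), bound := (N : ℤ)
                 draw := 0, rad := (R I : ℤ)} : Vars).mem :=
      Vars.short_set (a := 11) (z := 0) t2 (by simp) (by norm_num) rfl rfl
    have t4 : Short l
        ({x with reach := (T : ℤ), flag := F, out := o, col := (d : ℤ), bound := 0
                 draw := 0, rad := (R I : ℤ)} : Vars).mem :=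
      Vars.short_set (a := 10) (z := 0) t3 (by simp) (by norm_num) rfl rfl
    have t5 : Short l
        ({x with reach := (T : ℤ), flag := F, out := o, col := 0, bound := 0
                 draw := 0, rad := (R I : ℤ)} : Vars).mem :=
      Vars.short_set (a := 14) (z := 0) t4 (by simp) (by norm_num) rfl rfl
    have f1 : Det storeRadius
        ({x with reach := (T : ℤ), flag := F, out := o, col := (d : ℤ), bound := (N : ℤ)
                 draw := (I : ℤ)} : Vars).mem
        ({x with reach := (T : ℤ), flag := F, out := o, col := 0, bound := 0
                 draw := 0, rad := (R I : ℤ)} : Vars).mem (storeRadius.weight * (l + 1) ^ 2) := by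
      have g1 := Det.setVar (a := 13) (R I : ℤ) t1
        (y := {x with reach := (T : ℤ), flag := F, out := o, col := (d : ℤ), bound := (N : ℤ)
                      draw := (I : ℤ), rad := (R I : ℤ)})
        (e := plus (times (var 3) (plus (var 6) (.const 1))) (var 11)) (by
          change x.len * (x.level + 1) + (I : ℤ) = _
          rw [hlen, hlev]
          simp only [R]
          push_cast
          ring) (by norm_num) rfl rfl
      have g2 := Det.setVar (a := 11) (e := .const 0) 0 t2 rfl (by norm_num) rfl
        (y := {x with reach := (T : ℤ), flag := F, out := o, col := (d : ℤ), bound := (N : ℤ)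
                      draw := 0, rad := (R I : ℤ)}) rfl
      have g3 := Det.setVar (a := 10) (e := .const 0) 0 t3 rfl (by norm_num) rfl
        (y := {x with reach := (T : ℤ), flag := F, out := o, col := (d : ℤ), bound := 0
                      draw := 0, rad := (R I : ℤ)}) rfl
      have g4 := Det.setVar (a := 14) (e := .const 0) 0 t4 rfl (by norm_num) rfl
        (y := {x with reach := (T : ℤ), flag := F, out := o, col := 0, bound := 0
                      draw := 0, rad := (R I : ℤ)}) rfl
      exact g1.seq_weight (g2.seq_weight (g3.seq_weight g4))
    have f2 := runs_release (d := d) (R := R I) (S := S) t5 hd hcoin hpow rfl rfl rfl rfl hW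
      (show (R I : ℤ) ≤ (T : ℤ) by exact_mod_cast hRT.le) (fun k hk => if_pos hk) (by omega) (by omega)
      (fun k hk z hz => by
        refine lt_of_le_of_lt (abs_rnd_le hW) ?_
        obtain ⟨h1, h2⟩ : 0 ≤ S k ∧ S k ≤ n := partialSum_bounds hdat
        have hRT' : (R I : ℤ) ≤ T := by exact_mod_cast hRT.le
        change |S k + z + x.shift| + x.wid < 2 ^ l
        have hz' := abs_le.1 hz
        have h3 : |S k + z + x.shift| ≤ n + T + (4 * (s * K) : ℕ) := by
          rw [abs_le]
          constructor <;> linarith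
        have h4 : n + T + 4 * (s * K) + 4 * (s * K) < 2 ^ l := by omega
        have h5 : ((n + T + 4 * (s * K) + 4 * (s * K) : ℕ) : ℤ) < 2 ^ l := by exact_mod_cast h4
        push_cast at h5 h3 hW' ⊢
        linarith)
    refine (f1.seq_runs f2).mono (by push_cast; exact le_rfl) ?_
    refine Finset.sum_le_sum fun k _ => ?_
    change (if near x.wid x.shift T (S k) = 0 then (0 : ℝ≥0∞) else _) ≤ _
    split_ifs
    · exact le_rfl
    · refine Nat.cast_le.2 (Nat.mul_le_mul_left _ (Nat.clog_mono_right _ ?_))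
      have : 8 * K * (J + 2) = 2 * T := by rw [hTdef]; ring
      omega
  have e6 := e4.seq e5
  refine ⟨_, (e1.seq_runs (e2.seq_runs (e3.seq_runs e6))).mono ?_ ?_, ?_⟩
  · rw [ENNReal.tsum_mul_right, tsum_unif (by omega), one_mul]
    have hwt : finish.weight = storeReach.weight + (scan.weight + (radiusBound.weight
      + (sampler.weight + (storeRadius.weight + release.weight)))) := rfl
    have hlog : Nat.clog 2 N ≤ l := clog_le_of_two_mul_le (by omega)
    rw [hwt]
    generalize storeReach.weight = w1
    generalize scan.weight = w2
    generalize radiusBound.weight = w3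
    generalize sampler.weight = w4
    generalize storeRadius.weight = w5
    generalize release.weight = w6
    norm_cast
    generalize (l + 1) ^ 2 = θ
    have q1 : ∀ w : ℕ, w * θ ≤ (d + 1) * ((n + 1) * (3 * (l + 1) * (w * θ))) := fun w => by
      calc w * θ = 1 * (1 * (1 * (w * θ))) := by ring
        _ ≤ _ := by gcongr <;> omega
    have q2 : (d + 1) * ((n + 1) * (w2 * θ)) ≤ (d + 1) * ((n + 1) * (3 * (l + 1) * (w2 * θ))) := by
      exact Nat.mul_le_mul_left _ (Nat.mul_le_mul_left _ (Nat.le_mul_of_pos_left _ (by omega)))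
    have q4 : 3 * (Nat.clog 2 N + 1) * (w4 * θ) ≤ (d + 1) * ((n + 1) * (3 * (l + 1) * (w4 * θ))) := by
      calc 3 * (Nat.clog 2 N + 1) * (w4 * θ) = 1 * (1 * (3 * (Nat.clog 2 N + 1) * (w4 * θ))) := by
            ring
        _ ≤ _ := by gcongr <;> omega
    have q6 : (d + 1) * (3 * (l + 1) * (w6 * θ)) ≤ (d + 1) * ((n + 1) * (3 * (l + 1) * (w6 * θ))) := by
      exact Nat.mul_le_mul_left _ (Nat.le_mul_of_pos_left _ (by omega))
    have q1a := q1 w1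
    have q3a := q1 w3
    have q5a := q1 w5
    calc _ ≤ (d + 1) * ((n + 1) * (3 * (l + 1) * (w1 * θ)))
          + ((d + 1) * ((n + 1) * (3 * (l + 1) * (w2 * θ)))
          + ((d + 1) * ((n + 1) * (3 * (l + 1) * (w3 * θ)))
          + ((d + 1) * ((n + 1) * (3 * (l + 1) * (w4 * θ)))
          + ((d + 1) * ((n + 1) * (3 * (l + 1) * (w5 * θ)))
          + (d + 1) * ((n + 1) * (3 * (l + 1) * (w6 * θ))))))) := by gcongr
      _ = _ := by ring
  · rw [ENNReal.tsum_mul_right, tsum_unif (by omega), one_mul]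
    by_cases h : F = 0
    · have hN' : N = 1 := by rw [hN, fineBound, if_pos h]
      rw [hN']
      simp only [Nat.clog_one_right, mul_zero, Nat.cast_zero, zero_add]
      refine Finset.sum_le_sum fun k _ => ?_
      split_ifs
      · exact le_rfl
      · exact Nat.cast_le.2 (Nat.mul_le_mul_right _ (by norm_num))
    -- A nonzero total yields a column within reach, to which the draw of the fine part is charged.
    · obtain ⟨k₀, hk₀, hne⟩ := Finset.exists_ne_zero_of_sum_ne_zero h
      have h1 : ((2 * Nat.clog 2 N : ℕ) : ℝ≥0∞) ≤ ∑ k ∈ Finset.range d,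
          if near x.wid x.shift T (S k) = 0 then 0
          else ((2 * Nat.clog 2 (8 * K * (J + 2)) : ℕ) : ℝ≥0∞) := by
        refine le_trans ?_ (Finset.single_le_sum (fun _ _ => zero_le) hk₀)
        rw [if_neg hne]
        refine Nat.cast_le.2 (Nat.mul_le_mul_left _ (Nat.clog_mono_right _ ?_))
        have : 8 * K * (J + 2) = 2 * T := by rw [hTdef]; ring
        omega
      refine (add_le_add_left h1 _).trans (le_of_eq ?_)
      rw [← Finset.sum_add_distrib]
      refine Finset.sum_congr rfl fun k _ => ?_
      split_ifs
      · simp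
      · push_cast
        ring
  · intro a k
    change released {x with out := o} d (R a.1) 0 S a.2 k = _
    rw [released, dif_pos ⟨Nat.zero_le _, k.2⟩]

/-- The level is unbounded, so round i is analysed with a word length growing by one per round; its
squared cost is still summable against 2^-i. The initial coin 1 lets the loop start. -/
theorem runs_drawLevel {l : ℕ} {x : Vars} (hx : Short l x.mem) (hlev : x.level = 0)
    (hcoin : x.coin = 1) :
    Runs drawLevel x.mem geo (fun j => ({x with level := j, coin := 0} : Vars).mem)
      (∑' i : ℕ, 2⁻¹ ^ i * (2 * (drawLevel.weight * (l + i + 2) ^ 2) : ℕ)) 2 := by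
  have hlt : ∀ j i : ℕ, j ≤ i + 1 → j < 2 ^ (l + i + 1) := fun j i hj => by
    have h1 : i + 1 < 2 ^ (i + 1) := Nat.lt_two_pow_self
    have h2 : 2 ^ (i + 1) ≤ 2 ^ (l + i + 1) := Nat.pow_le_pow_right (by norm_num) (by omega)
    omega
  have hsh : ∀ (j i c : ℕ), j ≤ i + 1 → c ≤ 1 →
      Short (l + i + 1) ({x with level := j, coin := c} : Vars).mem := fun j i c hj hc =>
    Vars.short_set (a := 7) (z := (c : ℤ)) (Vars.short_set (a := 6) (z := (j : ℤ))
      (y := {x with level := j}) (hx.mono (by omega))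
      (abs_natCast_lt (hlt j i hj)) (by norm_num) rfl rfl)
      (abs_natCast_lt (lt_of_le_of_lt hc (by
        have : 1 ≤ l + i + 1 := by omega
        exact Nat.one_lt_two_pow (by omega)))) (by norm_num) rfl rfl
  set p : Cmd := .seq (.toss 7 (.const 0)) (setVar 6 (plus (var 6) (var 7))) with hp
  have hA0 : x = {x with level := (0 : ℕ), coin := (1 : ℕ)} := by
    apply Vars.ext <;> simp [hlev, hcoin]
  have hbody : ∀ j : ℕ, Runs p ({x with level := (j : ℤ), coin := ((1 : ℕ) : ℤ)} : Vars).mem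
      (fun _ : Bool => 2⁻¹) (fun b => cond b
        ({x with level := ((j + 1 : ℕ) : ℤ), coin := ((1 : ℕ) : ℤ)} : Vars).mem
        ({x with level := (j : ℤ), coin := 0} : Vars).mem)
      (p.weight * (l + j + 1 + 1) ^ 2 : ℕ) 1 := by
    intro j
    have ht := Runs.toss (a := 7) 0 (hsh j j 1 (by omega) le_rfl) (i := .const 0) rfl
    simp only [Vars.set_coin] at ht
    refine ht.seq_det_weight tsum_bool_half fun b _ => ?_
    have h1 := Det.setVar (a := 6) (e := plus (var 6) (var 7)) ((j + b.toNat : ℕ) : ℤ)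
      (hsh j j b.toNat (by omega) (Bool.toNat_le b)) (by push_cast; rfl) (by norm_num) rfl
      (y := {x with level := ((j + b.toNat : ℕ) : ℤ), coin := b.toNat}) rfl
    cases b
    · exact h1
    · exact h1
  have h := Runs.geometric (e := var 7) (p := p)
    (A := fun j => ({x with level := (j : ℤ), coin := ((1 : ℕ) : ℤ)} : Vars).mem)
    (D := fun j => ({x with level := (j : ℤ), coin := 0} : Vars).mem)
    (g := fun j => ((var 7).costWeight + 1) * (l + j + 1 + 1) ^ 2)
    (fun j => (by norm_num : (0 : ℤ) < ((1 : ℕ) : ℤ))) (fun j => (by norm_num : ¬ (0 : ℤ) < 0))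
    (fun j => Arith.guard_cost_le (hsh j j 1 (by omega) le_rfl) _)
    (fun j => Arith.guard_cost_le (hsh j j 0 (by omega) (by omega)) _) hbody
  rw [← hA0] at h
  refine h.mono (ENNReal.tsum_le_tsum fun i => ?_) le_rfl
  gcongr
  have hwt : drawLevel.weight = (var 7).costWeight + 1 + p.weight := rfl
  rw [hwt]
  norm_cast
  generalize p.weight = w1
  generalize (var 7).costWeight = w2
  rw [show l + i + 1 + 1 = l + i + 2 by ring]
  generalize (l + i + 2) ^ 2 = θ
  nlinarith [Nat.zero_le (w1 * θ)]

/-- The width of the grid. -/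
def width (s K : ℕ) : ℕ := if 1 < s then s * (4 * K) else 1

theorem width_pos {s K : ℕ} (hK : 1 ≤ K) : 0 < width s K := by
  unfold width
  split_ifs
  · positivity
  · norm_num

theorem width_le {s K : ℕ} (hs : 1 ≤ s) (hK : 1 ≤ K) : width s K ≤ 4 * (s * K) := by
  have : 1 ≤ s * K := Nat.mul_pos hs hK
  unfold width
  split_ifs
  · exact le_of_eq (by ring)
  · omega

theorem det_prologue {l s K : ℕ} {x : Vars} (hx : Short l x.mem) (hs1 : x.par 1 = s)
    (hK2 : x.par 2 = K) (hs : 1 ≤ s) (hK : 1 ≤ K) (hl : 4 * (s * K) < 2 ^ l) :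
    Det prologue x.mem ({x with len := (4 * K : ℕ), wid := width s K, bound := s} : Vars).mem
      (prologue.weight * (l + 1) ^ 2) := by
  have hKs : K ≤ s * K := Nat.le_mul_of_pos_left _ hs
  have s1 : Short l ({x with len := ((4 * K : ℕ) : ℤ)} : Vars).mem :=
    Vars.short_set (a := 3) (z := ((4 * K : ℕ) : ℤ)) hx (abs_natCast_lt (by omega)) (by norm_num)
      rfl rfl
  have s2 : Short l ({x with len := ((4 * K : ℕ) : ℤ), wid := width s K} : Vars).mem :=
    Vars.short_set (a := 4) (z := (width s K : ℤ)) s1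
      (abs_natCast_lt ((width_le hs hK).trans_lt hl)) (by norm_num) rfl rfl
  refine (Det.setVar (y := {x with len := ((4 * K : ℕ) : ℤ)}) ((4 * K : ℕ) : ℤ) hx ?_
    (by norm_num) rfl rfl).seq_weight
    (Det.seq_weight (m' := ({x with len := ((4 * K : ℕ) : ℤ), wid := width s K} : Vars).mem) ?_
      (Det.setVar (s : ℤ) s2 hs1 (by norm_num) rfl rfl))
  · change 4 * x.par 2 = _
    rw [hK2]
    push_cast
    rfl
  · have hg : (minus (param 1) (.const 1)).val ({x with len := ((4 * K : ℕ) : ℤ)} : Vars).mem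
        = s - 1 := by
      rw [← hs1]; rfl
    by_cases h : 1 < s
    · refine Det.branch_pos_weight s1 (by rw [hg]; omega)
        (Det.setVar (width s K : ℤ) s1 ?_ (by norm_num) rfl rfl)
      change x.par 1 * ((4 * K : ℕ) : ℤ) = _
      rw [hs1, width, if_pos h]
      push_cast
      rfl
    · refine Det.branch_not_weight s1 (by rw [hg]; omega)
        (Det.setVar (width s K : ℤ) s1 ?_ (by norm_num) rfl rfl)
      rw [width, if_neg h]
      rfl

theorem det_storeShift {l u K : ℕ} {x : Vars} (hx : Short l x.mem) (hdraw : x.draw = u)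
    (hlen : x.len = (4 * K : ℕ)) (hl : u * (4 * K) < 2 ^ l) :
    Det storeShift x.mem ({x with shift := (u * (4 * K) : ℕ), coin := 1} : Vars).mem
      (storeShift.weight * (l + 1) ^ 2) := by
  have s1 : Short l ({x with shift := ((u * (4 * K) : ℕ) : ℤ)} : Vars).mem :=
    Vars.short_set (a := 5) (z := ((u * (4 * K) : ℕ) : ℤ)) hx (abs_natCast_lt hl) (by norm_num)
      rfl rfl
  refine (Det.setVar (y := {x with shift := ((u * (4 * K) : ℕ) : ℤ)}) ((u * (4 * K) : ℕ) : ℤ) hx ?_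
    (by norm_num) rfl rfl).seq_weight
    (Det.setVar 1 s1 rfl (by norm_num) rfl rfl)
  change x.draw * x.len = _
  rw [hdraw, hlen]
  push_cast
  rfl

/-- A bound for the expected number of random bits used for the noise, given the shift and the
noise level. -/
noncomputable def noiseBits (d s K u J : ℕ) (S : ℕ → ℤ) : ℝ≥0∞ :=
  ∑ k ∈ Finset.range d, if near (width s K) (u * (4 * K) : ℕ) (4 * K * (J + 2) : ℕ) (S k) = 0 then 0
    else (4 * Nat.clog 2 (8 * K * (J + 2)) : ℕ)

/-- One more binary digit per level is enough, because J + 2 ≤ 2·2^J. -/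
theorem Fits.level {d s K n l : ℕ} (h : Fits d s K n 0 l) (J : ℕ) : Fits d s K n J (l + J) := by
  unfold Fits at *
  have h1 : J + 1 ≤ 2 ^ J := Nat.lt_two_pow_self
  have h2 : J + 2 ≤ 2 * 2 ^ J := by omega
  calc 64 * ((n + 1) * (d + 1) * (s * K) * (J + 2))
      ≤ 64 * ((n + 1) * (d + 1) * (s * K) * (2 * 2 ^ J)) := by gcongr
    _ = 64 * ((n + 1) * (d + 1) * (s * K) * (0 + 2)) * 2 ^ J := by ring
    _ ≤ _ := by rw [pow_add]; gcongr

/-- The cube in the time bound combines the quadratic cost of a step with a number of coin tosses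
per draw that is linear in the word length. -/
theorem runs_program {l d s K n : ℕ} {x : Vars} (hx : Short l x.mem) (hs : 1 ≤ s) (hK : 1 ≤ K)
    (hfit : Fits d s K n 0 l) (hd : x.par 0 = d) (hs1 : x.par 1 = s) (hK2 : x.par 2 = K)
    (hn : x.par 3 = n) (hdat : ∀ k, 0 ≤ x.dat k ∧ x.dat k ≤ 1) (hlev : x.level = 0)
    (hcoin : x.coin = 0) (hpow : x.pow = 0) (hflag : x.flag = 0) (hcol : x.col = 0)
    (hrow : x.row = 0) (hout : x.out = 0) :
    ∃ μ : ℕ × ℕ × ℕ × (Fin d → ℕ) → Memory,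
      Runs program x.mem (fun a => unif s a.1 * (geo a.2.1 *
        (unif (fineBound (width s K) (a.1 * (4 * K) : ℕ) (4 * K * (a.2.1 + 2) : ℕ) d K
          (partialSum x.dat d n)) a.2.2.1
        * ∏ i, unif (2 * (4 * K * (a.2.1 + 1) + a.2.2.1) + 1) (a.2.2.2 i)))) μ
        (((d + 1) * (n + 1) * (3 * program.weight) : ℕ) * ∑' i : ℕ, 2⁻¹ ^ i * ((l + i + 2 : ℕ) : ℝ≥0∞) ^ 3)
        ((2 * Nat.clog 2 s : ℕ) + ∑' u, unif s u * (2 + ∑' J, geo J *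
          noiseBits d s K u J (partialSum x.dat d n))) ∧
      ∀ a, a.1 < s → ∀ k : Fin d, μ a 2 k = rnd (width s K) (a.1 * (4 * K) : ℕ)
        (partialSum x.dat d n k
          + ((a.2.2.2 k : ℤ) - (4 * K * (a.2.1 + 1) + a.2.2.1 : ℕ))) := by
  obtain ⟨b1, b2, b3, b4, b5⟩ := hfit.bounds hs hK
  have hss : s ≤ s * K := Nat.le_mul_of_pos_right _ hK
  have hKs : K ≤ s * K := Nat.le_mul_of_pos_left _ hs
  have hpl : (0 : ℕ) < 2 ^ l := by positivity
  have e1 := det_prologue hx hs1 hK2 hs hK (by omega)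
  set x1 : Vars := {x with len := (4 * K : ℕ), wid := width s K, bound := s} with hx1
  have sx1 : Short l x1.mem :=
    Vars.short_set (a := 10) (z := (s : ℤ)) (Vars.short_set (a := 4) (z := (width s K : ℤ))
      (y := {x with len := ((4 * K : ℕ) : ℤ), wid := width s K})
      (Vars.short_set (a := 3) (z := ((4 * K : ℕ) : ℤ)) (y := {x with len := ((4 * K : ℕ) : ℤ)}) hx
        (abs_natCast_lt (by omega)) (by norm_num) rfl rfl)
      (abs_natCast_lt ((width_le hs hK).trans_lt (by omega))) (by norm_num) rfl rfl)
      (abs_natCast_lt (by omega)) (by norm_num) rfl rfl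
  have e2 := runs_sampler (N := s) sx1 hcoin hpow rfl hs (by omega)
  have sx2 : ∀ u < s, Short l ({x1 with draw := (u : ℤ)} : Vars).mem := fun u hu =>
    Vars.short_set (a := 11) (z := (u : ℤ)) sx1 (abs_natCast_lt (by omega)) (by norm_num) rfl rfl
  have hus : ∀ u < s, u * (4 * K) ≤ 4 * (s * K) := fun u hu => by
    calc u * (4 * K) ≤ s * (4 * K) := by gcongr
      _ = _ := by ring
  have sx3 : ∀ u < s, ∀ c : ℕ, c ≤ 1 →
      Short l ({x1 with draw := (u : ℤ), shift := (u * (4 * K) : ℕ), coin := c} : Vars).mem :=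
    fun u hu c hc => Vars.short_set (a := 7) (z := (c : ℤ))
      (Vars.short_set (a := 5) (z := ((u * (4 * K) : ℕ) : ℤ))
      (y := {x1 with draw := (u : ℤ), shift := (u * (4 * K) : ℕ)}) (sx2 u hu)
      (abs_natCast_lt ((hus u hu).trans_lt (by omega))) (by norm_num) rfl rfl)
      (abs_natCast_lt (by omega)) (by norm_num) rfl rfl
  -- The family of memories is chosen for all u, but it is specified only for the shifts that can
  -- occur.
  have hfin : ∀ u J : ℕ, ∃ μ : ℕ × (Fin d → ℕ) → Memory, u < s →
      Runs finish
        ({x1 with draw := (u : ℤ), shift := (u * (4 * K) : ℕ), coin := 0, level := (J : ℤ)} :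
          Vars).mem
        (fun a => unif (fineBound (width s K) (u * (4 * K) : ℕ) (4 * K * (J + 2) : ℕ) d K
          (partialSum x.dat d n)) a.1 * ∏ i, unif (2 * (4 * K * (J + 1) + a.1) + 1) (a.2 i)) μ
        ((d + 1) * ((n + 1) * (3 * (l + J + 1) * (finish.weight * (l + J + 1) ^ 2))) : ℕ)
        (noiseBits d s K u J (partialSum x.dat d n)) ∧
      ∀ a (k : Fin d), μ a 2 k = rnd (width s K) (u * (4 * K) : ℕ) (partialSum x.dat d n k
        + ((a.2 k : ℤ) - (4 * K * (J + 1) + a.1 : ℕ))) := by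
    intro u J
    by_cases hu : u < s
    · have hJl : J < 2 ^ (l + J) := lt_of_lt_of_le Nat.lt_two_pow_self
        (Nat.pow_le_pow_right (by norm_num) (by omega))
      have sx4 : Short (l + J) ({x1 with draw := (u : ℤ), shift := (u * (4 * K) : ℕ), coin := 0
                                         level := (J : ℤ)} : Vars).mem :=
        Vars.short_set (a := 6) (z := (J : ℤ)) ((sx3 u hu 0 (by omega)).mono (by omega))
          (abs_natCast_lt hJl) (by norm_num) rfl rfl
      obtain ⟨μ, h1, h2⟩ := runs_finish sx4 hs hK (hfit.level J) hd hn hdat rfl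
        (Int.natCast_pos.2 (width_pos hK)) (Int.ofNat_le.2 (width_le hs hK)) (Int.natCast_nonneg _)
        (Int.ofNat_le.2 (hus u hu)) rfl rfl hpow hflag hcol hrow hout
      exact ⟨μ, fun _ => ⟨h1, h2⟩⟩
    · exact ⟨fun _ => 0, fun h => absurd h hu⟩
  choose μ hμ using hfin
  have e3 : ∀ u, unif s u ≠ 0 → Runs (.seq storeShift (.seq drawLevel finish))
      ({x1 with draw := (u : ℤ)} : Vars).mem
      (fun a : ℕ × ℕ × (Fin d → ℕ) => geo a.1 * (unif (fineBound (width s K) (u * (4 * K) : ℕ)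
        (4 * K * (a.1 + 2) : ℕ) d K (partialSum x.dat d n)) a.2.1
        * ∏ i, unif (2 * (4 * K * (a.1 + 1) + a.2.1) + 1) (a.2.2 i))) (fun a => μ u a.1 a.2)
      ((storeShift.weight * (l + 1) ^ 2 : ℕ)
        + (∑' i : ℕ, (2⁻¹ : ℝ≥0∞) ^ i * ((2 * (drawLevel.weight * (l + i + 2) ^ 2) : ℕ) : ℝ≥0∞)
        + ∑' J, geo J *
          (((d + 1) * ((n + 1) * (3 * (l + J + 1) * (finish.weight * (l + J + 1) ^ 2))) : ℕ) :
            ℝ≥0∞)))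
      (2 + ∑' J, geo J * noiseBits d s K u J (partialSum x.dat d n)) := by
    intro u hu
    have hus' := lt_of_unif_ne_zero hu
    refine (det_storeShift (sx2 u hus') rfl rfl ((hus u hus').trans_lt (by omega))).seq_runs ?_
    exact (runs_drawLevel (x := {x1 with draw := (u : ℤ), shift := (u * (4 * K) : ℕ), coin := 1})
      (sx3 u hus' 1 le_rfl) hlev rfl).seq fun J _ => (hμ u J hus').1
  refine ⟨fun a => μ a.1 a.2.1 a.2.2, (e1.seq_runs (e2.seq e3)).mono ?_ ?_,
    fun a ha => (hμ a.1 a.2.1 ha).2 a.2.2⟩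
  · rw [ENNReal.tsum_mul_right, tsum_unif (by omega), one_mul]
    have hlog : Nat.clog 2 s ≤ l := clog_le_of_two_mul_le (by omega)
    have hwt : program.weight = prologue.weight + (sampler.weight + (storeShift.weight
      + (drawLevel.weight + finish.weight))) := rfl
    rw [hwt]
    generalize prologue.weight = w1
    generalize sampler.weight = w2
    generalize storeShift.weight = w3
    generalize drawLevel.weight = w4
    generalize finish.weight = w5
    set X : ℝ≥0∞ := ∑' i : ℕ, 2⁻¹ ^ i * ((l + i + 2 : ℕ) : ℝ≥0∞) ^ 3 with hX
    have hX0 : (((l + 2) ^ 3 : ℕ) : ℝ≥0∞) ≤ X := by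
      refine le_trans (le_of_eq ?_) (ENNReal.le_tsum 0)
      push_cast
      ring
    have hdn : (1 : ℝ≥0∞) ≤ ((d + 1) * (n + 1) : ℕ) := by
      exact_mod_cast Nat.mul_pos (Nat.succ_pos d) (Nat.succ_pos n)
    have hsq : (l + 1) ^ 2 ≤ (l + 2) ^ 3 := by
      calc (l + 1) ^ 2 ≤ (l + 2) ^ 2 := by gcongr; omega
        _ ≤ _ := Nat.pow_le_pow_right (by omega) (by omega)
    have c1 : ∀ w : ℕ, ((w * (l + 1) ^ 2 : ℕ) : ℝ≥0∞) ≤ ((d + 1) * (n + 1) : ℕ) * ((3 * w : ℕ) * X) := by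
      intro w
      calc ((w * (l + 1) ^ 2 : ℕ) : ℝ≥0∞) ≤ ((3 * w * (l + 2) ^ 3 : ℕ) : ℝ≥0∞) := by
            refine Nat.cast_le.2 (Nat.mul_le_mul (by omega) hsq)
        _ = 1 * ((3 * w : ℕ) * ((l + 2) ^ 3 : ℕ)) := by push_cast; ring
        _ ≤ _ := by gcongr
    have c2 : ((3 * (Nat.clog 2 s + 1) * (w2 * (l + 1) ^ 2) : ℕ) : ℝ≥0∞)
        ≤ ((d + 1) * (n + 1) : ℕ) * ((3 * w2 : ℕ) * X) := by
      calc ((3 * (Nat.clog 2 s + 1) * (w2 * (l + 1) ^ 2) : ℕ) : ℝ≥0∞)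
          ≤ ((3 * w2 * (l + 2) ^ 3 : ℕ) : ℝ≥0∞) := by
            refine Nat.cast_le.2 ?_
            calc 3 * (Nat.clog 2 s + 1) * (w2 * (l + 1) ^ 2)
                ≤ 3 * (l + 2) * (w2 * (l + 2) ^ 2) := by gcongr <;> omega
              _ = _ := by ring
        _ = 1 * ((3 * w2 : ℕ) * ((l + 2) ^ 3 : ℕ)) := by push_cast; ring
        _ ≤ _ := by gcongr
    have c4 : ∑' i : ℕ, 2⁻¹ ^ i * ((2 * (w4 * (l + i + 2) ^ 2) : ℕ) : ℝ≥0∞)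
        ≤ ((d + 1) * (n + 1) : ℕ) * ((3 * w4 : ℕ) * X) := by
      calc _ ≤ ∑' i : ℕ, (3 * w4 : ℕ) * (2⁻¹ ^ i * ((l + i + 2 : ℕ) : ℝ≥0∞) ^ 3) := by
            refine ENNReal.tsum_le_tsum fun i => ?_
            have : 2 * (w4 * (l + i + 2) ^ 2) ≤ 3 * w4 * (l + i + 2) ^ 3 := by
              calc 2 * (w4 * (l + i + 2) ^ 2) ≤ 3 * (w4 * (l + i + 2) ^ 3) := by
                    gcongr <;> omega
                _ = _ := by ring
            calc (2⁻¹ : ℝ≥0∞) ^ i * ((2 * (w4 * (l + i + 2) ^ 2) : ℕ) : ℝ≥0∞)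
                ≤ 2⁻¹ ^ i * ((3 * w4 * (l + i + 2) ^ 3 : ℕ) : ℝ≥0∞) :=
                  mul_le_mul_right (Nat.cast_le.2 this) _
              _ = _ := by push_cast; ring
        _ = 1 * ((3 * w4 : ℕ) * X) := by rw [ENNReal.tsum_mul_left, one_mul]
        _ ≤ _ := by gcongr
    have c5 : ∑' J, geo J *
          (((d + 1) * ((n + 1) * (3 * (l + J + 1) * (w5 * (l + J + 1) ^ 2))) : ℕ) : ℝ≥0∞)
        ≤ ((d + 1) * (n + 1) : ℕ) * ((3 * w5 : ℕ) * X) := by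
      rw [← ENNReal.tsum_mul_left, ← ENNReal.tsum_mul_left]
      refine ENNReal.tsum_le_tsum fun i => ?_
      have hg : geo i ≤ 2⁻¹ ^ i := by
        rw [geo, pow_succ]
        exact mul_le_of_le_one_right' (ENNReal.inv_le_one.2 (by norm_num))
      calc _ ≤ 2⁻¹ ^ i * ((((d + 1) * (n + 1)) * (3 * w5 * (l + i + 2) ^ 3) : ℕ) : ℝ≥0∞) := by
            refine mul_le_mul' hg (Nat.cast_le.2 ?_)
            calc (d + 1) * ((n + 1) * (3 * (l + i + 1) * (w5 * (l + i + 1) ^ 2)))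
                = ((d + 1) * (n + 1)) * (3 * w5 * (l + i + 1) ^ 3) := by ring
              _ ≤ _ := by gcongr; omega
        _ = _ := by push_cast; ring
    calc _ ≤ ((d + 1) * (n + 1) : ℕ) * ((3 * w1 : ℕ) * X)
          + (((d + 1) * (n + 1) : ℕ) * ((3 * w2 : ℕ) * X)
          + (((d + 1) * (n + 1) : ℕ) * ((3 * w3 : ℕ) * X)
          + (((d + 1) * (n + 1) : ℕ) * ((3 * w4 : ℕ) * X)
          + ((d + 1) * (n + 1) : ℕ) * ((3 * w5 : ℕ) * X)))) := by
          gcongr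
          · exact c1 w1
          · exact c1 w3
      _ = _ := by push_cast; ring
  · exact le_rfl

/-! ### Column sums and the law of the output -/

/-- The concatenation of the records of a database, as a sequence of zeros and ones. -/
def entries {d : ℕ} (x : List (Record d)) (k : ℕ) : ℤ :=
  if h : 0 < d then
    if (x.getD (k / d) fun _ => false) ⟨k % d, Nat.mod_lt k h⟩ then 1 else 0
  else 0

theorem entries_bounds {d : ℕ} (x : List (Record d)) (k : ℕ) :
    0 ≤ entries x k ∧ entries x k ≤ 1 := by
  unfold entries
  split_ifs <;> norm_num

/-- The column sums of a database. -/
def counts {d : ℕ} (x : List (Record d)) : ℕ → ℤ := partialSum (entries x) d x.length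

theorem sum_range_getD {X : Type*} (f : X → ℤ) (a : X) (x : List X) :
    ∑ i ∈ Finset.range x.length, f (x.getD i a) = (x.map f).sum := by
  induction x with
  | nil => simp
  | cons r x ih =>
    rw [List.length_cons, Finset.sum_range_succ', List.map_cons, List.sum_cons, ← ih, add_comm]
    simp

theorem counts_eq {d : ℕ} (x : List (Record d)) (k : Fin d) :
    counts x k = (x.map fun r => if r k then (1 : ℤ) else 0).sum := by
  rw [counts, partialSum, ← sum_range_getD _ fun _ => false]
  refine Finset.sum_congr rfl fun i _ => ?_
  have hd : 0 < d := k.pos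
  have h1 : (i * d + k) / d = i := by
    rw [add_comm, Nat.add_mul_div_right _ _ hd, Nat.div_eq_of_lt k.2, zero_add]
  have h2 : (i * d + k) % d = k := by
    rw [add_comm, Nat.add_mul_mod_self_right, Nat.mod_eq_of_lt k.2]
  simp only [entries, dif_pos hd, h1, h2]

theorem counts_cast {d : ℕ} (x : List (Record d)) (k : Fin d) :
    (counts x k : ℝ) = total x k := by
  rw [counts_eq, total]
  induction x with
  | nil => simp
  | cons r x ih =>
    rw [List.map_cons, List.sum_cons, List.map_cons, List.sum_cons, Int.cast_add, ih]
    split_ifs <;> simp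

/-- The contents of the memory before the program is run. -/
noncomputable def initial (d s : ℕ) (ε : ℝ) (x : List (Record d)) : Vars where
  par := inputMemory d s ε x 0
  dat := entries x
  out := 0
  len := 0
  wid := 0
  shift := 0
  level := 0
  coin := 0
  reach := 0
  flag := 0
  bound := 0
  draw := 0
  pow := 0
  rad := 0
  col := 0
  row := 0

theorem initial_mem (d s : ℕ) (ε : ℝ) (x : List (Record d)) :
    (initial d s ε x).mem = inputMemory d s ε x := by
  have h0 : scalar 0 = 0 := by unfold scalar; exact Function.update_eq_self 0 (0 : ℕ → ℤ)
  funext a k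
  match a with
  | 0 => rfl
  | 1 => rfl
  | a + 2 =>
    have h1 : inputMemory d s ε x (a + 2) k = 0 := rfl
    rw [h1]
    have h2 : ∀ l : List (ℕ → ℤ), (∀ f ∈ l, f = 0) → l.getD a 0 = 0 := by
      intro l hl
      rw [List.getD_eq_getElem?_getD]
      rcases h : l[a]? with _ | f
      · rfl
      · exact hl f (List.mem_of_getElem? h)
    have h3 : (initial d s ε x).mem (a + 2) = 0 := by
      refine h2 ((initial d s ε x).arrays.drop 2) ?_
      simp [Vars.arrays, initial, h0]
    rw [h3]
    rfl

theorem short_inputMemory {d s K l : ℕ} {ε : ℝ} {x : List (Record d)} (hs : 1 ≤ s) (hK : 1 ≤ K)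
    (hKε : ⌈(d : ℝ) / ε⌉ = K) (hfit : Fits d s K x.length 0 l) :
    Short l (inputMemory d s ε x) := by
  obtain ⟨b1, b2, b3, b4, b5⟩ := hfit.bounds hs hK
  have hss : s ≤ s * K := Nat.le_mul_of_pos_right _ hK
  have hKs : K ≤ s * K := Nat.le_mul_of_pos_left _ hs
  intro a k
  rw [bitLen_le_iff]
  match a, k with
  | 0, 0 => exact abs_natCast_lt (n := d) (by omega)
  | 0, 1 => exact abs_natCast_lt (n := s) (by omega)
  | 0, 2 =>
    change |⌈(d : ℝ) / ε⌉| < _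
    rw [hKε]
    exact abs_natCast_lt (by omega)
  | 0, 3 => exact abs_natCast_lt (n := x.length) (by omega)
  | 1, k =>
    change |entries x k| < _
    obtain ⟨h1, h2⟩ := entries_bounds x k
    rw [abs_of_nonneg h1]
    refine h2.trans_lt ?_
    have : 1 < 2 ^ l := by omega
    exact_mod_cast this
  | 0, k + 4 => exact abs_natCast_lt (n := 0) (by positivity)
  | a + 2, k => exact abs_natCast_lt (n := 0) (by positivity)

theorem exists_fits (d s K n : ℕ) : ∃ l, Fits d s K n 0 l :=
  ⟨_, Nat.lt_two_pow_self.le⟩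

theorem runs_program_input {d s K l : ℕ} {ε : ℝ} {x : List (Record d)} (hs : 1 ≤ s) (hK : 1 ≤ K)
    (hKε : ⌈(d : ℝ) / ε⌉ = K) (hfit : Fits d s K x.length 0 l) :
    ∃ μ : ℕ × ℕ × ℕ × (Fin d → ℕ) → Memory,
      Runs program (inputMemory d s ε x) (fun a => unif s a.1 * (geo a.2.1 *
        (unif (fineBound (width s K) (a.1 * (4 * K) : ℕ) (4 * K * (a.2.1 + 2) : ℕ) d K
          (counts x)) a.2.2.1
        * ∏ i, unif (2 * (4 * K * (a.2.1 + 1) + a.2.2.1) + 1) (a.2.2.2 i)))) μ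
        (((d + 1) * (x.length + 1) * (3 * program.weight) : ℕ)
          * ∑' i : ℕ, 2⁻¹ ^ i * ((l + i + 2 : ℕ) : ℝ≥0∞) ^ 3)
        ((2 * Nat.clog 2 s : ℕ) + ∑' u, unif s u * (2 + ∑' J, geo J *
          noiseBits d s K u J (counts x))) ∧
      ∀ a, a.1 < s → ∀ k : Fin d, μ a 2 k = rnd (width s K) (a.1 * (4 * K) : ℕ)
        (counts x k + ((a.2.2.2 k : ℤ) - (4 * K * (a.2.1 + 1) + a.2.2.1 : ℕ))) := by
  have hsh := short_inputMemory hs hK hKε hfit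
  rw [← initial_mem] at hsh ⊢
  exact runs_program (x := initial d s ε x) hsh hs hK hfit rfl rfl hKε rfl (entries_bounds x) rfl
    rfl rfl rfl rfl rfl rfl

/-- The average of a function over the vectors at distance at most `R` from `S`. -/
noncomputable def cubeMean {d : ℕ} (R : ℕ) (S : Fin d → ℤ) (G : (Fin d → ℤ) → ℝ≥0∞) : ℝ≥0∞ :=
  ∑' z : Fin d → ℕ, (∏ i, unif (2 * R + 1) (z i)) * G fun k => S k + ((z k : ℤ) - R)

theorem cubeMean_of_forall {d R : ℕ} {S : Fin d → ℤ} {G : (Fin d → ℤ) → ℝ≥0∞} {c : ℝ≥0∞}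
    (h : ∀ y : Fin d → ℤ, (∀ i, |y i - S i| ≤ R) → G y = c) : cubeMean R S G = c := by
  rw [cubeMean]
  calc _ = ∑' z : Fin d → ℕ, (∏ i, unif (2 * R + 1) (z i)) * c := by
        refine tsum_congr fun z => ?_
        by_cases hz : ∏ i, unif (2 * R + 1) (z i) = 0
        · rw [hz, zero_mul, zero_mul]
        · rw [h]
          intro i
          have := lt_of_unif_ne_zero (fun h0 => hz (Finset.prod_eq_zero (Finset.mem_univ i) h0))
          rw [abs_le]
          constructor <;> omega
    _ = c := by rw [ENNReal.tsum_mul_right, tsum_pi_unif (by omega), one_mul]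

theorem cubeMean_eq_tsum {d : ℕ} (R : ℕ) (S : Fin d → ℤ) (G : (Fin d → ℤ) → ℝ≥0∞) :
    cubeMean R S G = ∑' y : Fin d → ℤ,
      (if ∀ i, |y i - S i| ≤ R then (((2 * R + 1 : ℕ) : ℝ≥0∞) ^ d)⁻¹ else 0) * G y := by
  have hinj : Function.Injective fun (z : Fin d → ℕ) (k : Fin d) => S k + ((z k : ℤ) - R) := by
    intro z z' h
    funext k
    have := congrFun h k
    simp only at this
    omega
  rw [← hinj.tsum_eq]
  · refine tsum_congr fun z => ?_
    congr 1
    by_cases hz : ∀ i, z i < 2 * R + 1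
    · rw [if_pos]
      · rw [Finset.prod_congr rfl fun i _ => by rw [unif, if_pos (hz i)], Finset.prod_const,
          Finset.card_univ, Fintype.card_fin, ENNReal.inv_pow]
      · intro i
        have := hz i
        simp only [abs_le]
        constructor <;> omega
    · rw [if_neg]
      · push Not at hz
        obtain ⟨i, hi⟩ := hz
        exact Finset.prod_eq_zero (Finset.mem_univ i) (if_neg (by omega))
      · refine fun h => hz fun i => ?_
        have := abs_le.1 (h i)
        simp only at this
        omega
  · intro y hy
    have h : ∀ i, |y i - S i| ≤ R := by
      by_contra h
      exact hy (by simp only [if_neg h, zero_mul])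
    refine ⟨fun i => (y i - S i + R).toNat, ?_⟩
    funext k
    have := abs_le.1 (h k)
    simp only
    omega

/-- The distribution of the output. -/
theorem lintegral_output {d s K : ℕ} {ε : ℝ} (hs : 1 ≤ s) (hK : 1 ≤ K)
    (hKε : ⌈(d : ℝ) / ε⌉ = K) (x : List (Record d)) (G : (Fin d → ℤ) → ℝ≥0∞) :
    ∫⁻ σ, G (fun k => σ.mem 2 k) ∂(finalState program d s ε x)
      = ∑' u, unif s u * ∑' J, geo J * ∑' I, unif (4 * K) I *
        cubeMean (4 * K * (J + 1) + I) (fun k : Fin d => counts x k)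
          fun y => G fun k => rnd (width s K) (u * (4 * K) : ℕ) (y k) := by
  obtain ⟨l, hfit⟩ := exists_fits d s K x.length
  obtain ⟨μ, hμ, hout⟩ := runs_program_input hs hK hKε hfit
  have hW : (0 : ℤ) < width s K := Int.natCast_pos.2 (width_pos hK)
  rw [finalState, hμ.law 0 0 fun m => G fun k : Fin d => m 2 k, ENNReal.tsum_prod']
  refine tsum_congr fun u => ?_
  by_cases hu : u < s
  swap
  · simp [unif, hu]
  rw [ENNReal.tsum_prod', ← ENNReal.tsum_mul_left]
  refine tsum_congr fun J => ?_
  rw [ENNReal.tsum_prod', ← ENNReal.tsum_mul_left, ← ENNReal.tsum_mul_left]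
  have hcube : ∀ I : ℕ, ∑' z : Fin d → ℕ, unif s u * (geo J *
      (unif (fineBound (width s K) (u * (4 * K) : ℕ) (4 * K * (J + 2) : ℕ) d K (counts x)) I
        * ∏ i, unif (2 * (4 * K * (J + 1) + I) + 1) (z i)))
        * G (fun k => μ (u, J, I, z) 2 k)
      = unif s u * (geo J *
      (unif (fineBound (width s K) (u * (4 * K) : ℕ) (4 * K * (J + 2) : ℕ) d K (counts x)) I
        * cubeMean (4 * K * (J + 1) + I) (fun k : Fin d => counts x k)
          fun y => G fun k => rnd (width s K) (u * (4 * K) : ℕ) (y k))) := by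
    intro I
    rw [cubeMean, ← ENNReal.tsum_mul_left, ← ENNReal.tsum_mul_left, ← ENNReal.tsum_mul_left]
    refine tsum_congr fun z => ?_
    have : (fun k : Fin d => μ (u, J, I, z) 2 k) = fun k : Fin d => rnd (width s K)
        (u * (4 * K) : ℕ) (counts x k + ((z k : ℤ) - (4 * K * (J + 1) + I : ℕ))) :=
      funext fun k => hout (u, J, I, z) hu k
    rw [this]
    ring
  simp only [hcube]
  by_cases h0 : ∑ j ∈ Finset.range d,
      near (width s K) (u * (4 * K) : ℕ) (4 * K * (J + 2) : ℕ) (counts x j) = 0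
  swap
  · refine tsum_congr fun I => ?_
    rw [fineBound, if_neg h0]
  -- If no column has a grid point within reach, every radius gives the same output. Hence the fine
  -- part may be averaged over 4K values although it was drawn with bound 1.
  have hconst : ∀ N I : ℕ, N ≤ 4 * K → unif N I *
      (cubeMean (4 * K * (J + 1) + I) (fun k : Fin d => counts x k)
        fun y => G fun k => rnd (width s K) (u * (4 * K) : ℕ) (y k))
      = unif N I * G fun k => rnd (width s K) (u * (4 * K) : ℕ) (counts x k) := by
    intro N I hN
    by_cases hI : I < N
    swap
    · simp [unif, hI]
    congr 1
    refine cubeMean_of_forall fun y hy => ?_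
    congr 1
    funext k
    have hk := (Finset.sum_eq_zero_iff_of_nonneg fun j _ => near_nonneg hW
      (Int.natCast_nonneg _)).1 h0 k (Finset.mem_range.2 k.2)
    have := rnd_eq_of_near_eq_zero hW ((hy k).trans (Int.ofNat_le.2 (by
      have : 4 * K * (J + 2) = 4 * K * (J + 1) + 4 * K := by ring
      omega))) hk
    rw [← this]
    congr 1
    ring
  have hsum : ∀ N : ℕ, 1 ≤ N → N ≤ 4 * K → ∑' I, unif s u * (geo J * (unif N I *
      (cubeMean (4 * K * (J + 1) + I) (fun k : Fin d => counts x k)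
        fun y => G fun k => rnd (width s K) (u * (4 * K) : ℕ) (y k))))
      = unif s u * (geo J * G fun k => rnd (width s K) (u * (4 * K) : ℕ) (counts x k)) := by
    intro N hN hN'
    rw [ENNReal.tsum_mul_left, ENNReal.tsum_mul_left]
    simp only [hconst N _ hN']
    rw [ENNReal.tsum_mul_right, tsum_unif (by omega), one_mul]
  rw [fineBound, if_pos h0, hsum 1 le_rfl (by omega), ENNReal.tsum_mul_left, ENNReal.tsum_mul_left,
    ← hsum (4 * K) (by omega) le_rfl, ENNReal.tsum_mul_left, ENNReal.tsum_mul_left]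

theorem haltsAlmostSurely_program {d s K : ℕ} {ε : ℝ} (hs : 1 ≤ s) (hK : 1 ≤ K)
    (hKε : ⌈(d : ℝ) / ε⌉ = K) (x : List (Record d)) : HaltsAlmostSurely program d s ε x := by
  refine ⟨?_⟩
  have h := lintegral_output hs hK hKε x fun _ => 1
  rw [lintegral_one] at h
  rw [h]
  simp only [cubeMean_of_forall (fun _ _ => rfl), mul_one]
  rw [tsum_unif (by omega)]
  simp only [mul_one, tsum_geo]
  exact tsum_unif (by omega)

/-! ### Privacy: the density of the noise -/

/-- Division with remainder, q = LJ + I, merges level and fine part into one radius L + q. -/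
theorem tsum_blocks {L : ℕ} (hL : 1 ≤ L) (g f : ℕ → ℝ≥0∞) :
    ∑' J, g J * ∑' I, unif L I * f (L * (J + 1) + I)
      = ∑' q, g (q / L) * (L : ℝ≥0∞)⁻¹ * f (L + q) := by
  have : NeZero L := ⟨by omega⟩
  rw [← (Nat.divModEquiv L).symm.tsum_eq fun q => g (q / L) * (L : ℝ≥0∞)⁻¹ * f (L + q),
    ENNReal.tsum_prod']
  refine tsum_congr fun J => ?_
  rw [tsum_unif_mul, Finset.sum_range, tsum_fintype, Finset.mul_sum, Finset.mul_sum]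
  refine Finset.sum_congr rfl fun i _ => ?_
  have h1 : (Nat.divModEquiv L).symm (J, i) = J * L + i := by
    simp [Nat.divModEquiv]
  have h2 : (J * L + (i : ℕ)) / L = J := by
    rw [add_comm, Nat.add_mul_div_right _ _ (by omega), Nat.div_eq_of_lt i.2, zero_add]
  rw [h1, h2, mul_assoc, show L + (J * L + (i : ℕ)) = L * (J + 1) + i by ring]

/-- The density of the radius of the noise, divided by the volume of the cube. -/
noncomputable def shellDensity (d L q : ℕ) : ℝ :=
  (2⁻¹ : ℝ) ^ (q / L + 1) * (L : ℝ)⁻¹ * ((2 * (L + q) + 1 : ℝ) ^ d)⁻¹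

theorem shellDensity_pos {d L q : ℕ} (hL : 1 ≤ L) : 0 < shellDensity d L q := by
  have : (0 : ℝ) < L := by exact_mod_cast hL
  unfold shellDensity
  positivity

/-- A stretch of at most L radii crosses at most one block boundary, so the weight is halved at most
once. The side of the cube grows by a factor of at most 1 + k/L ≤ e^(k/L), because its initial
radius is already at least L. -/
theorem shellDensity_decay {d L p k : ℕ} (hL : 1 ≤ L) (hk : k ≤ L) :
    2⁻¹ * shellDensity d L p * Real.exp (-(d / L : ℝ)) ^ k ≤ shellDensity d L (p + k) := by
  have hL' : (0 : ℝ) < L := by exact_mod_cast hL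
  have h1 : (p + k) / L ≤ p / L + 1 := by
    calc (p + k) / L ≤ (p + L) / L := Nat.div_le_div_right (by omega)
      _ = _ := Nat.add_div_right _ (by omega)
  have h2 : (2⁻¹ : ℝ) ^ (p / L + 1 + 1) ≤ 2⁻¹ ^ ((p + k) / L + 1) :=
    pow_le_pow_of_le_one (by norm_num) (by norm_num) (by omega)
  have h3 : (2 * (L + (p + k : ℕ)) + 1 : ℝ) ≤ (2 * (L + p) + 1) * Real.exp (k / L : ℝ) := by
    have h4 := Real.add_one_le_exp (k / L : ℝ)
    have h5 : (2 * k : ℝ) ≤ (2 * (L + p) + 1) * (k / L) := by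
      have : (2 * k : ℝ) = 2 * L * (k / L) := by field_simp
      rw [this]
      gcongr
      have : (0 : ℝ) ≤ p := Nat.cast_nonneg p
      linarith
    calc (2 * (L + (p + k : ℕ)) + 1 : ℝ) = (2 * (L + p) + 1) + 2 * k := by push_cast; ring
      _ ≤ (2 * (L + p) + 1) * (k / L + 1) := by linarith
      _ ≤ _ := by gcongr
  have h6 : (Real.exp (-(d / L : ℝ)) ^ k) * (((2 * (L + p) + 1 : ℝ) ^ d)⁻¹)
      ≤ ((2 * (L + (p + k : ℕ)) + 1 : ℝ) ^ d)⁻¹ := by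
    rw [← Real.exp_nat_mul]
    have h7 : (2 * (L + (p + k : ℕ)) + 1 : ℝ) ^ d
        ≤ (2 * (L + p) + 1) ^ d * Real.exp (d * (k / L)) := by
      rw [Real.exp_nat_mul, ← mul_pow]
      gcongr
    refine le_trans (le_of_eq ?_) (inv_anti₀ (by positivity) h7)
    rw [mul_inv, ← Real.exp_neg, mul_comm]
    congr 2
    ring
  unfold shellDensity
  calc _ = (2⁻¹ : ℝ) ^ (p / L + 1 + 1) * (L : ℝ)⁻¹ * ((Real.exp (-(d / L : ℝ)) ^ k)
        * (((2 * (L + p) + 1 : ℝ) ^ d)⁻¹)) := by rw [pow_succ]; ring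
    _ ≤ _ := by gcongr

/-- The infinite series sums to 1/(e^θ - 1), and since θL ≥ 1 the part beyond L is at most a
fraction 1/e < 1/2 of it. -/
theorem le_sum_geometric {θ : ℝ} {L : ℕ} (hθ : 0 < θ) (h : 1 ≤ θ * L) :
    2⁻¹ * (Real.exp θ - 1)⁻¹ ≤ ∑ k ∈ Finset.range L, Real.exp (-θ) ^ (k + 1) := by
  have h1 : Real.exp (-θ) < 1 := by
    rw [← Real.exp_zero]
    exact Real.exp_lt_exp.2 (by linarith)
  have h0 : 1 < Real.exp θ := Real.one_lt_exp_iff.2 hθ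
  have hpow : Real.exp (-θ) ^ L ≤ 2⁻¹ := by
    rw [← Real.exp_nat_mul]
    calc Real.exp (L * -θ) ≤ Real.exp (-1) := Real.exp_le_exp.2 (by linarith)
      _ ≤ 2⁻¹ := by
        rw [Real.exp_neg]
        refine inv_anti₀ (by norm_num) ?_
        have := Real.add_one_le_exp (1 : ℝ)
        linarith
  simp only [pow_succ]
  rw [← Finset.sum_mul, geom_sum_eq h1.ne]
  have h2 : (Real.exp θ - 1)⁻¹ = Real.exp (-θ) / (1 - Real.exp (-θ)) := by
    rw [Real.exp_neg]
    have : Real.exp θ ≠ 0 := (Real.exp_pos θ).ne'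
    have : Real.exp θ - 1 ≠ 0 := by linarith
    field_simp
  have h3 : (Real.exp (-θ) ^ L - 1) / (Real.exp (-θ) - 1) * Real.exp (-θ)
      = (1 - Real.exp (-θ) ^ L) * (Real.exp (-θ) / (1 - Real.exp (-θ))) := by
    rw [← neg_sub 1 (Real.exp (-θ)), ← neg_sub 1 (Real.exp (-θ) ^ L), neg_div_neg_eq]
    ring
  rw [h2, h3]
  have : 0 ≤ Real.exp (-θ) / (1 - Real.exp (-θ)) :=
    div_nonneg (Real.exp_pos _).le (by linarith)
  gcongr
  linarith

/-- One factor 2 is lost in the decay and one in truncating the series. Together they require e^ε -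
1 ≥ 4(e^θ - 1), which holds for ε ≥ 4θ; this is the reason for cells of length 4K. -/
theorem shellDensity_le_sum {d L p : ℕ} {ε : ℝ} (hd : 1 ≤ d) (hL : 1 ≤ L)
    (hε : 4 * (d / L : ℝ) ≤ ε) :
    shellDensity d L p
      ≤ (Real.exp ε - 1) * ∑ k ∈ Finset.range L, shellDensity d L (p + (k + 1)) := by
  have hL' : (0 : ℝ) < L := by exact_mod_cast hL
  have hd' : (1 : ℝ) ≤ d := by exact_mod_cast hd
  have hθ : (0 : ℝ) < d / L := by positivity
  set θ : ℝ := d / L with hθdef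
  have h0 : 0 < Real.exp θ - 1 := sub_pos.2 (Real.one_lt_exp_iff.2 hθ)
  have h4 : 4 * (Real.exp θ - 1) ≤ Real.exp ε - 1 := by
    -- Bernoulli's inequality for the fourth power of e^θ.
    have h5 := one_add_mul_le_pow (a := Real.exp θ - 1) (by linarith) 4
    have h6 : (1 + (Real.exp θ - 1)) ^ 4 = Real.exp (4 * θ) := by
      rw [add_sub_cancel, ← Real.exp_nat_mul]
      norm_num
    have h7 : Real.exp (4 * θ) ≤ Real.exp ε := Real.exp_le_exp.2 hε
    push_cast at h5
    linarith
  have hv := shellDensity_pos (d := d) (q := p) hL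
  have hsum := le_sum_geometric (L := L) hθ (by rw [hθdef]; field_simp; exact hd')
  calc shellDensity d L p = (4 * (Real.exp θ - 1)) * (2⁻¹ * shellDensity d L p
        * (2⁻¹ * (Real.exp θ - 1)⁻¹)) := by field_simp; norm_num
    _ ≤ (Real.exp ε - 1) * (2⁻¹ * shellDensity d L p
        * ∑ k ∈ Finset.range L, Real.exp (-θ) ^ (k + 1)) := by gcongr; linarith
    _ ≤ _ := by
        rw [Finset.mul_sum]
        refine mul_le_mul_of_nonneg_left (Finset.sum_le_sum fun k hk => ?_) (by linarith)
        exact shellDensity_decay hL (Finset.mem_range.1 hk)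

/-- The density of the noise at a vector of maximum norm `ρ`. -/
noncomputable def noiseDensity (d L ρ : ℕ) : ℝ≥0∞ :=
  ∑' q, if ρ ≤ L + q then ENNReal.ofReal (shellDensity d L q) else 0

theorem noiseDensity_anti {d L ρ ρ' : ℕ} (h : ρ ≤ ρ') :
    noiseDensity d L ρ' ≤ noiseDensity d L ρ := by
  refine ENNReal.tsum_le_tsum fun q => ?_
  split_ifs
  · exact le_rfl
  · omega
  · exact zero_le
  · exact le_rfl

/-- Every cube has radius at least L, so the density is constant up to norm L. Beyond, the step from
L + p to L + p + 1 removes exactly the term with index p, which is at most (e^ε - 1) times what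
remains. -/
theorem noiseDensity_le {d L : ℕ} {ε : ℝ} (hd : 1 ≤ d) (hL : 1 ≤ L) (hε : 4 * (d / L : ℝ) ≤ ε)
    (ρ : ℕ) :
    noiseDensity d L ρ ≤ ENNReal.ofReal (Real.exp ε) * noiseDensity d L (ρ + 1) := by
  have hε0 : 0 ≤ ε := le_trans (by positivity) hε
  have he1 : 1 ≤ Real.exp ε := Real.one_le_exp hε0
  have h1 : (1 : ℝ≥0∞) ≤ ENNReal.ofReal (Real.exp ε) := ENNReal.one_le_ofReal.2 he1
  by_cases hρ : ρ < L
  · have : noiseDensity d L ρ = noiseDensity d L (ρ + 1) := by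
      refine tsum_congr fun q => ?_
      rw [if_pos (by omega), if_pos (by omega)]
    rw [this]
    exact le_mul_of_one_le_left' h1
  · obtain ⟨p, rfl⟩ := Nat.exists_eq_add_of_le (not_lt.1 hρ)
    have hsplit : noiseDensity d L (L + p)
        = ENNReal.ofReal (shellDensity d L p) + noiseDensity d L (L + p + 1) := by
      have : ∀ q, (if L + p ≤ L + q then ENNReal.ofReal (shellDensity d L q) else 0)
          = (if q = p then ENNReal.ofReal (shellDensity d L p) else 0)
            + if L + p + 1 ≤ L + q then ENNReal.ofReal (shellDensity d L q) else 0 := by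
        intro q
        rcases lt_trichotomy q p with h | h | h
        · rw [if_neg (by omega), if_neg (by omega), if_neg (by omega), add_zero]
        · subst h
          rw [if_pos le_rfl, if_pos rfl, if_neg (by omega), add_zero]
        · rw [if_pos (by omega), if_neg (by omega), if_pos (by omega), zero_add]
      rw [noiseDensity, tsum_congr this, ENNReal.tsum_add, tsum_ite_eq]
      rfl
    have hlow : ENNReal.ofReal (∑ k ∈ Finset.range L, shellDensity d L (p + (k + 1)))
        ≤ noiseDensity d L (L + p + 1) := by
      rw [ENNReal.ofReal_sum_of_nonneg fun k _ => (shellDensity_pos hL).le]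
      have hinj : Function.Injective fun k : ℕ => p + (k + 1) := fun a b h => by
        simp only at h; omega
      calc _ ≤ ∑' k : ℕ, ENNReal.ofReal (shellDensity d L (p + (k + 1))) :=
            ENNReal.sum_le_tsum _
        _ = ∑' k : ℕ, (fun q => if L + p + 1 ≤ L + q then ENNReal.ofReal (shellDensity d L q)
              else 0) (p + (k + 1)) := tsum_congr fun k => by
            simp only
            rw [if_pos (by omega)]
        _ ≤ _ := ENNReal.tsum_comp_le_tsum_of_injective hinj _
    calc noiseDensity d L (L + p)
        ≤ ENNReal.ofReal (Real.exp ε - 1) * noiseDensity d L (L + p + 1)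
          + noiseDensity d L (L + p + 1) := by
          rw [hsplit]
          gcongr
          calc _ ≤ ENNReal.ofReal ((Real.exp ε - 1)
                * ∑ k ∈ Finset.range L, shellDensity d L (p + (k + 1))) :=
                ENNReal.ofReal_le_ofReal (shellDensity_le_sum hd hL hε)
            _ = _ := ENNReal.ofReal_mul (by linarith)
            _ ≤ _ := by gcongr
      _ = (ENNReal.ofReal (Real.exp ε - 1) + 1) * noiseDensity d L (L + p + 1) := by
          rw [add_mul, one_mul]
      _ = _ := by
          rw [← ENNReal.ofReal_one, ← ENNReal.ofReal_add (by linarith) zero_le_one,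
            sub_add_cancel]

theorem forall_abs_sub_le_iff {d R : ℕ} {y S : Fin d → ℤ} :
    (∀ i, |y i - S i| ≤ R) ↔ (Finset.univ.sup fun i => (y i - S i).natAbs) ≤ R := by
  rw [Finset.sup_le_iff]
  refine ⟨fun h i _ => ?_, fun h i => ?_⟩
  · have := h i
    rw [Int.abs_eq_natAbs] at this
    exact_mod_cast this
  · rw [Int.abs_eq_natAbs]
    exact_mod_cast h i (Finset.mem_univ i)

/-- After exchanging the sums, a vector y collects the weights of all cubes that contain it, so its
density depends only on its distance from S. -/
theorem tsum_cubeMean {d L : ℕ} (hL : 1 ≤ L) (S : Fin d → ℤ) (H : (Fin d → ℤ) → ℝ≥0∞) :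
    ∑' J, geo J * ∑' I, unif L I * cubeMean (L * (J + 1) + I) S H
      = ∑' y : Fin d → ℤ, noiseDensity d L (Finset.univ.sup fun i => (y i - S i).natAbs) * H y := by
  rw [tsum_blocks hL geo fun R => cubeMean R S H]
  simp only [cubeMean_eq_tsum, ← ENNReal.tsum_mul_left]
  rw [ENNReal.tsum_comm]
  refine tsum_congr fun y => ?_
  rw [noiseDensity, ← ENNReal.tsum_mul_right]
  refine tsum_congr fun q => ?_
  rw [← mul_assoc]
  congr 1
  simp only [forall_abs_sub_le_iff]
  split_ifs
  · have hL' : (0 : ℝ) < L := by exact_mod_cast hL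
    rw [shellDensity, ENNReal.ofReal_mul (by positivity), ENNReal.ofReal_mul (by positivity),
      ENNReal.ofReal_inv_of_pos (by positivity), ENNReal.ofReal_inv_of_pos (by positivity),
      ENNReal.ofReal_pow (by norm_num), ENNReal.ofReal_pow (by positivity),
      ENNReal.ofReal_inv_of_pos (by norm_num), ENNReal.ofReal_natCast, geo]
    congr 3
    · norm_num
    · rw [← ENNReal.ofReal_natCast]
      push_cast
      rfl
  · rw [mul_zero]

theorem lintegral_output_eq_tsum {d s K : ℕ} {ε : ℝ} (hs : 1 ≤ s) (hK : 1 ≤ K)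
    (hKε : ⌈(d : ℝ) / ε⌉ = K) (x : List (Record d)) (G : (Fin d → ℤ) → ℝ≥0∞) :
    ∫⁻ σ, G (fun k => σ.mem 2 k) ∂(finalState program d s ε x)
      = ∑' u, unif s u * ∑' y : Fin d → ℤ,
        noiseDensity d (4 * K) (Finset.univ.sup fun i => (y i - counts x i).natAbs)
          * G fun k => rnd (width s K) (u * (4 * K) : ℕ) (y k) := by
  rw [lintegral_output hs hK hKε]
  refine tsum_congr fun u => ?_
  rw [tsum_cubeMean (by omega)]

theorem mechanism_apply {d s : ℕ} {ε : ℝ} {P : Cmd} (x : List (Record d))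
    {A : Set (Fin d → ℝ)} (hA : MeasurableSet A) :
    mechanism P d s ε x A = ∫⁻ σ, A.indicator 1 (fun k : Fin d => (σ.mem 2 k : ℝ))
      ∂(finalState P d s ε x) := by
  rw [mechanism, Measure.map_apply (measurable_of_state _) hA, ← lintegral_indicator_one (measurable_of_state _ hA)]
  rfl

theorem abs_counts_sub_le {d : ℕ} {x x' : List (Record d)} (h : Edit x x') (k : Fin d) :
    |counts x k - counts x' k| ≤ 1 := by
  rw [counts_eq, counts_eq]
  cases h with
  | insertion l a r =>
    simp only [List.map_append, List.sum_append, List.map_cons, List.sum_cons]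
    rw [abs_le]
    split_ifs <;> constructor <;> linarith
  | deletion l a r =>
    simp only [List.map_append, List.sum_append, List.map_cons, List.sum_cons]
    rw [abs_le]
    split_ifs <;> constructor <;> linarith

theorem eq_or_edit_of_insertDeleteDist_le_one {X : Type*} {x y : List X}
    (h : insertDeleteDist x y ≤ 1) : x = y ∨ Edit x y := by
  by_contra hxy
  push Not at hxy
  have : (2 : ℕ∞) ≤ insertDeleteDist x y := by
    refine le_iInf₂ fun k hk => ?_
    match k with
    | 0 => exact absurd hk hxy.1
    | 1 =>
      obtain ⟨z, h1, h2⟩ := hk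
      exact absurd ((h2 : z = y) ▸ h1) hxy.2
    | k + 2 => exact_mod_cast (by omega : 2 ≤ k + 2)
  exact absurd (this.trans h) (by decide)

theorem abs_counts_sub_le_of_dist {d : ℕ} {x x' : List (Record d)}
    (h : insertDeleteDist x x' ≤ 1) (k : Fin d) : |counts x k - counts x' k| ≤ 1 := by
  rcases eq_or_edit_of_insertDeleteDist_le_one h with rfl | h
  · simp
  · exact abs_counts_sub_le h k

/-- The comparison is made for every fixed shift and every noisy vector before rounding. An edit
changes the distance from the column sums by at most 1. -/
theorem isDP_program {d s K : ℕ} {ε : ℝ} (hd : 1 ≤ d) (hs : 1 ≤ s) (hK : 1 ≤ K)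
    (hε : 0 < ε) (hKε : ⌈(d : ℝ) / ε⌉ = K) : IsDP ε 0 (mechanism program d s ε) := by
  intro x x' hxx A hA
  rw [mechanism_apply x hA, mechanism_apply x' hA, ENNReal.ofReal_zero, add_zero]
  have hout := fun x : List (Record d) => lintegral_output_eq_tsum hs hK hKε x
    fun y => A.indicator 1 fun k => (y k : ℝ)
  rw [hout, hout, ← ENNReal.tsum_mul_left]
  refine ENNReal.tsum_le_tsum fun u => ?_
  refine le_trans (mul_le_mul_right ?_ _) (le_of_eq (mul_left_comm _ _ _))
  rw [← ENNReal.tsum_mul_left]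
  refine ENNReal.tsum_le_tsum fun y => ?_
  refine le_trans (mul_le_mul_left ?_ _) (le_of_eq (mul_assoc _ _ _))
  have hKd : (d : ℝ) / ε ≤ K := by
    have := Int.le_ceil ((d : ℝ) / ε)
    rw [hKε] at this
    exact_mod_cast this
  have hK' : (0 : ℝ) < K := by exact_mod_cast hK
  refine (noiseDensity_le (ε := ε) hd (by omega) ?_ _).trans ?_
  -- Here 4·d/(4K) = d/K ≤ ε, because K ≥ d/ε.
  · push_cast
    rw [div_le_iff₀ hε] at hKd
    rw [← mul_div_assoc, div_le_iff₀ (by positivity)]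
    linarith
  · gcongr
    refine noiseDensity_anti (Finset.sup_le fun i hi => ?_)
    have h1 := abs_counts_sub_le_of_dist hxx i
    have h2 : (y i - counts x i).natAbs ≤ Finset.univ.sup fun i => (y i - counts x i).natAbs :=
      Finset.le_sup (f := fun i => (y i - counts x i).natAbs) hi
    rw [abs_le] at h1
    omega

/-! ### Randomness: how often a column needs noise -/

/-- Hermite's identity for integer division. -/
theorem sum_add_ediv (s : ℕ) (hs : 1 ≤ s) (m : ℤ) :
    ∑ u ∈ Finset.range s, (m + u) / (s : ℤ) = m := by
  have hs' : (s : ℤ) ≠ 0 := by omega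
  have step : ∀ m : ℤ, ∑ u ∈ Finset.range s, (m + 1 + u) / (s : ℤ)
      = ∑ u ∈ Finset.range s, (m + u) / (s : ℤ) + 1 := by
    intro m
    have h1 := Finset.sum_range_succ (fun u : ℕ => (m + u) / (s : ℤ)) s
    have h2 := Finset.sum_range_succ' (fun u : ℕ => (m + u) / (s : ℤ)) s
    have h3 : (m + s) / (s : ℤ) = m / s + 1 := by
      rw [Int.add_ediv_of_dvd_right (dvd_refl _), Int.ediv_self hs']
    have h4 : ∑ u ∈ Finset.range s, (m + 1 + u) / (s : ℤ)
        = ∑ u ∈ Finset.range s, (m + ((u + 1 : ℕ) : ℤ)) / (s : ℤ) :=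
      Finset.sum_congr rfl fun u _ => by push_cast; ring_nf
    rw [h4]
    simp only [Nat.cast_zero, add_zero] at h2
    linarith
  induction m using Int.induction_on with
  | zero =>
    refine Finset.sum_eq_zero fun u hu => ?_
    rw [zero_add]
    exact Int.ediv_eq_zero_of_lt (by omega) (by exact_mod_cast Finset.mem_range.1 hu)
  | succ i ih => rw [step, ih]
  | pred i ih =>
    have := step (-(i : ℤ) - 1)
    rw [sub_add_cancel, ih] at this
    linarith

/-- Shift and reach are multiples of L, so division by sL can be done first by L and then by s.
Hermite's identity at y/L ± (J+2) leaves the difference 2(J+2), independently of y and s. -/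
theorem sum_near {s L : ℕ} (hs : 1 ≤ s) (hL : 1 ≤ L) (J : ℕ) (y : ℤ) :
    ∑ u ∈ Finset.range s, near (s * L : ℕ) (u * L : ℕ) (L * (J + 2) : ℕ) y = 2 * (J + 2) := by
  have hL' : (L : ℤ) ≠ 0 := by omega
  have key : ∀ (u : ℕ) (τ : ℤ), (y + (u * L : ℕ) + L * τ) / ((s * L : ℕ) : ℤ)
      = (y / L + τ + u) / (s : ℤ) := by
    intro u τ
    rw [show ((s * L : ℕ) : ℤ) = (L : ℤ) * s by push_cast; ring,
      ← Int.ediv_ediv_of_nonneg (by omega)]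
    congr 1
    rw [show y + ((u * L : ℕ) : ℤ) + L * τ = y + L * (τ + u) by push_cast; ring,
      Int.add_mul_ediv_left _ _ hL']
    ring
  have h1 : ∀ u : ℕ, near (s * L : ℕ) (u * L : ℕ) (L * (J + 2) : ℕ) y
      = (y / L + (J + 2) + u) / (s : ℤ) - (y / L + -(J + 2) + u) / (s : ℤ) := by
    intro u
    rw [near, ← key, ← key]
    push_cast
    ring_nf
  simp only [h1]
  rw [Finset.sum_sub_distrib, sum_add_ediv s hs, sum_add_ediv s hs]
  ring

/-- For s > 1 an indicator is at most the count it tests, as counts are nonnegative integers. For s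
= 1, where the width is 1, there is a single shift and nothing to prove. -/
theorem card_near_le {s K : ℕ} (hs : 1 ≤ s) (hK : 1 ≤ K) (J : ℕ) (y : ℤ) :
    ∑ u ∈ Finset.range s, (if near (width s K) (u * (4 * K) : ℕ) (4 * K * (J + 2) : ℕ) y = 0
      then 0 else 1) ≤ 2 * (J + 2) := by
  by_cases h : 1 < s
  · have h1 := sum_near hs (by omega : 1 ≤ 4 * K) J y
    rw [width, if_pos h]
    have hW : (0 : ℤ) < (s * (4 * K) : ℕ) := by positivity
    zify
    rw [← h1]
    refine Finset.sum_le_sum fun u _ => ?_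
    have h2 := near_nonneg (W := (s * (4 * K) : ℕ)) (sh := (u * (4 * K) : ℕ))
      (T := (4 * K * (J + 2) : ℕ)) (y := y) hW (Int.natCast_nonneg _)
    split_ifs with h3
    · exact h2
    · push_cast at h2 h3 ⊢
      omega
  · obtain rfl : s = 1 := by omega
    rw [Finset.sum_range_one]
    split_ifs <;> omega

theorem tsum_noiseBits_le {d s K : ℕ} (hs : 1 ≤ s) (hK : 1 ≤ K) (J : ℕ) (S : ℕ → ℤ) :
    ∑' u, unif s u * noiseBits d s K u J S
      ≤ (s : ℝ≥0∞)⁻¹ * ((d * (2 * (J + 2) * (4 * Nat.clog 2 (8 * K * (J + 2)))) : ℕ) : ℝ≥0∞) := by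
  rw [tsum_unif_mul]
  refine mul_le_mul_right ?_ _
  simp only [noiseBits]
  rw [Finset.sum_comm]
  set c := 4 * Nat.clog 2 (8 * K * (J + 2))
  calc _ ≤ ∑ k ∈ Finset.range d, ((2 * (J + 2) * c : ℕ) : ℝ≥0∞) := by
        refine Finset.sum_le_sum fun k _ => ?_
        calc _ = (((∑ u ∈ Finset.range s, (if near (width s K) (u * (4 * K) : ℕ)
              (4 * K * (J + 2) : ℕ) (S k) = 0 then 0 else 1)) * c : ℕ) : ℝ≥0∞) := by
              rw [Finset.sum_mul, Nat.cast_sum]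
              refine Finset.sum_congr rfl fun u _ => ?_
              split_ifs <;> simp
          _ ≤ _ := Nat.cast_le.2 (Nat.mul_le_mul_right _ (card_near_le hs hK J _))
    _ = _ := by simp

/-- The cube is at most 6·C(i+3, 3), and the series of C(i+3, 3)/2^i sums to 2^4 = 16. -/
theorem tsum_geometric_cube_le : ∑' i : ℕ, (2⁻¹ : ℝ≥0∞) ^ i * ((i + 1 : ℕ) : ℝ≥0∞) ^ 3 ≤ 96 := by
  have h := hasSum_choose_mul_geometric_of_norm_lt_one (𝕜 := ℝ) 3 (r := 2⁻¹) (by norm_num)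
  have h1 : ∀ i : ℕ, (2⁻¹ : ℝ≥0∞) ^ i * ((i + 1 : ℕ) : ℝ≥0∞) ^ 3
      ≤ ENNReal.ofReal (6 * (((i + 3).choose 3 : ℕ) * (2⁻¹ : ℝ) ^ i)) := by
    intro i
    have h2 : (i + 1) ^ 3 ≤ 6 * (i + 3).choose 3 := by
      have h3 := Nat.descFactorial_eq_factorial_mul_choose (i + 3) 3
      have h4 : (i + 3).descFactorial 3 = (i + 1) * ((i + 2) * (i + 3)) := by
        simp [Nat.descFactorial]
      have h5 : Nat.factorial 3 = 6 := rfl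
      rw [← h5, ← h3, h4]
      calc (i + 1) ^ 3 = (i + 1) * ((i + 1) * (i + 1)) := by ring
        _ ≤ _ := by gcongr <;> omega
    calc _ ≤ (2⁻¹ : ℝ≥0∞) ^ i * ((6 * (i + 3).choose 3 : ℕ) : ℝ≥0∞) := by
          refine mul_le_mul_right ?_ _
          exact_mod_cast h2
      _ = _ := by
          rw [show (6 * (((i + 3).choose 3 : ℕ) * (2⁻¹ : ℝ) ^ i))
            = (2⁻¹ : ℝ) ^ i * ((6 * (i + 3).choose 3 : ℕ) : ℝ) by push_cast; ring,
            ENNReal.ofReal_mul (by positivity), ENNReal.ofReal_natCast,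
            ENNReal.ofReal_pow (by norm_num), ENNReal.ofReal_inv_of_pos (by norm_num)]
          norm_num
  calc _ ≤ ∑' i : ℕ, ENNReal.ofReal (6 * (((i + 3).choose 3 : ℕ) * (2⁻¹ : ℝ) ^ i)) :=
        ENNReal.tsum_le_tsum h1
    _ = ENNReal.ofReal (6 * (1 / (1 - 2⁻¹) ^ (3 + 1))) := by
        rw [← ENNReal.ofReal_tsum_of_nonneg (fun i => by positivity) (h.mul_left 6).summable,
          (h.mul_left 6).tsum_eq]
    _ = _ := by norm_num

theorem clog_mul_le (K J : ℕ) : Nat.clog 2 (8 * K * (J + 2)) ≤ Nat.clog 2 (8 * K) + (J + 2) := by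
  refine Nat.clog_le_of_le_pow ?_
  rw [pow_add]
  exact Nat.mul_le_mul (Nat.le_pow_clog (by norm_num) _) Nat.lt_two_pow_self.le

/-- The expected cost of a column at level J is quadratic in J + 2: one factor counts the bad
shifts, the other comes from the length of the radius. The geometric weights absorb it; 1536 =
16·96. -/
theorem tsum_geo_noiseBits_le {d s K : ℕ} (hs : 1 ≤ s) (hK : 1 ≤ K) (S : ℕ → ℤ) :
    ∑' u, unif s u * ∑' J, geo J * noiseBits d s K u J S
      ≤ (s : ℝ≥0∞)⁻¹ * ((d * (1536 * Nat.clog 2 (8 * K)) : ℕ) : ℝ≥0∞) := by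
  set A := Nat.clog 2 (8 * K) with hA
  have hA2 : 2 ≤ A := by
    have : Nat.clog 2 4 ≤ A := Nat.clog_mono_right 2 (by omega)
    exact le_trans (by decide) this
  calc _ = ∑' J, geo J * ∑' u, unif s u * noiseBits d s K u J S := by
        simp only [← ENNReal.tsum_mul_left]
        rw [ENNReal.tsum_comm]
        refine tsum_congr fun J => tsum_congr fun u => ?_
        ring
    _ ≤ ∑' J : ℕ, ((s : ℝ≥0∞)⁻¹ * ((d * (16 * A) : ℕ) : ℝ≥0∞))
          * ((2⁻¹ : ℝ≥0∞) ^ J * ((J + 1 : ℕ) : ℝ≥0∞) ^ 3) := by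
        refine ENNReal.tsum_le_tsum fun J => ?_
        have h1 := clog_mul_le K J
        have h2 : d * (2 * (J + 2) * (4 * Nat.clog 2 (8 * K * (J + 2))))
            ≤ 2 * (d * (16 * A) * (J + 1) ^ 3) := by
          have h3 : Nat.clog 2 (8 * K * (J + 2)) ≤ A * (J + 2) := by
            refine h1.trans ?_
            rw [← hA]
            nlinarith
          have h4 : (J + 2) ^ 2 ≤ 4 * (J + 1) ^ 3 := by
            calc (J + 2) ^ 2 ≤ (2 * (J + 1)) ^ 2 := by gcongr; omega
              _ = 4 * (J + 1) ^ 2 := by ring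
              _ ≤ _ := by gcongr <;> omega
          calc _ ≤ d * (2 * (J + 2) * (4 * (A * (J + 2)))) := by gcongr
            _ = d * (8 * A) * (J + 2) ^ 2 := by ring
            _ ≤ d * (8 * A) * (4 * (J + 1) ^ 3) := by gcongr
            _ = _ := by ring
        have hhalf : geo J = 2⁻¹ * 2⁻¹ ^ J := by rw [geo, pow_succ, mul_comm]
        have htwo : (2⁻¹ : ℝ≥0∞) * 2 = 1 := ENNReal.inv_mul_cancel (by norm_num) (by norm_num)
        calc _ ≤ geo J * ((s : ℝ≥0∞)⁻¹ * ((2 * (d * (16 * A) * (J + 1) ^ 3) : ℕ) : ℝ≥0∞)) :=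
              mul_le_mul_right ((tsum_noiseBits_le hs hK J S).trans
                (mul_le_mul_right (Nat.cast_le.2 h2) _)) _
          _ = (2⁻¹ * 2) * (((s : ℝ≥0∞)⁻¹ * ((d * (16 * A) : ℕ) : ℝ≥0∞))
              * ((2⁻¹ : ℝ≥0∞) ^ J * ((J + 1 : ℕ) : ℝ≥0∞) ^ 3)) := by
              rw [hhalf]; push_cast; ring
          _ = _ := by rw [htwo, one_mul]
    _ ≤ (s : ℝ≥0∞)⁻¹ * ((d * (16 * A) : ℕ) : ℝ≥0∞) * 96 := by
        rw [ENNReal.tsum_mul_left]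
        exact mul_le_mul_right tsum_geometric_cube_le _
    _ = _ := by push_cast; ring

theorem lintegral_bits_le {d s K : ℕ} {ε : ℝ} (hs : 1 ≤ s) (hK : 1 ≤ K)
    (hKε : ⌈(d : ℝ) / ε⌉ = K) (x : List (Record d)) :
    ∫⁻ σ, (σ.bits : ℝ≥0∞) ∂(finalState program d s ε x)
      ≤ (2 * Nat.clog 2 s + 2 : ℕ)
        + (s : ℝ≥0∞)⁻¹ * ((d * (1536 * Nat.clog 2 (8 * K)) : ℕ) : ℝ≥0∞) := by
  obtain ⟨l, hfit⟩ := exists_fits d s K x.length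
  obtain ⟨μ, hμ, -⟩ := runs_program_input hs hK hKε hfit
  refine (hμ.bits 0 0).trans ?_
  simp only [mul_add]
  rw [ENNReal.tsum_add, ENNReal.tsum_mul_right, tsum_unif (by omega), one_mul, Nat.cast_zero,
    zero_add, ← add_assoc]
  refine add_le_add (le_of_eq ?_) (tsum_geo_noiseBits_le hs hK _)
  push_cast
  rfl

theorem clog_le_log {N : ℕ} (hN : 1 ≤ N) : (Nat.clog 2 N : ℝ) ≤ 2 * Real.log N + 1 := by
  rcases Nat.eq_or_lt_of_le hN with rfl | h
  · simp
  have h1 : 2 ^ (Nat.clog 2 N - 1) < N := Nat.pow_pred_clog_lt_self (by norm_num) h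
  have h2 : 1 ≤ Nat.clog 2 N := Nat.clog_pos (by norm_num) h
  have h3 : ((2 : ℝ) ^ (Nat.clog 2 N - 1)) ≤ N := by exact_mod_cast h1.le
  have h4 := Real.log_le_log (by positivity) h3
  rw [Real.log_pow, Nat.cast_sub h2, Nat.cast_one] at h4
  have h5 : (0 : ℝ) ≤ (Nat.clog 2 N : ℝ) - 1 := by
    rw [sub_nonneg]; exact_mod_cast h2
  have h6 := Real.log_two_gt_d9
  nlinarith

theorem two_lt_log {t : ℝ} (ht : 10 < t) : 2 < Real.log t := by
  rw [Real.lt_log_iff_exp_lt (by linarith)]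
  have h : Real.exp 2 = Real.exp 1 ^ 2 := by rw [← Real.exp_nat_mul]; norm_num
  have := Real.exp_one_lt_d9
  have h0 := Real.exp_pos 1
  rw [h]
  nlinarith

/-- The integer handed to the program in place of `ε`. -/
theorem exists_ceil {t : ℝ} (ht : 10 < t) :
    ∃ K : ℕ, ⌈t⌉ = K ∧ 1 ≤ K ∧ t ≤ K ∧ (K : ℝ) ≤ 2 * t := by
  have h0 : 0 < ⌈t⌉ := Int.ceil_pos.2 (by linarith)
  have h1 : ((⌈t⌉.toNat : ℕ) : ℤ) = ⌈t⌉ := Int.toNat_of_nonneg h0.le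
  have h2 : ((⌈t⌉.toNat : ℕ) : ℝ) = ⌈t⌉ := by exact_mod_cast congrArg (Int.cast (R := ℝ)) h1
  refine ⟨⌈t⌉.toNat, h1.symm, by omega, ?_, ?_⟩
  · rw [h2]; exact Int.le_ceil t
  · rw [h2]
    have := Int.ceil_lt_add_one t
    linarith

theorem randomness_le {d s : ℕ} {ε : ℝ} (hs : 1 ≤ s) (ht : 10 < (d : ℝ) / ε) :
    randomness program d s ε
      ≤ ENNReal.ofReal (20000 * ((d : ℝ) / s * Real.log (d / ε) + Real.log s)) := by
  obtain ⟨K, hKε, hK, -, hKt⟩ := exists_ceil ht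
  have hd : 1 ≤ d := by
    rcases Nat.eq_zero_or_pos d with rfl | h
    · norm_num at ht
    · exact h
  have hΛ := two_lt_log ht
  set t := (d : ℝ) / ε with htdef
  have hs' : (1 : ℝ) ≤ s := by exact_mod_cast hs
  have hd' : (1 : ℝ) ≤ d := by exact_mod_cast hd
  have hK8 : (Nat.clog 2 (8 * K) : ℝ) ≤ 6 * Real.log t := by
    have h1 := clog_le_log (N := 8 * K) (by omega)
    have h2 : Real.log ((8 * K : ℕ) : ℝ) ≤ Real.log (2 ^ 4 * t) := by
      refine Real.log_le_log (by positivity) ?_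
      push_cast
      linarith
    rw [Real.log_mul (by norm_num) (by linarith), Real.log_pow] at h2
    have h3 := Real.log_two_lt_d9
    push_cast at h1 h2
    linarith
  -- The additive constant is absorbed by log s if s ≥ 2; if s = 1, it is absorbed by d·log(d/ε),
  -- because d/ε > 10 gives log(d/ε) > 2.
  have hlogs : (2 * Nat.clog 2 s + 2 : ℝ) ≤ 2 * (d / s * Real.log t) + 12 * Real.log s := by
    rcases Nat.eq_or_lt_of_le hs with rfl | h
    · norm_num
      nlinarith
    · have h1 := clog_le_log hs
      have h2 : Real.log 2 ≤ Real.log s := Real.log_le_log (by norm_num) (by exact_mod_cast h)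
      have h3 := Real.log_two_gt_d9
      have h4 : 0 ≤ (d : ℝ) / s * Real.log t := by positivity
      linarith
  refine iSup_le fun x => (lintegral_bits_le hs hK hKε x).trans ?_
  calc _ = ENNReal.ofReal ((2 * Nat.clog 2 s + 2 : ℝ)
        + (s : ℝ)⁻¹ * (d * (1536 * Nat.clog 2 (8 * K)))) := by
        rw [ENNReal.ofReal_add (by positivity) (by positivity), ENNReal.ofReal_mul (by positivity),
          ENNReal.ofReal_inv_of_pos (by linarith), ENNReal.ofReal_natCast]
        simp only [← ENNReal.ofReal_natCast]
        push_cast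
        rfl
    _ ≤ _ := by
        refine ENNReal.ofReal_le_ofReal ?_
        have h1 : (s : ℝ)⁻¹ * (d * (1536 * Nat.clog 2 (8 * K)))
            ≤ (s : ℝ)⁻¹ * (d * (1536 * (6 * Real.log t))) := by gcongr
        have h2 : (s : ℝ)⁻¹ * (d * (1536 * (6 * Real.log t)))
            = 9216 * (d / s * Real.log t) := by ring
        have h4 : 0 ≤ (d : ℝ) / s * Real.log t := by positivity
        have h5 : 0 ≤ Real.log s := Real.log_nonneg hs'
        linarith

/-! ### Running time -/

theorem expectedTime_le_of_fits {d s K l : ℕ} {ε : ℝ} {x : List (Record d)} (hs : 1 ≤ s)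
    (hK : 1 ≤ K) (hKε : ⌈(d : ℝ) / ε⌉ = K) (hfit : Fits d s K x.length 0 l) :
    expectedTime program d s ε x
      ≤ ((288 * program.weight * ((d + 1) * (x.length + 1) * (l + 2) ^ 3) : ℕ) : ℝ≥0∞) := by
  obtain ⟨μ, hμ, -⟩ := runs_program_input hs hK hKε hfit
  refine (hμ.time 0 0).trans ?_
  rw [Nat.cast_zero, zero_add]
  have h1 : ∑' i : ℕ, (2⁻¹ : ℝ≥0∞) ^ i * ((l + i + 2 : ℕ) : ℝ≥0∞) ^ 3
      ≤ (((l + 2) ^ 3 : ℕ) : ℝ≥0∞) * 96 := by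
    -- Uses l + i + 2 ≤ (l + 2)(i + 1) to separate the word length from the level.
    refine le_trans ?_ (mul_le_mul_right tsum_geometric_cube_le _)
    rw [← ENNReal.tsum_mul_left]
    refine ENNReal.tsum_le_tsum fun i => ?_
    rw [mul_left_comm]
    refine mul_le_mul_right ?_ _
    rw [← Nat.cast_pow, ← Nat.cast_pow, ← Nat.cast_mul, ← mul_pow]
    refine Nat.cast_le.2 (Nat.pow_le_pow_left ?_ 3)
    nlinarith
  refine (mul_le_mul_right h1 _).trans (le_of_eq ?_)
  push_cast
  ring

theorem log_natCast_add_one_le (n : ℕ) : Real.log ((n : ℝ) + 1) ≤ n := by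
  have := Real.log_le_sub_one_of_pos (show (0 : ℝ) < n + 1 by positivity)
  linarith

theorem log_div_le {d : ℝ} {ε : ℝ} (hd : 0 < d) (hε : 0 < ε) :
    Real.log (d / ε) ≤ d + max (Real.log (1 / ε)) 0 := by
  rw [div_eq_mul_one_div, Real.log_mul hd.ne' (by positivity)]
  have h1 := Real.log_le_sub_one_of_pos hd
  have h2 := le_max_left (Real.log (1 / ε)) 0
  linarith

theorem expectedTime_le {d s : ℕ} {ε : ℝ} (hs : 1 ≤ s) (hε : 0 < ε) (ht : 10 < (d : ℝ) / ε)
    (x : List (Record d)) :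
    expectedTime program d s ε x ≤ ENNReal.ofReal (9216000 * program.weight *
      ((x.length : ℝ) + d + Real.log s + max (Real.log (1 / ε)) 0) ^ 5) := by
  obtain ⟨K, hKε, hK, -, hKt⟩ := exists_ceil ht
  have hd : 1 ≤ d := by
    rcases Nat.eq_zero_or_pos d with rfl | h
    · norm_num at ht
    · exact h
  have hs' : (1 : ℝ) ≤ s := by exact_mod_cast hs
  have hd' : (1 : ℝ) ≤ d := by exact_mod_cast hd
  have hK' : (1 : ℝ) ≤ K := by exact_mod_cast hK
  have hn0 : (0 : ℝ) ≤ x.length := Nat.cast_nonneg _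
  have hls : 0 ≤ Real.log s := Real.log_nonneg hs'
  have hm0 : 0 ≤ max (Real.log (1 / ε)) 0 := le_max_right _ _
  set l := Nat.clog 2 (64 * ((x.length + 1) * (d + 1) * (s * K) * (0 + 2))) with hl
  have hfit : Fits d s K x.length 0 l := Nat.le_pow_clog (by norm_num) _
  set X := (x.length : ℝ) + d + Real.log s + max (Real.log (1 / ε)) 0 with hX
  -- The word length is the logarithm of a product of all parameters, hence linear in X. The
  -- exponent 5 consists of d + 1, the number of records plus 1, and the cubed word length.
  have hl2 : ((l + 2 : ℕ) : ℝ) ≤ 20 * X := by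
    have hpos : 0 < (x.length + 1) * (d + 1) * (s * K) := by positivity
    have h1 := clog_le_log (N := 64 * ((x.length + 1) * (d + 1) * (s * K) * (0 + 2))) (by omega)
    have h2 : Real.log ((64 * ((x.length + 1) * (d + 1) * (s * K) * (0 + 2)) : ℕ) : ℝ)
        = 7 * Real.log 2 + (Real.log (x.length + 1) + Real.log (d + 1) + (Real.log s
          + Real.log K)) := by
      rw [show ((64 * ((x.length + 1) * (d + 1) * (s * K) * (0 + 2)) : ℕ) : ℝ)
        = 2 ^ 7 * (((x.length : ℝ) + 1) * (d + 1) * (s * K)) by push_cast; ring,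
        Real.log_mul (by positivity) (by positivity), Real.log_mul (by positivity) (by positivity),
        Real.log_mul (by positivity) (by positivity), Real.log_mul (by positivity) (by positivity),
        Real.log_pow]
      norm_num
    have h3 : Real.log K ≤ Real.log 2 + Real.log (d / ε) := by
      rw [← Real.log_mul (by norm_num) (by linarith)]
      exact Real.log_le_log (by linarith) hKt
    have h4 := log_div_le (show (0 : ℝ) < d by linarith) hε
    have h5 := log_natCast_add_one_le x.length
    have h6 := log_natCast_add_one_le d
    have h7 := Real.log_two_lt_d9
    rw [← hl, h2] at h1
    push_cast
    linarith
  have hX1 : 1 ≤ X := by linarith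
  refine (expectedTime_le_of_fits hs hK hKε hfit).trans ?_
  rw [← ENNReal.ofReal_natCast]
  refine ENNReal.ofReal_le_ofReal ?_
  have h1 : ((d : ℝ) + 1) ≤ 2 * X := by linarith
  have h2 : ((x.length : ℝ) + 1) ≤ 2 * X := by linarith
  calc ((288 * program.weight * ((d + 1) * (x.length + 1) * (l + 2) ^ 3) : ℕ) : ℝ)
      = 288 * program.weight * (((d : ℝ) + 1) * (x.length + 1) * ((l + 2 : ℕ) : ℝ) ^ 3) := by
        push_cast; ring
    _ ≤ 288 * program.weight * ((2 * X) * (2 * X) * (20 * X) ^ 3) := by gcongr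
    _ = _ := by ring

/-! ### Accuracy -/

theorem cubeMean_le_one {d R : ℕ} {S : Fin d → ℤ} {G : (Fin d → ℤ) → ℝ≥0∞} (h : ∀ y, G y ≤ 1) :
    cubeMean R S G ≤ 1 := by
  calc cubeMean R S G ≤ cubeMean R S fun _ => 1 :=
        ENNReal.tsum_le_tsum fun z => mul_le_mul_right (h _) _
    _ = 1 := cubeMean_of_forall fun _ _ => rfl

theorem tsum_geo_tail (q : ℕ) : ∑' J, (if J ≤ q then 0 else geo J) = 2⁻¹ ^ (q + 1) := by
  rw [← (ENNReal.summable (f := fun J => if J + (q + 1) ≤ q then 0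
    else geo (J + (q + 1)))).sum_add_tsum_nat_add' (k := q + 1)
    (f := fun J => if J ≤ q then 0 else geo J)]
  rw [Finset.sum_eq_zero fun J hJ => if_pos (by have := Finset.mem_range.1 hJ; omega), zero_add]
  calc _ = ∑' J, 2⁻¹ ^ (q + 1) * geo J := by
        refine tsum_congr fun J => ?_
        rw [if_neg (by omega), geo, geo, ← pow_add]
        congr 1
        omega
    _ = _ := by rw [ENNReal.tsum_mul_left, tsum_geo, mul_one]

/-- The shift and the remainder both lie between 0 and the width, and the error is their difference.
-/
theorem abs_rnd_sub_le {s K u : ℕ} (hK : 1 ≤ K) (hu : u < s) (y : ℤ) :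
    |rnd (width s K) (u * (4 * K) : ℕ) y - y| ≤ (if 1 < s then s * (4 * K) else 0 : ℕ) := by
  have hW : (0 : ℤ) < width s K := Int.natCast_pos.2 (width_pos hK)
  by_cases h : 1 < s
  · have hWe : width s K = s * (4 * K) := if_pos h
    rw [if_pos h, rnd]
    have h1 := Int.mul_ediv_add_emod (y + (u * (4 * K) : ℕ)) (width s K)
    have h2 := Int.emod_nonneg (y + (u * (4 * K) : ℕ)) hW.ne'
    have h3 := Int.emod_lt_of_pos (y + (u * (4 * K) : ℕ)) hW
    have h4 : u * (4 * K) ≤ s * (4 * K) := Nat.mul_le_mul_right _ hu.le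
    rw [abs_le]
    constructor <;> omega
  · obtain rfl : u = 0 := by omega
    rw [if_neg h, rnd, width, if_neg h]
    simp

theorem measurableSet_lt_norm_sub {d : ℕ} (α : ℝ) (v : Fin d → ℝ) :
    MeasurableSet {y : Fin d → ℝ | α < ‖y - v‖} :=
  measurableSet_lt measurable_const (measurable_norm.comp (measurable_id.sub_const v))

theorem norm_sub_total_le {d : ℕ} {x : List (Record d)} {y : Fin d → ℤ} {B : ℕ}
    (h : ∀ k, |y k - counts x k| ≤ B) : ‖(fun k => (y k : ℝ)) - total x‖ ≤ B := by
  rw [pi_norm_le_iff_of_nonneg (Nat.cast_nonneg _)]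
  intro k
  rw [Pi.sub_apply, ← counts_cast, Real.norm_eq_abs, ← Int.cast_sub, ← Int.cast_abs]
  exact_mod_cast h k

/-- Up to level q the error is deterministically bounded by the largest radius plus the width; only
higher levels can violate the bound. -/
theorem mechanism_lt_norm_le {d s K q : ℕ} {ε α : ℝ} (hs : 1 ≤ s) (hK : 1 ≤ K)
    (hKε : ⌈(d : ℝ) / ε⌉ = K) (x : List (Record d))
    (hα : ((4 * K * (q + 2) + (if 1 < s then s * (4 * K) else 0) : ℕ) : ℝ) ≤ α) :
    mechanism program d s ε x {y | α < ‖y - total x‖} ≤ 2⁻¹ ^ (q + 1) := by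
  rw [mechanism_apply x (measurableSet_lt_norm_sub α _),
    lintegral_output hs hK hKε x fun y => Set.indicator {y | α < ‖y - total x‖} 1
      fun k => (y k : ℝ)]
  have hind : ∀ y : Fin d → ℝ,
      Set.indicator {y : Fin d → ℝ | α < ‖y - total x‖} (1 : (Fin d → ℝ) → ℝ≥0∞) y ≤ 1 :=
    fun y => Set.indicator_le_self' (fun _ _ => zero_le) y
  calc _ ≤ ∑' u, unif s u * 2⁻¹ ^ (q + 1) := by
        refine ENNReal.tsum_le_tsum fun u => ?_
        by_cases hu : u < s
        swap
        · simp [unif, hu]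
        refine mul_le_mul_right ?_ _
        rw [← tsum_geo_tail]
        refine ENNReal.tsum_le_tsum fun J => ?_
        split_ifs with hJ
        · rw [nonpos_iff_eq_zero, mul_eq_zero]
          right
          refine ENNReal.tsum_eq_zero.2 fun I => ?_
          by_cases hI : I < 4 * K
          swap
          · simp [unif, hI]
          rw [mul_eq_zero]
          right
          refine cubeMean_of_forall fun y hy => Set.indicator_of_notMem ?_ _
          rw [Set.mem_ofPred_eq, not_lt]
          refine le_trans (norm_sub_total_le fun k => ?_) hα
          have h1 := abs_rnd_sub_le hK hu (y k)
          have h2 := hy k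
          have h3 : 4 * K * (J + 1) + I ≤ 4 * K * (q + 2) := by
            have : 4 * K * (J + 2) ≤ 4 * K * (q + 2) := Nat.mul_le_mul_left _ (by omega)
            have : 4 * K * (J + 2) = 4 * K * (J + 1) + 4 * K := by ring
            omega
          have h4 := abs_sub_le (rnd (width s K) (u * (4 * K) : ℕ) (y k)) (y k) (counts x k)
          rw [Nat.cast_add]
          have h5 : ((4 * K * (J + 1) + I : ℕ) : ℤ) ≤ (4 * K * (q + 2) : ℕ) := Int.ofNat_le.2 h3
          linarith
        · calc _ ≤ geo J * ∑' I, unif (4 * K) I * 1 := by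
                refine mul_le_mul_right (ENNReal.tsum_le_tsum fun I => mul_le_mul_right ?_ _) _
                exact cubeMean_le_one fun y => hind _
            _ = geo J := by simp only [mul_one]; rw [tsum_unif (by omega), mul_one]
    _ = _ := by rw [ENNReal.tsum_mul_right, tsum_unif (by omega), one_mul]

/-- In dimension one, the noise is small with at least the expected probability. -/
theorem le_cubeMean {R a : ℕ} (ha : a ≤ R) {S : Fin 1 → ℤ} {G : (Fin 1 → ℤ) → ℝ≥0∞}
    (hG : ∀ y, |y 0 - S 0| ≤ a → G y = 1) :
    ((2 * a + 1 : ℕ) : ℝ≥0∞) * ((2 * R + 1 : ℕ) : ℝ≥0∞)⁻¹ ≤ cubeMean R S G := by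
  have hinj : Function.Injective fun (k : ℕ) (_ : Fin 1) => S 0 + ((k : ℤ) - a) := fun k k' h => by
    have := congrFun h 0
    simp only at this
    omega
  have hterm : ∀ k ∈ Finset.range (2 * a + 1), ((2 * R + 1 : ℕ) : ℝ≥0∞)⁻¹
      = (fun y : Fin 1 → ℤ => (if ∀ i, |y i - S i| ≤ R then (((2 * R + 1 : ℕ) : ℝ≥0∞) ^ 1)⁻¹
        else 0) * G y) (fun _ => S 0 + ((k : ℤ) - a)) := by
    intro k hk
    have hk' := Finset.mem_range.1 hk
    have h1 : |S 0 + ((k : ℤ) - a) - S 0| ≤ a := by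
      rw [abs_le]
      constructor <;> omega
    have h2 : ∀ i : Fin 1, |S 0 + ((k : ℤ) - a) - S i| ≤ R := fun i => by
      rw [Subsingleton.elim i 0]
      exact h1.trans (by exact_mod_cast ha)
    have h3 := hG (fun _ => S 0 + ((k : ℤ) - a)) h1
    simp only
    rw [if_pos h2, h3, pow_one, mul_one]
  rw [cubeMean_eq_tsum]
  calc _ = ∑ _k ∈ Finset.range (2 * a + 1), ((2 * R + 1 : ℕ) : ℝ≥0∞)⁻¹ := by
        rw [Finset.sum_const, Finset.card_range, nsmul_eq_mul]
    _ ≤ _ := by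
        rw [Finset.sum_congr rfl hterm]
        exact (ENNReal.sum_le_tsum _).trans (ENNReal.tsum_comp_le_tsum_of_injective hinj _)

/-- Here α may be small compared with K, where a bound on the radius is useless. Level 0 occurs with
probability 1/2 and has radius R below 8K. If ⌊α⌋ ≤ R, it places the noise within α with conditional
probability at least (2⌊α⌋+1)/(16K); otherwise it always succeeds, and β ≥ 1/2 suffices. -/
theorem mechanism_lt_norm_le_of_one {K : ℕ} {ε α β : ℝ} (hK : 1 ≤ K)
    (hKε : ⌈((1 : ℕ) : ℝ) / ε⌉ = K) (x : List (Record 1)) (hα : 0 ≤ α) (hβ : 1 / 2 ≤ β)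
    (hαβ : 32 * K * (1 - β) ≤ α) :
    mechanism program 1 1 ε x {y | α < ‖y - total x‖} ≤ ENNReal.ofReal β := by
  have hprob : IsProbabilityMeasure (mechanism program 1 1 ε x) := by
    have : IsProbabilityMeasure (finalState program 1 1 ε x) :=
      haltsAlmostSurely_program le_rfl hK hKε x
    exact (Measure.isProbabilityMeasure_map (measurable_of_state _).aemeasurable)
  set A := {y : Fin 1 → ℝ | α < ‖y - total x‖} with hA
  have hAm : MeasurableSet A := measurableSet_lt_norm_sub α _
  have hgood : ENNReal.ofReal (1 - β) ≤ mechanism program 1 1 ε x Aᶜ := by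
    rw [mechanism_apply x hAm.compl,
      lintegral_output le_rfl hK hKε x fun y => Set.indicator Aᶜ 1 fun k => (y k : ℝ)]
    -- Only the shift u = 0 exists, and afterwards only the level J = 0 is kept.
    refine le_trans ?_ (ENNReal.le_tsum 0)
    rw [show unif 1 0 = 1 by simp [unif], one_mul]
    refine le_trans ?_ (ENNReal.le_tsum 0)
    have hc : ∀ I < 4 * K, ENNReal.ofReal (2 * (1 - β)) ≤ cubeMean (4 * K * (0 + 1) + I)
        (fun k : Fin 1 => counts x k) fun y => Set.indicator Aᶜ 1 fun k =>
          ((rnd (width 1 K) (0 * (4 * K) : ℕ) (y k) : ℤ) : ℝ) := by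
      intro I hI
      set R := 4 * K * (0 + 1) + I with hR
      refine le_trans ?_ (le_cubeMean (min_le_right ⌊α⌋₊ R) ?_)
      · have hR' : 2 * R + 1 ≤ 16 * K := by omega
        have hR'' : ((2 * R + 1 : ℕ) : ℝ) ≤ 16 * K := by exact_mod_cast hR'
        rw [← ENNReal.ofReal_natCast, ← ENNReal.ofReal_natCast, ← ENNReal.ofReal_inv_of_pos
          (by positivity), ← ENNReal.ofReal_mul (by positivity)]
        refine ENNReal.ofReal_le_ofReal ?_
        rw [← div_eq_mul_inv, le_div_iff₀ (by positivity)]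
        rcases le_total ⌊α⌋₊ R with h | h
        · rw [min_eq_left h]
          have h1 := Nat.lt_floor_add_one α
          have h2 : (0 : ℝ) ≤ ⌊α⌋₊ := Nat.cast_nonneg _
          rcases le_total β 1 with h4 | h4
          · have h3 : 2 * (1 - β) * ((2 * R + 1 : ℕ) : ℝ) ≤ 2 * (1 - β) * (16 * K) := by
              gcongr
            push_cast at h3 ⊢
            linarith
          · have h3 : 2 * (1 - β) * ((2 * R + 1 : ℕ) : ℝ) ≤ 0 :=
              mul_nonpos_of_nonpos_of_nonneg (by linarith) (Nat.cast_nonneg _)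
            refine h3.trans (Nat.cast_nonneg _)
        · rw [min_eq_right h]
          have : (0 : ℝ) ≤ ((2 * R + 1 : ℕ) : ℝ) := Nat.cast_nonneg _
          nlinarith
      · intro y hy
        refine Set.indicator_of_mem ?_ _
        rw [hA, Set.mem_compl_iff, Set.mem_ofPred_eq, not_lt]
        refine le_trans (norm_sub_total_le (B := ⌊α⌋₊) fun k => ?_) (Nat.floor_le hα)
        rw [Subsingleton.elim k 0]
        have h1 := abs_rnd_sub_le (s := 1) hK zero_lt_one (y 0)
        rw [if_neg (lt_irrefl 1), Nat.cast_zero, abs_nonpos_iff, sub_eq_zero] at h1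
        rw [h1]
        exact hy.trans (by exact_mod_cast min_le_left _ _)
    calc ENNReal.ofReal (1 - β) = geo 0 * ∑' I, unif (4 * K) I * ENNReal.ofReal (2 * (1 - β)) := by
          rw [ENNReal.tsum_mul_right, tsum_unif (by omega), one_mul, geo, zero_add, pow_one,
            ENNReal.ofReal_mul zero_le_two, ← mul_assoc, ENNReal.ofReal_ofNat,
            ENNReal.inv_mul_cancel (by norm_num) (by norm_num), one_mul]
      _ ≤ _ := by
          refine mul_le_mul_right (ENNReal.tsum_le_tsum fun I => ?_) _
          by_cases hI : I < 4 * K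
          · exact mul_le_mul_right (hc I hI) _
          · simp [unif, hI]
  have h1 := prob_compl_eq_one_sub (μ := mechanism program 1 1 ε x) hAm.compl
  rw [compl_compl] at h1
  rw [h1]
  refine (tsub_le_tsub_left hgood 1).trans ?_
  rw [← ENNReal.ofReal_one]
  rcases le_total β 1 with h | h
  · rw [← ENNReal.ofReal_sub _ (by linarith)]
    exact ENNReal.ofReal_le_ofReal (by linarith)
  · exact tsub_le_self.trans (ENNReal.ofReal_le_ofReal h)

theorem IsAccurate.mono {d : ℕ} {α α' β : ℝ} {M : List (Record d) → Measure (Fin d → ℝ)}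
    (h : IsAccurate α β M) (hα : α ≤ α') : IsAccurate α' β M := fun x =>
  (measure_mono fun _ hy => lt_of_le_of_lt hα hy).trans (h x)

theorem one_le_of_lt_div {d : ℕ} {ε : ℝ} (ht : 10 < (d : ℝ) / ε) : 1 ≤ d := by
  rcases Nat.eq_zero_or_pos d with rfl | h
  · norm_num at ht
  · exact h

theorem exists_geometric_tail_le {β : ℝ} (hβ : 0 < β) (hβ1 : β ≤ 1) :
    ∃ q : ℕ, (2⁻¹ : ℝ≥0∞) ^ (q + 1) ≤ ENNReal.ofReal β ∧ (q : ℝ) ≤ 2 * Real.log (1 / β) := by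
  have h2 := Real.log_two_gt_d9
  have hb : 0 ≤ Real.log (1 / β) := Real.log_nonneg (by rwa [le_div_iff₀ hβ, one_mul])
  -- The integer part of the binary logarithm of 1/β; the factor 2 bounds 1/log 2.
  refine ⟨⌊Real.log (1 / β) / Real.log 2⌋₊, ?_, ?_⟩
  · set q := ⌊Real.log (1 / β) / Real.log 2⌋₊
    have h3 : Real.log (1 / β) < (q + 1) * Real.log 2 := by
      rw [← div_lt_iff₀ (by linarith)]
      exact Nat.lt_floor_add_one _
    have h4 : (1 / β) < 2 ^ (q + 1) := by
      rw [← Real.log_lt_log_iff (by positivity) (by positivity), Real.log_pow]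
      exact_mod_cast h3
    have h5 : (2⁻¹ : ℝ) ^ (q + 1) ≤ β := by
      rw [inv_pow, inv_le_comm₀ (by positivity) hβ, ← one_div]
      exact h4.le
    calc (2⁻¹ : ℝ≥0∞) ^ (q + 1) = ENNReal.ofReal ((2⁻¹ : ℝ) ^ (q + 1)) := by
          rw [ENNReal.ofReal_pow (by norm_num), ENNReal.ofReal_inv_of_pos (by norm_num)]
          norm_num
      _ ≤ _ := ENNReal.ofReal_le_ofReal h5
  · refine (Nat.floor_le (by positivity)).trans ?_
    rw [div_le_iff₀ (by linarith)]
    nlinarith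

theorem isAccurate_program {d s : ℕ} {ε β : ℝ} (hs : 1 ≤ s) (hε : 0 < ε)
    (ht : 10 < (d : ℝ) / ε) (hβ : 0 < β) (hβ1 : β ≤ 1) :
    IsAccurate (100 * (d * Real.log (d / β) / ε + s * Real.log s * (d * Real.log (d / ε)) / ε)) β
      (mechanism program d s ε) := by
  obtain ⟨K, hKε, hK, -, hKt⟩ := exists_ceil ht
  have hd := one_le_of_lt_div ht
  have hΛ := two_lt_log ht
  have hd' : (1 : ℝ) ≤ d := by exact_mod_cast hd
  have hs' : (1 : ℝ) ≤ s := by exact_mod_cast hs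
  have hb : 0 ≤ Real.log (1 / β) := Real.log_nonneg (by rwa [le_div_iff₀ hβ, one_mul])
  have hld : 0 ≤ Real.log d := Real.log_nonneg hd'
  have hlog : Real.log (d / β) = Real.log d + Real.log (1 / β) := by
    rw [div_eq_mul_one_div, Real.log_mul (by linarith) (by positivity)]
  rw [show 100 * (d * Real.log (d / β) / ε + s * Real.log s * (d * Real.log (d / ε)) / ε)
    = 100 * (d / ε * Real.log (d / β) + s * Real.log s * (d / ε * Real.log (d / ε))) by ring, hlog]
  have h2 := Real.log_two_gt_d9
  set t := (d : ℝ) / ε with htdef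
  set b := Real.log (1 / β)
  -- In the first case the claimed error is at least a fixed multiple of d/ε, which pays for the
  -- constant part of the tail bound. The remaining case forces s = d = 1 and β ≥ 1/2.
  by_cases hcase : 1 < s ∨ Real.log 2 ≤ Real.log d + b
  · obtain ⟨q, hq, hqb⟩ := exists_geometric_tail_le hβ hβ1
    refine fun x => (mechanism_lt_norm_le hs hK hKε x (q := q) ?_).trans hq
    have h3 : 4 * (K : ℝ) * (q + 2) ≤ 4 * (2 * t) * (2 * b + 2) := by gcongr
    have htb : 0 ≤ t * b := by positivity
    have htd : 0 ≤ t * Real.log d := by positivity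
    by_cases h : 1 < s
    · rw [if_pos h]
      have hs2 : (2 : ℝ) ≤ s := by exact_mod_cast h
      have h4 : Real.log 2 ≤ Real.log s := Real.log_le_log (by norm_num) hs2
      have h5 : (s : ℝ) * (4 * K) ≤ s * (4 * (2 * t)) := by gcongr
      have h6 : (s : ℝ) * (1 / 2) * (t * 2) ≤ s * Real.log s * (t * Real.log t) := by
        gcongr
        linarith
      have h7 : 2 * t ≤ s * t := by gcongr
      push_cast
      linarith
    · rw [if_neg h]
      have h4 := hcase.resolve_left h
      have h5 : t * (1 / 2) ≤ t * (Real.log d + b) := by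
        gcongr
        linarith
      have h6 : 0 ≤ s * Real.log s * (t * Real.log t) := by
        have := Real.log_nonneg hs'
        positivity
      push_cast
      linarith
  · push Not at hcase
    obtain rfl : s = 1 := by omega
    obtain rfl : d = 1 := by
      by_contra h
      have : Real.log 2 ≤ Real.log d :=
        Real.log_le_log (by norm_num) (by exact_mod_cast (by omega : 2 ≤ d))
      linarith
    have hβ2 : 1 / 2 ≤ β := by
      by_contra h
      push Not at h
      have : Real.log 2 ≤ b :=
        Real.log_le_log (by norm_num) (by rw [le_div_iff₀ hβ]; linarith)
      linarith
    have h3 : 1 - β ≤ b := by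
      have := Real.log_le_sub_one_of_pos hβ
      rw [show b = -Real.log β from by simp [b]]
      linarith
    have h4 : 32 * (K : ℝ) * (1 - β) ≤ 32 * (2 * t) * b := by
      gcongr
    have htb : 0 ≤ t * b := by positivity
    refine fun x => mechanism_lt_norm_le_of_one hK hKε x ?_ hβ2 ?_
    · simp only [Nat.cast_one, Real.log_one]
      nlinarith
    · simp only [Nat.cast_one, Real.log_one]
      linarith

/-! ### The choice s = ⌈d log(d/ε)⌉ and the constants -/

theorem ceil_bounds {d s : ℕ} {ε : ℝ} (ht : 10 < (d : ℝ) / ε)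
    (hs : s = ⌈(d : ℝ) * Real.log (d / ε) ^ 1⌉₊) :
    1 ≤ s ∧ (d : ℝ) * Real.log (d / ε) ≤ s ∧ (s : ℝ) ≤ 2 * (d * Real.log (d / ε)) ∧
      Real.log s ≤ 1 + Real.log d + Real.log (Real.log (d / ε)) := by
  have hd := one_le_of_lt_div ht
  have hd' : (1 : ℝ) ≤ d := by exact_mod_cast hd
  have hΛ := two_lt_log ht
  rw [pow_one] at hs
  set Λ := Real.log (d / ε)
  have h1 : 1 ≤ (d : ℝ) * Λ := by nlinarith
  have h2 : (d : ℝ) * Λ ≤ s := hs ▸ Nat.le_ceil _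
  have h3 : (s : ℝ) ≤ 2 * (d * Λ) := by
    have := Nat.ceil_lt_add_one (show 0 ≤ (d : ℝ) * Λ by linarith)
    rw [← hs] at this
    linarith
  have h4 : (1 : ℝ) ≤ s := h1.trans h2
  refine ⟨by exact_mod_cast h4, h2, h3, ?_⟩
  have h5 := Real.log_le_log (by linarith) h3
  rw [Real.log_mul (by norm_num) (by positivity), Real.log_mul (by positivity) (by positivity)] at h5
  have := Real.log_two_lt_d9
  linarith

end PrivateSum

theorem mainTheorem2 :
    ∃ (P : RandProg.Cmd) (C : ℝ) (a b : ℕ),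
      (∀ (d s : ℕ) (ε : ℝ), 1 ≤ s → 0 < ε → 10 < (d : ℝ) / ε →
        (∀ x : List (PrivateSum.Record d), PrivateSum.HaltsAlmostSurely P d s ε x) ∧
        (∀ x : List (PrivateSum.Record d),
          PrivateSum.expectedTime P d s ε x ≤
            ENNReal.ofReal
              (C * ((x.length : ℝ) + d + Real.log s + max (Real.log (1 / ε)) 0) ^ a)) ∧
        PrivateSum.IsDP ε 0 (PrivateSum.mechanism P d s ε) ∧
        PrivateSum.randomness P d s ε ≤
          ENNReal.ofReal (C * ((d : ℝ) / s * Real.log (d / ε) ^ b + Real.log s)) ∧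
        ∀ β : ℝ, 0 < β → β ≤ 1 →
          PrivateSum.IsAccurate
            (C * (d * Real.log (d / β) / ε + s * Real.log s * (d * Real.log (d / ε)) / ε)) β
            (PrivateSum.mechanism P d s ε)) ∧
      (∀ (d s : ℕ) (ε : ℝ), 0 < ε → 10 < (d : ℝ) / ε →
        s = ⌈(d : ℝ) * Real.log (d / ε) ^ b⌉₊ →
        (∀ x : List (PrivateSum.Record d),
          PrivateSum.expectedTime P d s ε x ≤
            ENNReal.ofReal (C * ((x.length : ℝ) + d + max (Real.log (1 / ε)) 0) ^ a)) ∧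
        PrivateSum.randomness P d s ε ≤
          ENNReal.ofReal (C * (Real.log d + Real.log (Real.log (d / ε)))) ∧
        ∀ β : ℝ, 0 < β → β ≤ 1 →
          PrivateSum.IsAccurate
            (C * (d * Real.log (d / β) / ε +
              (d : ℝ) ^ 2 * Real.log (max (d : ℝ) (d / ε)) ^ a / ε)) β
            (PrivateSum.mechanism P d s ε)) := by
  set w : ℝ := (PrivateSum.program.weight : ℝ) with hw
  have hw0 : 0 ≤ w := Nat.cast_nonneg _
  -- The largest demand is 9216000·4^5·w, from the running time in the special case.
  set C : ℝ := 10 ^ 10 * (w + 1) with hC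
  have hC1 : 10 ^ 10 ≤ C := by linarith
  refine ⟨PrivateSum.program, C, 5, 1, fun d s ε hs hε ht => ?_, fun d s ε hε ht hsd => ?_⟩
  · have hd := PrivateSum.one_le_of_lt_div ht
    have hΛ := PrivateSum.two_lt_log ht
    have hs' : (1 : ℝ) ≤ s := by exact_mod_cast hs
    have hd' : (1 : ℝ) ≤ d := by exact_mod_cast hd
    have hls := Real.log_nonneg hs'
    have hm := le_max_right (Real.log (1 / ε)) 0
    obtain ⟨K, hKε, hK, -, -⟩ := PrivateSum.exists_ceil ht
    refine ⟨PrivateSum.haltsAlmostSurely_program hs hK hKε, fun x => ?_,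
      PrivateSum.isDP_program hd hs hK hε hKε, ?_, fun β hβ hβ1 => ?_⟩
    · refine (PrivateSum.expectedTime_le hs hε ht x).trans (ENNReal.ofReal_le_ofReal ?_)
      rw [← hw]
      gcongr
      linarith
    · refine (PrivateSum.randomness_le hs ht).trans (ENNReal.ofReal_le_ofReal ?_)
      rw [pow_one]
      gcongr
      linarith
    · refine (PrivateSum.isAccurate_program hs hε ht hβ hβ1).mono ?_
      have : 0 ≤ Real.log (d / β) := Real.log_nonneg (by rw [le_div_iff₀ hβ]; linarith)
      gcongr
      linarith
  · have hd := PrivateSum.one_le_of_lt_div ht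
    have hΛ := PrivateSum.two_lt_log ht
    have hd' : (1 : ℝ) ≤ d := by exact_mod_cast hd
    obtain ⟨hs, hs1, hs2, hs3⟩ := PrivateSum.ceil_bounds ht hsd
    have hs' : (1 : ℝ) ≤ s := by exact_mod_cast hs
    have hls := Real.log_nonneg hs'
    have hld := Real.log_nonneg hd'
    have hdt := PrivateSum.log_div_le (show (0 : ℝ) < d by linarith) hε
    set Λ := Real.log (d / ε) with hΛdef
    have hlΛ : Real.log Λ ≤ Λ - 1 := Real.log_le_sub_one_of_pos (by linarith)
    have hm := le_max_right (Real.log (1 / ε)) 0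
    refine ⟨fun x => ?_, ?_, fun β hβ hβ1 => ?_⟩
    · refine (PrivateSum.expectedTime_le hs hε ht x).trans (ENNReal.ofReal_le_ofReal ?_)
      rw [← hw]
      have hn : (0 : ℝ) ≤ x.length := Nat.cast_nonneg _
      have h1 : (x.length : ℝ) + d + Real.log s + max (Real.log (1 / ε)) 0
          ≤ 4 * ((x.length : ℝ) + d + max (Real.log (1 / ε)) 0) := by
        have := Real.log_le_sub_one_of_pos (show (0 : ℝ) < d by linarith)
        linarith
      calc _ ≤ 9216000 * w * (4 * ((x.length : ℝ) + d + max (Real.log (1 / ε)) 0)) ^ 5 := by gcongr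
        _ = 9437184000 * w * ((x.length : ℝ) + d + max (Real.log (1 / ε)) 0) ^ 5 := by ring
        _ ≤ _ := by
          gcongr
          linarith
    · refine (PrivateSum.randomness_le hs ht).trans (ENNReal.ofReal_le_ofReal ?_)
      -- With s ≥ dΛ the expected cost of the noise is a constant, and this is absorbed by log Λ ≥
      -- log 2.
      have h1 : (d : ℝ) / s * Λ ≤ 1 := by
        rw [div_mul_eq_mul_div, div_le_one (by linarith)]
        exact hs1
      have h2 : Real.log 2 ≤ Real.log Λ := Real.log_le_log (by norm_num) hΛ.le
      have h3 := Real.log_two_gt_d9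
      calc 20000 * ((d : ℝ) / s * Λ + Real.log s)
          ≤ 100000 * (Real.log d + Real.log Λ) := by linarith
        _ ≤ _ := by gcongr <;> linarith
    · refine (PrivateSum.isAccurate_program hs hε ht hβ hβ1).mono ?_
      rw [← hΛdef]
      have hdβ : 0 ≤ Real.log (d / β) := Real.log_nonneg (by rw [le_div_iff₀ hβ]; linarith)
      set M := Real.log (max (d : ℝ) (d / ε)) with hM
      have h1 : Λ ≤ M := Real.log_le_log (by linarith) (le_max_right _ _)
      have h2 : Real.log d ≤ M := Real.log_le_log (by linarith) (le_max_left _ _)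
      have h3 : Real.log s ≤ 2 * M := by linarith
      -- A third power of M would do; as M > 1, it may be raised to the exponent 5 already fixed for
      -- the running time.
      have h4 : (s : ℝ) * Real.log s * (d * Λ) ≤ 4 * ((d : ℝ) ^ 2 * M ^ 5) := by
        calc (s : ℝ) * Real.log s * (d * Λ) ≤ (2 * (d * M)) * (2 * M) * (d * M) := by
              have : 0 ≤ M := by linarith
              gcongr
              exact hs2.trans (by gcongr)
          _ = 4 * ((d : ℝ) ^ 2 * M ^ 3) := by ring
          _ ≤ _ := by
              gcongr
              · linarith
              · norm_num
      have h5 : (d : ℝ) ^ 2 * M ^ 5 / ε ≥ 0 := by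
        have : 0 ≤ M := by linarith
        positivity
      calc 100 * (d * Real.log (d / β) / ε + s * Real.log s * (d * Λ) / ε)
          ≤ 100 * (d * Real.log (d / β) / ε + 4 * ((d : ℝ) ^ 2 * M ^ 5) / ε) := by gcongr
        _ ≤ 400 * (d * Real.log (d / β) / ε + (d : ℝ) ^ 2 * M ^ 5 / ε) := by
            have : 0 ≤ d * Real.log (d / β) / ε := by positivity
            rw [mul_div_assoc 4]
            linarith
        _ ≤ _ := by
            gcongr
            linarith
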